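/- Let $1\le k\le n$ be integers. Let $A\in C^1(0,\infty)$ be positive and such that $p\mapsto pA(p)$ extends continuously to $[0,\infty)$ with value $0$ at $p=0$ and is strictly increasing on $(0,\infty)$. Let $f:\mathbb R\to\mathbb R$ be positive, continuous and non-decreasing. For $\lambda\in\mathbb R^n$ let $\sigma_l(\lambda)$ be the $l$-th elementary symmetric function and $\Gamma_k=\{\lambda\in\mathbb R^n:\sigma_l(\lambda)>0,\ l=1,\dots,k\}$. For a matrix $M$ write $\lambda(M)$ for its eigenvalues counted with algebraic multiplicity. The field $A(|Du|)Du$ is taken to be $0$ where $Du=0$. Let $\Phi^k(\mathbb R^n)$ be the set of $u\in C^1(\mathbb R^n)$ such that $A(|Du|)Du\in C^1(\mathbb R^n)$ and, at every point of $\mathbb R^n$, the eigenvalues $\lambda(D_i(A(|Du|)D_ju))$ are all real and lie in $\Gamma_k$. Call $u$ a *solution* if $u\in C^2(\mathbb R^n\setminus\{0\})\cap\Phi^k(\mathbb R^n)$ and $$\sigma_k^{1/k}\bigl(\lambda\bigl(D_i(A(|Du|)D_ju)\bigr)\bigr)\ \ge\ f(u)\quad\text{at every point of }\mathbb R^n .$$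 (Solutions are not required to be positive.) Let $\Psi(p)=p\,(pA(p))^k-\int_0^p(tA(t))^k\,dt$ for $p\ge0$; when $\lim_{p\to\infty}pA(p)=\infty$, it is a bijection of $[0,\infty)$ onto itself, with inverse $\Psi^{-1}$. Let $0<c\le b$ be arbitrary. 1. If $\lim_{p\to\infty}pA(p)<\infty$, there is no solution. 2. Suppose $\lim_{p\to\infty}pA(p)=\infty$. If a solution exists, then $$\int_b^\infty\Bigl(\Psi^{-1}\Bigl(\int_c^s f^k(t)\,dt\Bigr)\Bigr)^{-1}ds=\infty .\qquad(\ast)$$ Conversely, if $(pA(p))'>0$ for all $p>0$ and $(\ast)$ holds, then a solution exists. In particular, when $(pA(p))'>0$ on $(0,\infty)$, a solution exists if and only if $(\ast)$ holds. 3. Suppose that $0<\liminf_{p\to\infty}\frac{A(p)}{p^{m-2}}\le\limsup_{p\to\infty}\frac{A(p)}{p^{m-2}}<\infty$ for some $m>1$. If a solution exists, then $$\int_b^\infty\Bigl(\int_c^s f^k(t)\,dt\Bigr)^{-\frac1{k(m-1)+1}}ds=\infty .\qquad(\ast\ast)$$ Conversely, if $(pA(p))'>0$ for all $p>0$ and $(\ast\ast)$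 holds, then a solution exists. In particular, when $(pA(p))'>0$ on $(0,\infty)$, a solution exists if and only if $(\ast\ast)$ holds. -/

import Mathlib

open Set Filter Topology MeasureTheory

noncomputable section

/-- The vector field `A(|Du|) Du` on `ℝⁿ`. It vanishes wherever `Du = 0`, so the value of `A` at `0`
is irrelevant. -/
def fluxField {n : ℕ} (A : ℝ → ℝ) (u : EuclideanSpace ℝ (Fin n) → ℝ) :
    EuclideanSpace ℝ (Fin n) → EuclideanSpace ℝ (Fin n) :=
  fun x => A ‖gradient u x‖ • gradient u x

/-- The matrix `(D_i (A(|Du|) D_j u))_{i,j}` at the point `x`. -/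
def fluxMatrix {n : ℕ} (A : ℝ → ℝ) (u : EuclideanSpace ℝ (Fin n) → ℝ)
    (x : EuclideanSpace ℝ (Fin n)) : Matrix (Fin n) (Fin n) ℝ :=
  Matrix.of fun i j => (fderiv ℝ (fluxField A u) x (EuclideanSpace.single i 1)) j

/-- The real eigenvalues of a matrix, counted with algebraic multiplicity. -/
def eigenvalueMultiset {n : ℕ} (M : Matrix (Fin n) (Fin n) ℝ) : Multiset ℝ :=
  M.charpoly.roots

/-- The cone `Γ_k`: the (unordered) `n`-tuples `λ` of real numbers whose elementary symmetric
functions `σ_l(λ)`, `l = 1, …, k`, are all positive. -/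
def gammaCone (n k : ℕ) : Set (Multiset ℝ) :=
  {lam | Multiset.card lam = n ∧ ∀ l : ℕ, 1 ≤ l → l ≤ k → 0 < lam.esymm l}

/-- The class `Φᵏ(ℝⁿ)`. -/
def PhiClass (n k : ℕ) (A : ℝ → ℝ) : Set (EuclideanSpace ℝ (Fin n) → ℝ) :=
  {u | ContDiff ℝ 1 u ∧ ContDiff ℝ 1 (fluxField A u) ∧
    ∀ x, eigenvalueMultiset (fluxMatrix A u x) ∈ gammaCone n k}

/-- `u ∈ C²(ℝⁿ \ {0}) ∩ Φᵏ(ℝⁿ)` and `σ_k^{1/k}(λ(D_i(A(|Du|) D_j u))) ≥ f(u)` at every point of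
`ℝⁿ`. -/
def IsEntireSolution (n k : ℕ) (A f : ℝ → ℝ) (u : EuclideanSpace ℝ (Fin n) → ℝ) : Prop :=
  ContDiffOn ℝ 2 u {0}ᶜ ∧ u ∈ PhiClass n k A ∧
    ∀ x, f (u x) ≤ ((eigenvalueMultiset (fluxMatrix A u x)).esymm k) ^ (1 / (k : ℝ))

/-- `Ψ(p) = p (p A(p))ᵏ - ∫₀ᵖ (t A(t))ᵏ dt`. -/
def Psi (A : ℝ → ℝ) (k : ℕ) (p : ℝ) : ℝ :=
  p * (p * A p) ^ k - ∫ t in (0 : ℝ)..p, (t * A t) ^ k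

/-- The inverse function of `Ψ : [0, ∞) → [0, ∞)`. -/
def PsiInv (A : ℝ → ℝ) (k : ℕ) : ℝ → ℝ :=
  Function.invFunOn (Psi A k) (Ici 0)

/-- `∫_b^∞ (Ψ⁻¹(∫_c^s fᵏ(t) dt))⁻¹ ds = ∞`. -/
def PsiKellerOsserman (A f : ℝ → ℝ) (k : ℕ) (c b : ℝ) : Prop :=
  ∫⁻ s in Ioi b, ENNReal.ofReal ((PsiInv A k (∫ t in c..s, f t ^ k))⁻¹) = ⊤

/-- `∫_b^∞ (∫_c^s fᵏ(t) dt)^{-1/(k(m-1)+1)} ds = ∞`. -/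
def PowerKellerOsserman (f : ℝ → ℝ) (k : ℕ) (m c b : ℝ) : Prop :=
  ∫⁻ s in Ioi b,
    ENNReal.ofReal ((∫ t in c..s, f t ^ k) ^ (-(1 / ((k : ℝ) * (m - 1) + 1)))) = ⊤

/-- `0 < liminf_{p → ∞} A(p)/p^{m-2} ≤ limsup_{p → ∞} A(p)/p^{m-2} < ∞`, in the extended reals. -/
def PowerGrowth (A : ℝ → ℝ) (m : ℝ) : Prop :=
  0 < liminf (fun p : ℝ => ((A p / p ^ (m - 2) : ℝ) : EReal)) atTop ∧
    limsup (fun p : ℝ => ((A p / p ^ (m - 2) : ℝ) : EReal)) atTop < ⊤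

end

/-!
Necessity. Newton's inequalities give `σ_k ≤ σ₁ᵏ` on `Γ_k`, so a solution satisfies
`f(u) ≤ div (A(|Du|)Du)`. If `pA(p)` is bounded, testing this inequality with compactly supported
functions on larger and larger balls gives a contradiction. If `pA(p)` is unbounded, write
`e(p) = pA(p)` and `ψ = Ψ`; then `d(e(p)ᵏ) = p⁻¹ dψ(p)`. A function `v(|x|)` whose flux `e(v'(r))`
is linear for `r ≤ r₀`, and which satisfies `ψ(v'(r)) = ψ(p₀) + ∫ w(t) dt` (over `t` from `v(r₀)` to
`v(r)`) for `r ≥ r₀`, is found by separation of variables: the radius at which it reaches the height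
`s` is the integral of `1/v'` over heights. If that integral converges, `v` can be made to reach
any height within a fixed radius.
At a local maximum of `u - v(|x|)` the eigenvalues of the flux matrix of `u` are at most those of
the flux matrix of `v(|x|)`, and `σ_k` is monotone on `Γ_k`; hence `u ≤ v(|x|)` outside the ball of
radius `r₀`, and inside it the divergence inequality suffices. With
`v(r₀) = u(0) - 1` this is absurd at the origin.

Sufficiency. The second eigenvalue inequality for `v(|x|)` carries a factor `rᵏ⁻¹`, so `w(t)` must
dominate a power of the radius at which height `t` is reached. Such a bound is built into the weight
by a delay equation for that radius, and the profile is global because the integral diverges.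
-/

section SymmetricFunctions

open Polynomial

lemma multiset_esymm_zero {R : Type*} [CommSemiring R] (s : Multiset R) : s.esymm 0 = 1 := by
  simp [Multiset.esymm]

lemma multiset_esymm_cons_succ {R : Type*} [CommSemiring R] (a : R) (s : Multiset R) (k : ℕ) :
    (a ::ₘ s).esymm (k + 1) = s.esymm (k + 1) + a * s.esymm k := by
  simp only [Multiset.esymm, Multiset.powersetCard_cons, Multiset.map_add, Multiset.sum_add,
    Multiset.map_map, Function.comp_def, Multiset.prod_cons, Multiset.sum_map_mul_left]

lemma multiset_esymm_eq_zero_of_card_lt {R : Type*} [CommSemiring R] {s : Multiset R} {k : ℕ}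
    (h : Multiset.card s < k) : s.esymm k = 0 := by
  simp [Multiset.esymm, Multiset.powersetCard_eq_empty _ h]

lemma multiset_esymm_one {R : Type*} [CommSemiring R] (s : Multiset R) : s.esymm 1 = s.sum := by
  simp [Multiset.esymm, Multiset.powersetCard_one, Multiset.map_map]

lemma multiset_esymm_replicate {R : Type*} [CommSemiring R] (n k : ℕ) (a : R) :
    (Multiset.replicate n a).esymm k = n.choose k * a ^ k := by
  induction n generalizing k with
  | zero =>
    cases k with
    | zero => simp [multiset_esymm_zero]
    | succ k => rw [multiset_esymm_eq_zero_of_card_lt (by simp)]; simp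
  | succ n ih =>
    cases k with
    | zero => simp [multiset_esymm_zero]
    | succ k =>
      rw [Multiset.replicate_succ, multiset_esymm_cons_succ, ih, ih, Nat.choose_succ_succ]
      push_cast
      ring

lemma multiset_esymm_cons_replicate {R : Type*} [CommSemiring R] (n k : ℕ) (a b : R) :
    (a ::ₘ Multiset.replicate n b).esymm (k + 1) =
      n.choose (k + 1) * b ^ (k + 1) + n.choose k * (a * b ^ k) := by
  rw [multiset_esymm_cons_succ, multiset_esymm_replicate, multiset_esymm_replicate]
  ring

lemma splits_derivative {p : ℝ[X]} (hp : p.Splits) : (derivative p).Splits := by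
  refine splits_iff_card_roots.2 (le_antisymm (card_roots' _) ?_)
  have h1 := card_roots_le_derivative p
  have h2 := natDegree_derivative_le p
  rw [← hp.natDegree_eq_card_roots] at h1
  omega

lemma splits_hasseDeriv {p : ℝ[X]} (hp : p.Splits) (j : ℕ) : (hasseDeriv j p).Splits := by
  have hiter : (derivative^[j] p).Splits := by
    induction j with
    | zero => exact hp
    | succ j ih => exact Function.iterate_succ_apply' derivative j p ▸ splits_derivative ih
  have hfact : hasseDeriv j p = C (j.factorial : ℝ)⁻¹ * derivative^[j] p := by
    rw [← factorial_smul_hasseDeriv, LinearMap.smul_apply, nsmul_eq_mul, ← C_eq_natCast,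
      ← mul_assoc, ← C_mul, inv_mul_cancel₀ (by positivity), C_1, one_mul]
  exact hfact ▸ hiter.C_mul _

lemma two_mul_coeff_zero_mul_coeff_two_le_sq {p : ℝ[X]} (hp : p.Splits) :
    2 * (p.coeff 0 * p.coeff 2) ≤ p.coeff 1 ^ 2 := by
  obtain ⟨s, hs⟩ := splits_iff_exists_multiset.1 hp
  have hprod : ∀ s : Multiset ℝ, 2 * ((s.map fun a => X - C a).prod.coeff 0 *
      (s.map fun a => X - C a).prod.coeff 2) ≤ (s.map fun a => X - C a).prod.coeff 1 ^ 2 := by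
    intro s
    induction s using Multiset.induction_on with
    | empty => simp [coeff_one]
    | cons a s ih =>
      rw [Multiset.map_cons, Multiset.prod_cons]
      set q := (s.map fun a => X - C a).prod
      simp only [sub_mul, coeff_sub, coeff_X_mul, coeff_X_mul_zero, coeff_C_mul]
      nlinarith [mul_le_mul_of_nonneg_left ih (sq_nonneg a), sq_nonneg (q.coeff 0)]
  rw [hs]
  simp only [coeff_C_mul]
  nlinarith [mul_le_mul_of_nonneg_left (hprod s) (sq_nonneg p.leadingCoeff)]

lemma coeff_mul_coeff_le_sq {p : ℝ[X]} (hp : p.Splits) (j : ℕ) :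
    p.coeff j * p.coeff (j + 2) ≤ p.coeff (j + 1) ^ 2 := by
  have h := two_mul_coeff_zero_mul_coeff_two_le_sq (splits_hasseDeriv hp j)
  have hchoose : ((j + 2).choose j : ℝ) = (j + 2) * (j + 1) / 2 := by
    rw [Nat.choose_symm_add, Nat.cast_choose_two]
    push_cast
    ring
  simp only [hasseDeriv_coeff, zero_add, Nat.choose_self, Nat.cast_one, one_mul, add_comm 1 j,
    Nat.choose_succ_self_right, Nat.cast_add, add_comm 2 j, hchoose] at h
  by_contra! hlt
  have hpos : 0 < p.coeff j * p.coeff (j + 2) := (sq_nonneg _).trans_lt hlt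
  nlinarith [mul_lt_mul_of_pos_left hlt (show (0 : ℝ) < (j + 1) ^ 2 by positivity),
    mul_pos (show (0 : ℝ) < j + 1 by positivity) hpos]

lemma esymm_mul_esymm_le_sq (s : Multiset ℝ) (k : ℕ) :
    s.esymm k * s.esymm (k + 2) ≤ s.esymm (k + 1) ^ 2 := by
  by_cases hk : Multiset.card s < k + 2
  · rw [multiset_esymm_eq_zero_of_card_lt hk, mul_zero]
    positivity
  obtain ⟨j, hj⟩ := Nat.exists_eq_add_of_le (not_lt.1 hk)
  have hsplits : (s.map fun r => X + C r).prod.Splits :=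
    Splits.multisetProd (Multiset.forall_mem_map_iff.2 fun r _ => Splits.X_add_C r)
  have h := coeff_mul_coeff_le_sq hsplits j
  rw [Multiset.prod_X_add_C_coeff s (by omega), Multiset.prod_X_add_C_coeff s (by omega),
    Multiset.prod_X_add_C_coeff s (by omega), show Multiset.card s - j = k + 2 by omega,
    show Multiset.card s - (j + 1) = k + 1 by omega,
    show Multiset.card s - (j + 2) = k by omega] at h
  rwa [mul_comm]

variable {n k : ℕ} {s t : Multiset ℝ}

lemma esymm_pos_of_mem_gammaCone (hs : s ∈ gammaCone n k) {l : ℕ} (hl : l ≤ k) :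
    0 < s.esymm l := by
  rcases Nat.eq_zero_or_pos l with rfl | h0
  · exact multiset_esymm_zero s ▸ one_pos
  · exact hs.2 l h0 hl

lemma gammaCone_anti {j : ℕ} (hjk : j ≤ k) (hs : s ∈ gammaCone n k) : s ∈ gammaCone n j :=
  ⟨hs.1, fun l h1 hl => hs.2 l h1 (hl.trans hjk)⟩

lemma esymm_succ_pos_of_cons {a : ℝ} (h0 : 0 < s.esymm k) (h1 : 0 < (a ::ₘ s).esymm (k + 1))
    (h2 : 0 < (a ::ₘ s).esymm (k + 2)) : 0 < s.esymm (k + 1) := by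
  rw [multiset_esymm_cons_succ] at h1 h2
  by_contra! hx
  have : 0 < a := pos_of_mul_pos_left (by linarith : 0 < a * s.esymm k) h0.le
  have hy : a * -s.esymm (k + 1) < s.esymm (k + 2) := by linarith
  have hlower : s.esymm k * (a * -s.esymm (k + 1)) < s.esymm (k + 1) ^ 2 :=
    (mul_lt_mul_of_pos_left hy h0).trans_le (esymm_mul_esymm_le_sq s k)
  nlinarith [mul_nonneg (by linarith : 0 ≤ a * s.esymm k + s.esymm (k + 1)) (neg_nonneg.2 hx)]

lemma mem_gammaCone_of_cons {a : ℝ} (h : a ::ₘ s ∈ gammaCone (n + 1) (k + 1)) :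
    s ∈ gammaCone n k := by
  have hcard : Multiset.card s = n := by simpa using h.1
  induction k with
  | zero => exact ⟨hcard, fun l h1 h2 => absurd h1 (by omega)⟩
  | succ k ih =>
    have hs : s ∈ gammaCone n k := ih (gammaCone_anti (Nat.le_succ _) h)
    refine ⟨hcard, fun l h1 hl => ?_⟩
    rcases Nat.lt_or_ge k l with hkl | hkl
    · obtain rfl : l = k + 1 := by omega
      exact esymm_succ_pos_of_cons (esymm_pos_of_mem_gammaCone hs le_rfl)
        (esymm_pos_of_mem_gammaCone h (Nat.le_succ _)) (esymm_pos_of_mem_gammaCone h le_rfl)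
    · exact esymm_pos_of_mem_gammaCone hs hkl

lemma esymm_cons_le_cons {a b : ℝ} (hab : a ≤ b) (h : a ::ₘ s ∈ gammaCone n k) {l : ℕ}
    (hl : l ≤ k) : (a ::ₘ s).esymm l ≤ (b ::ₘ s).esymm l := by
  rcases l with _ | l
  · simp only [multiset_esymm_zero, le_refl]
  obtain ⟨n, rfl⟩ : ∃ m, n = m + 1 := ⟨Multiset.card s, by simpa using h.1.symm⟩
  rw [multiset_esymm_cons_succ, multiset_esymm_cons_succ]
  have := esymm_pos_of_mem_gammaCone (mem_gammaCone_of_cons (gammaCone_anti hl h)) le_rfl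
  gcongr

lemma mem_gammaCone_cons_of_le {a b : ℝ} (hab : a ≤ b) (h : a ::ₘ s ∈ gammaCone n k) :
    b ::ₘ s ∈ gammaCone n k :=
  ⟨by simpa using h.1, fun l h1 hl => (h.2 l h1 hl).trans_le (esymm_cons_le_cons hab h hl)⟩

lemma esymm_le_esymm_of_rel (hs : s ∈ gammaCone n k) (h : Multiset.Rel (· ≤ ·) s t) :
    s.esymm k ≤ t.esymm k := by
  suffices ∀ w, s + w ∈ gammaCone n k → (s + w).esymm k ≤ (t + w).esymm k by
    simpa using this 0 (by simpa using hs)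
  clear hs
  induction h with
  | zero => exact fun w _ => le_rfl
  | @cons a b s t hab _ ih =>
    intro w hw
    rw [Multiset.cons_add] at hw
    calc (a ::ₘ s + w).esymm k = (a ::ₘ (s + w)).esymm k := by rw [Multiset.cons_add]
      _ ≤ (b ::ₘ (s + w)).esymm k := esymm_cons_le_cons hab hw le_rfl
      _ = (s + b ::ₘ w).esymm k := by rw [Multiset.add_cons]
      _ ≤ (t + b ::ₘ w).esymm k :=
        ih _ (by simpa only [Multiset.add_cons] using mem_gammaCone_cons_of_le hab hw)
      _ = (b ::ₘ t + w).esymm k := by rw [Multiset.add_cons, Multiset.cons_add]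

lemma esymm_succ_le_esymm_one_mul (hs : s ∈ gammaCone n k) {j : ℕ} (hj : j + 1 ≤ k) :
    s.esymm (j + 1) ≤ s.esymm 1 * s.esymm j := by
  induction j with
  | zero => simp [multiset_esymm_zero]
  | succ j ih =>
    have h0 := esymm_pos_of_mem_gammaCone hs (show j ≤ k by omega)
    have h1 := esymm_pos_of_mem_gammaCone hs (show j + 1 ≤ k by omega)
    refine le_of_mul_le_mul_left ?_ h0
    calc s.esymm j * s.esymm (j + 2) ≤ s.esymm (j + 1) * s.esymm (j + 1) := by
          rw [← sq]
          exact esymm_mul_esymm_le_sq s j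
      _ ≤ s.esymm 1 * s.esymm j * s.esymm (j + 1) := by
          gcongr
          exact ih (by omega)
      _ = s.esymm j * (s.esymm 1 * s.esymm (j + 1)) := by ring

lemma esymm_le_esymm_one_pow (hs : s ∈ gammaCone n k) : s.esymm k ≤ s.esymm 1 ^ k := by
  induction k with
  | zero => simp [multiset_esymm_zero]
  | succ k ih =>
    have h1 := esymm_pos_of_mem_gammaCone hs (show 1 ≤ k + 1 by omega)
    calc s.esymm (k + 1) ≤ s.esymm 1 * s.esymm k := esymm_succ_le_esymm_one_mul hs le_rfl
      _ ≤ s.esymm 1 * s.esymm 1 ^ k := by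
          gcongr
          exact ih (gammaCone_anti (Nat.le_succ k) hs)
      _ = s.esymm 1 ^ (k + 1) := (pow_succ' _ _).symm

end SymmetricFunctions

section Spectrum

open Polynomial InnerProductSpace Module

lemma charpoly_comp_comm {R M : Type*} [CommRing R] [AddCommGroup M] [Module R M] [Free R M]
    [Module.Finite R M] (S T : M →ₗ[R] M) : (S ∘ₗ T).charpoly = (T ∘ₗ S).charpoly := by
  nontriviality R
  classical
  let b := Free.chooseBasis R M
  rw [← LinearMap.charpoly_toMatrix _ b, ← LinearMap.charpoly_toMatrix (T ∘ₗ S) b,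
    LinearMap.toMatrix_comp b b b, LinearMap.toMatrix_comp b b b, Matrix.charpoly_mul_comm]

lemma eigenvalueMultiset_fluxMatrix {n : ℕ} {A : ℝ → ℝ} {u : EuclideanSpace ℝ (Fin n) → ℝ}
    {x : EuclideanSpace ℝ (Fin n)} {L : EuclideanSpace ℝ (Fin n) →L[ℝ] EuclideanSpace ℝ (Fin n)}
    (hL : HasFDerivAt (fluxField A u) L x) :
    eigenvalueMultiset (fluxMatrix A u x) =
      (L : EuclideanSpace ℝ (Fin n) →ₗ[ℝ] EuclideanSpace ℝ (Fin n)).charpoly.roots := by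
  rw [eigenvalueMultiset, ← Matrix.charpoly_transpose,
    ← LinearMap.charpoly_toMatrix _ (EuclideanSpace.basisFun (Fin n) ℝ).toBasis]
  congr 2
  ext i j
  simp [fluxMatrix, LinearMap.toMatrix_apply, hL.fderiv]

variable {E : Type*} [NormedAddCommGroup E] [InnerProductSpace ℝ E]

/-- The operator acting as multiplication by `b` on the line spanned by the unit vector `e` and as
multiplication by `a` on its orthogonal complement. The derivatives of radial vector fields and of
the flux field of a function with radial gradient are built from it. -/
noncomputable def axialMap (a b : ℝ) (e : E) : E →L[ℝ] E :=
  a • ContinuousLinearMap.id ℝ E + (b - a) • rankOne ℝ e e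

variable {a b a' b' : ℝ} {e : E}

lemma axialMap_apply (y : E) : axialMap a b e y = a • y + ((b - a) * ⟪e, y⟫_ℝ) • e := by
  simp [axialMap, smul_smul]

lemma axialMap_self : axialMap a a e = a • ContinuousLinearMap.id ℝ E := by
  simp [axialMap]

lemma inner_axialMap_self (y : E) :
    ⟪axialMap a b e y, y⟫_ℝ = a * (‖y‖ ^ 2 - ⟪e, y⟫_ℝ ^ 2) + b * ⟪e, y⟫_ℝ ^ 2 := by
  rw [axialMap_apply, inner_add_left, real_inner_smul_left, real_inner_smul_left,
    real_inner_self_eq_norm_sq]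
  ring

lemma inner_axialMap (he : ‖e‖ = 1) (y : E) : ⟪e, axialMap a b e y⟫_ℝ = b * ⟪e, y⟫_ℝ := by
  rw [axialMap_apply, inner_add_right, real_inner_smul_right, real_inner_smul_right,
    real_inner_self_eq_norm_sq, he]
  ring

lemma isSymmetric_axialMap : (axialMap a b e : E →ₗ[ℝ] E).IsSymmetric :=
  (LinearMap.IsSymmetric.id.smul (by simp)).add ((isSymmetric_rankOne_self e).smul (by simp))

lemma axialMap_axialMap (he : ‖e‖ = 1) (y : E) :
    axialMap a b e (axialMap a' b' e y) = axialMap (a * a') (b * b') e y := by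
  rw [axialMap_apply, inner_axialMap he, axialMap_apply, axialMap_apply]
  module

lemma norm_sq_axialMap (he : ‖e‖ = 1) (y : E) :
    ‖axialMap a b e y‖ ^ 2 = a ^ 2 * (‖y‖ ^ 2 - ⟪e, y⟫_ℝ ^ 2) + b ^ 2 * ⟪e, y⟫_ℝ ^ 2 := by
  have hsymm := isSymmetric_axialMap (a := a) (b := b) (e := e) (axialMap a b e y) y
  simp only [ContinuousLinearMap.coe_coe] at hsymm
  rw [← real_inner_self_eq_norm_sq, ← hsymm, axialMap_axialMap he, inner_axialMap_self, sq a, sq b]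

lemma real_inner_sq_le_of_norm_eq_one (he : ‖e‖ = 1) (y : E) : ⟪e, y⟫_ℝ ^ 2 ≤ ‖y‖ ^ 2 := by
  have h := abs_real_inner_le_norm e y
  rw [he, one_mul] at h
  exact sq_le_sq.2 (h.trans (le_abs_self _))

variable [FiniteDimensional ℝ E] {n : ℕ}

lemma roots_charpoly_axialMap (hn : finrank ℝ E = n + 1) (he : ‖e‖ = 1) :
    (axialMap a b e : E →ₗ[ℝ] E).charpoly.roots = b ::ₘ Multiset.replicate n a := by
  let B := (stdOrthonormalBasis ℝ E).reindex (finCongr hn)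
  have hmatrix : LinearMap.toMatrix B.toBasis B.toBasis (axialMap a b e : E →ₗ[ℝ] E) =
      Matrix.vecMulVec ((b - a) • B.repr e) (B.repr e) - Matrix.scalar (Fin (n + 1)) (-a) := by
    ext i j
    simp [LinearMap.toMatrix_apply, axialMap_apply, B.repr_apply_apply, Matrix.vecMulVec_apply,
      Matrix.diagonal_apply, real_inner_comm]
    split_ifs <;> ring
  have hdot : ((b - a) • B.repr e).ofLp ⬝ᵥ (B.repr e).ofLp = b - a := by
    have h := EuclideanSpace.real_norm_sq_eq (B.repr e)
    rw [LinearIsometryEquiv.norm_map, he] at h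
    rw [WithLp.ofLp_smul, smul_dotProduct, dotProduct, smul_eq_mul]
    simp only [← sq, ← h, one_pow, mul_one]
  have hprod : ((X : ℝ[X]) ^ Fintype.card (Fin (n + 1)) -
      (b - a) • X ^ (Fintype.card (Fin (n + 1)) - 1)).comp (X + C (-a)) =
      ((b ::ₘ Multiset.replicate n a).map fun r => X - C r).prod := by
    simp only [Fintype.card_fin, Nat.add_sub_cancel, smul_eq_C_mul, sub_comp, pow_comp, X_comp,
      mul_comp, C_comp, C_neg, C_sub, Multiset.map_cons, Multiset.map_replicate,
      Multiset.prod_cons, Multiset.prod_replicate]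
    ring
  rw [← LinearMap.charpoly_toMatrix _ B.toBasis, hmatrix, Matrix.charpoly_sub_scalar,
    Matrix.charpoly_vecMulVec, hdot, hprod, roots_multiset_prod_X_sub_C]

lemma eigenvalue_le_or_eigenvalue_le {T : E →ₗ[ℝ] E} (hT : T.IsSymmetric) (hn : finrank ℝ E = n)
    {e : E} {d : ℝ} (h : ∀ y, ⟪e, y⟫_ℝ = 0 → ⟪T y, y⟫_ℝ ≤ d * ‖y‖ ^ 2) {i j : Fin n}
    (hij : i ≠ j) : hT.eigenvalues hn i ≤ d ∨ hT.eigenvalues hn j ≤ d := by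
  by_contra! hlt
  let v := hT.eigenvectorBasis hn
  have hform : ∀ α β : ℝ, α * ⟪e, v i⟫_ℝ + β * ⟪e, v j⟫_ℝ = 0 →
      α ^ 2 * hT.eigenvalues hn i + β ^ 2 * hT.eigenvalues hn j ≤ d * (α ^ 2 + β ^ 2) := by
    intro α β hαβ
    have horth := orthonormal_iff_ite.1 v.orthonormal
    have hTv : ∀ i, T (v i) = hT.eigenvalues hn i • v i := hT.apply_eigenvectorBasis hn
    have hy := h (α • v i + β • v j) (by
      rw [inner_add_right, real_inner_smul_right, real_inner_smul_right, hαβ])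
    rw [← real_inner_self_eq_norm_sq, map_add, map_smul, map_smul, hTv, hTv] at hy
    simp only [inner_add_left, inner_add_right, real_inner_smul_left, real_inner_smul_right, horth,
      if_true, if_neg hij, if_neg hij.symm] at hy
    linarith
  have hcomb := hform ⟪e, v j⟫_ℝ (-⟪e, v i⟫_ℝ) (by ring)
  have hi : ⟪e, v i⟫_ℝ = 0 := by
    by_contra hi
    have : 0 < ⟪e, v i⟫_ℝ ^ 2 := by positivity
    nlinarith [mul_pos this (sub_pos.2 hlt.2), mul_nonneg (sq_nonneg ⟪e, v j⟫_ℝ)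
      (sub_pos.2 hlt.1).le]
  have hone := hform 1 0 (by rw [hi]; ring)
  linarith [hlt.1]

lemma rel_roots_charpoly_cons_replicate {T : E →ₗ[ℝ] E} (hT : T.IsSymmetric)
    (hn : finrank ℝ E = n + 1) {e : E} {d D : ℝ}
    (hd : ∀ y, ⟪e, y⟫_ℝ = 0 → ⟪T y, y⟫_ℝ ≤ d * ‖y‖ ^ 2) (hD : ∀ y, ⟪T y, y⟫_ℝ ≤ D * ‖y‖ ^ 2) :
    Multiset.Rel (· ≤ ·) T.charpoly.roots (D ::ₘ Multiset.replicate n d) := by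
  have hmax : ∀ i, hT.eigenvalues hn i ≤ D := by
    intro i
    have h := hD (hT.eigenvectorBasis hn i)
    simpa [hT.apply_eigenvectorBasis, real_inner_smul_left] using h
  have hrest : ∀ i : Fin n, hT.eigenvalues hn i.succ ≤ d := fun i =>
    (eigenvalue_le_or_eigenvalue_le hT hn hd (Fin.succ_ne_zero i)).elim id
      (hT.eigenvalues_antitone hn (Fin.zero_le _)).trans
  rw [hT.roots_charpoly_eq_eigenvalues hn, Fin.univ_succ, Finset.cons_val, Multiset.map_cons]
  refine Multiset.Rel.cons (hmax 0) (Multiset.rel_replicate_right.2 ⟨by simp, fun r hr => ?_⟩)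
  simp only [Finset.map_val, Multiset.mem_map, Function.comp_apply] at hr
  obtain ⟨_, ⟨i, -, rfl⟩, rfl⟩ := hr
  exact hrest i

end Spectrum

section RadialContact

open scoped InnerProductSpace

lemma nonpos_of_hasDerivWithinAt_of_le {l l' : ℝ → ℝ} {L : ℝ}
    (hle : ∀ᶠ t in 𝓝[≥] (0 : ℝ), l t ≤ l 0) (hl : ∀ᶠ t in 𝓝[≥] (0 : ℝ), HasDerivAt l (l' t) t)
    (h0 : l' 0 = 0) (hL : HasDerivWithinAt l' L (Ici 0) 0) : L ≤ 0 := by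
  by_contra! hLpos
  have hslope : Tendsto (slope l' 0) (𝓝[>] 0) (𝓝 L) := by
    simpa using hasDerivWithinAt_iff_tendsto_slope.1 hL
  have hpos : ∀ᶠ t in 𝓝[≥] (0 : ℝ), 0 < t → 0 < l' t := by
    have hlt : ∀ᶠ t in 𝓝[>] (0 : ℝ), 0 < l' t := by
      filter_upwards [hslope.eventually_const_lt hLpos, self_mem_nhdsWithin] with t ht ht0
      rw [slope_def_field, h0, sub_zero, sub_zero] at ht
      exact (div_pos_iff_of_pos_right ht0).1 ht
    rw [eventually_nhdsWithin_iff] at hlt ⊢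
    filter_upwards [hlt] with t ht _ using ht
  obtain ⟨δ, hδ, hsub⟩ := mem_nhdsGE_iff_exists_Icc_subset.1 (hle.and (hl.and hpos))
  have hδ0 : 0 < δ := hδ
  have hmono : StrictMonoOn l (Icc 0 δ) := by
    refine strictMonoOn_of_deriv_pos (convex_Icc _ _)
      (fun t ht => (hsub ht).2.1.continuousAt.continuousWithinAt) fun t ht => ?_
    rw [interior_Icc] at ht
    obtain ⟨-, hderiv, hlt⟩ := hsub (Ioo_subset_Icc_self ht)
    rw [hderiv.deriv]
    exact hlt ht.1
  exact (hmono (left_mem_Icc.2 hδ0.le) (right_mem_Icc.2 hδ0.le) hδ0).not_ge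
    (hsub (right_mem_Icc.2 hδ0.le)).1

lemma hasDerivAt_mul_id_of_continuousAt {c : ℝ → ℝ} (hc : ContinuousAt c 0) :
    HasDerivAt (fun t => c t * t) (c 0) 0 := by
  rw [hasDerivAt_iff_tendsto_slope]
  refine (hc.tendsto.mono_left nhdsWithin_le_nhds).congr' ?_
  filter_upwards [self_mem_nhdsWithin] with t (ht : t ≠ 0)
  rw [slope_def_field, mul_zero, sub_zero, sub_zero, mul_div_cancel_right₀ _ ht]

variable {E : Type*} [NormedAddCommGroup E] [InnerProductSpace ℝ E]

lemma norm_inv_norm_smul_self {x : E} (hx : x ≠ 0) : ‖‖x‖⁻¹ • x‖ = 1 := by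
  rw [norm_smul, norm_inv, norm_norm, inv_mul_cancel₀ (norm_ne_zero_iff.2 hx)]

lemma hasFDerivAt_norm_of_ne_zero {x : E} (hx : x ≠ 0) :
    HasFDerivAt (fun y : E => ‖y‖) (innerSL ℝ (‖x‖⁻¹ • x)) x := by
  have hx' : ‖x‖ ≠ 0 := norm_ne_zero_iff.2 hx
  have hsqrt := (hasStrictFDerivAt_norm_sq x).hasFDerivAt.sqrt (by positivity)
  simp only [Real.sqrt_sq (norm_nonneg _)] at hsqrt
  refine hsqrt.congr_fderiv ?_
  ext y
  simp only [smul_apply, innerSL_apply_apply, real_inner_smul_left, smul_eq_mul,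
    nsmul_eq_mul]
  push_cast
  field_simp

lemma hasFDerivAt_radialField {g : ℝ → ℝ} {g' : ℝ} {x : E} (hx : x ≠ 0)
    (hg : HasDerivAt g g' ‖x‖) :
    HasFDerivAt (fun y : E => (g ‖y‖ / ‖y‖) • y)
      (axialMap (g ‖x‖ / ‖x‖) g' (‖x‖⁻¹ • x)) x := by
  have hx' : ‖x‖ ≠ 0 := norm_ne_zero_iff.2 hx
  have hquot := (hg.div (hasDerivAt_id _) hx').comp_hasFDerivAt x (hasFDerivAt_norm_of_ne_zero hx)
  refine (hquot.smul (hasFDerivAt_id x)).congr_fderiv ?_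
  ext y
  simp only [Function.comp_apply, Pi.div_apply, id_eq, add_apply, smul_apply,
    ContinuousLinearMap.smulRight_apply, ContinuousLinearMap.id_apply, innerSL_apply_apply,
    axialMap_apply, smul_smul, smul_eq_mul, real_inner_smul_left]
  congr 2
  field_simp

lemma hasDerivWithinAt_norm_line_comp {q : ℝ → ℝ} {q' : ℝ} {x z : E} (hx : x ≠ 0)
    (hz : 0 ≤ ⟪‖x‖⁻¹ • x, z⟫_ℝ) (hq : HasDerivWithinAt q q' (Ici ‖x‖) ‖x‖) :
    HasDerivWithinAt (fun t : ℝ => q ‖x + t • z‖) (q' * ⟪‖x‖⁻¹ • x, z⟫_ℝ) (Ici 0) 0 := by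
  have hdir : HasDerivAt (fun t : ℝ => x + t • z) z 0 := by
    simpa using ((hasDerivAt_id (0 : ℝ)).smul_const z).const_add x
  have hnorm : HasDerivAt (fun t : ℝ => ‖x + t • z‖) ⟪‖x‖⁻¹ • x, z⟫_ℝ 0 := by
    have hx' : HasFDerivAt (fun y : E => ‖y‖) (innerSL ℝ (‖x‖⁻¹ • x)) (x + (0 : ℝ) • z) := by
      simpa using hasFDerivAt_norm_of_ne_zero hx
    exact hx'.comp_hasDerivAt (0 : ℝ) hdir
  have hmaps : MapsTo (fun t : ℝ => ‖x + t • z‖) (Ici 0) (Ici ‖x‖) := by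
    intro t (ht : 0 ≤ t)
    have hxz : 0 ≤ ⟪x, z⟫_ℝ := by
      rw [real_inner_smul_left] at hz
      exact nonneg_of_mul_nonneg_right hz (by positivity)
    refine (pow_le_pow_iff_left₀ (norm_nonneg _) (norm_nonneg _) two_ne_zero).1 ?_
    rw [norm_add_sq_real, real_inner_smul_right]
    nlinarith [mul_nonneg ht hxz, sq_nonneg ‖t • z‖]
  exact HasDerivWithinAt.comp (h₂ := q) (s' := Ici ‖x‖) 0 (by simpa using hq)
    hnorm.hasDerivWithinAt hmaps

variable [CompleteSpace E]

lemma hasGradientAt_radial {v : ℝ → ℝ} {v' : ℝ} {x : E} (hx : x ≠ 0)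
    (hv : HasDerivAt v v' ‖x‖) : HasGradientAt (fun y : E => v ‖y‖) ((v' / ‖x‖) • x) x := by
  rw [hasGradientAt_iff_hasFDerivAt]
  refine (hv.comp_hasFDerivAt x (hasFDerivAt_norm_of_ne_zero hx)).congr_fderiv ?_
  ext y
  simp [div_eq_mul_inv, mul_assoc]

lemma exists_hasFDerivAt_gradient {u : E → ℝ} {x : E} (hu : ContDiffAt ℝ 2 u x) :
    ∃ H : E →L[ℝ] E, HasFDerivAt (gradient u) H x ∧ (H : E →ₗ[ℝ] E).IsSymmetric := by
  let T : (E →L[ℝ] ℝ) →L[ℝ] E := LinearMap.mkContinuous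
    { toFun := (InnerProductSpace.toDual ℝ E).symm
      map_add' := map_add _
      map_smul' := by simp } 1 (by simp)
  have hdiff : DifferentiableAt ℝ (fderiv ℝ u) x :=
    (hu.fderiv_right (m := 1) (by norm_num)).differentiableAt (by norm_num)
  have hT : ∀ y z, ⟪T (fderiv ℝ (fderiv ℝ u) x y), z⟫_ℝ = fderiv ℝ (fderiv ℝ u) x y z :=
    fun y z => InnerProductSpace.toDual_symm_apply
  have hsymm : IsSymmSndFDerivAt ℝ u x := hu.isSymmSndFDerivAt (by simp)
  refine ⟨_, T.hasFDerivAt.comp x hdiff.hasFDerivAt, fun y z => ?_⟩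
  exact (hT y z).trans ((hsymm y z).trans ((hT z y).symm.trans (real_inner_comm _ _)))

/-- The radial function `v(|·|)`, with `v' = vp`, touches `u` from above at `x`, up to an additive
constant. -/
structure RadialContact (u : E → ℝ) (v vp : ℝ → ℝ) (x : E) : Prop where
  ne_zero : x ≠ 0
  contDiffAt : ContDiffAt ℝ 2 u x
  hasDerivAt : ∀ᶠ ρ in 𝓝 ‖x‖, HasDerivAt v (vp ρ) ρ
  continuousAt : ContinuousAt vp ‖x‖
  isLocalMax : IsLocalMax (fun y => u y - v ‖y‖) x

namespace RadialContact

variable {u : E → ℝ} {v vp : ℝ → ℝ} {H : E →L[ℝ] E} {x : E}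

lemma gradient_eq (h : RadialContact u v vp x) : gradient u x = (vp ‖x‖ / ‖x‖) • x := by
  have hu := (h.contDiffAt.differentiableAt (by norm_num)).hasGradientAt.hasFDerivAt
  have hv := (hasGradientAt_radial h.ne_zero h.hasDerivAt.self_of_nhds).hasFDerivAt
  exact (InnerProductSpace.toDual ℝ E).injective
    (sub_eq_zero.1 (h.isLocalMax.hasFDerivAt_eq_zero (hu.sub hv)))

lemma eventually_hasDerivAt_line (h : RadialContact u v vp x) (z : E) :
    ∀ᶠ t in 𝓝 (0 : ℝ), HasDerivAt (fun t : ℝ => u (x + t • z) - v ‖x + t • z‖)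
      (⟪gradient u (x + t • z), z⟫_ℝ - vp ‖x + t • z‖ / ‖x + t • z‖ * ⟪x + t • z, z⟫_ℝ) t := by
  have hline : Tendsto (fun t : ℝ => x + t • z) (𝓝 0) (𝓝 x) :=
    Continuous.tendsto' (by fun_prop) _ _ (by simp)
  have hprofile : ∀ᶠ y in 𝓝 x, HasDerivAt v (vp ‖y‖) ‖y‖ :=
    continuous_norm.continuousAt.eventually h.hasDerivAt
  filter_upwards [hline.eventually hprofile, hline.eventually (isOpen_ne.mem_nhds h.ne_zero),
    hline.eventually (h.contDiffAt.eventually (by norm_num))] with t hv hne hu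
  have hdir : HasDerivAt (fun t : ℝ => x + t • z) z t := by
    simpa using ((hasDerivAt_id t).smul_const z).const_add x
  have hu' := ((hu.differentiableAt (by norm_num)).hasGradientAt.hasFDerivAt).comp_hasDerivAt t hdir
  have hv' := ((hasGradientAt_radial hne hv).hasFDerivAt).comp_hasDerivAt t hdir
  refine (hu'.sub hv').congr_deriv ?_
  simp only [InnerProductSpace.toDual_apply_apply, real_inner_smul_left]

lemma inner_hess_le_of_hasDerivWithinAt (h : RadialContact u v vp x)
    (hH : HasFDerivAt (gradient u) H x) {z : E} {Q : ℝ}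
    (hQ : HasDerivWithinAt (fun t : ℝ => vp ‖x + t • z‖ / ‖x + t • z‖ * ⟪x + t • z, z⟫_ℝ) Q
      (Ici 0) 0) : ⟪H z, z⟫_ℝ ≤ Q := by
  have hdir : HasDerivAt (fun t : ℝ => x + t • z) z 0 := by
    simpa using ((hasDerivAt_id (0 : ℝ)).smul_const z).const_add x
  have hline : Tendsto (fun t : ℝ => x + t • z) (𝓝[≥] 0) (𝓝 x) :=
    (Continuous.tendsto' (by fun_prop) _ _ (by simp)).mono_left nhdsWithin_le_nhds
  have hu : HasDerivAt (fun t : ℝ => ⟪gradient u (x + t • z), z⟫_ℝ) ⟪H z, z⟫_ℝ 0 := by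
    have hH' : HasFDerivAt (gradient u) H (x + (0 : ℝ) • z) := by simpa using hH
    simpa using (hH'.comp_hasDerivAt (0 : ℝ) hdir).inner ℝ (hasDerivAt_const (0 : ℝ) z)
  refine sub_nonpos.1 (nonpos_of_hasDerivWithinAt_of_le ?_
    ((h.eventually_hasDerivAt_line z).filter_mono nhdsWithin_le_nhds) ?_
    (hu.hasDerivWithinAt.sub hQ))
  · simpa using hline.eventually h.isLocalMax
  · simp [h.gradient_eq, real_inner_smul_left]

lemma inner_hess_le_of_inner_eq_zero (h : RadialContact u v vp x)
    (hH : HasFDerivAt (gradient u) H x) {z : E} (hz : ⟪‖x‖⁻¹ • x, z⟫_ℝ = 0) :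
    ⟪H z, z⟫_ℝ ≤ vp ‖x‖ / ‖x‖ * ‖z‖ ^ 2 := by
  have hxz : ⟪x, z⟫_ℝ = 0 := by simpa [real_inner_smul_left, h.ne_zero] using hz
  have hcont : ContinuousAt (fun t : ℝ => vp ‖x + t • z‖ / ‖x + t • z‖ * ‖z‖ ^ 2) 0 := by
    have hnorm : ContinuousAt (fun t : ℝ => ‖x + t • z‖) 0 := by fun_prop
    have hvp : ContinuousAt (fun t : ℝ => vp ‖x + t • z‖) 0 :=
      ContinuousAt.comp (f := fun t : ℝ => ‖x + t • z‖) (by simpa using h.continuousAt) hnorm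
    exact (hvp.div hnorm (by simpa using h.ne_zero)).mul continuousAt_const
  have hQ := (hasDerivAt_mul_id_of_continuousAt hcont).hasDerivWithinAt (s := Ici 0)
  refine h.inner_hess_le_of_hasDerivWithinAt hH (HasDerivWithinAt.congr_deriv
    (hQ.congr_of_eventuallyEq (.of_forall fun t => ?_) ?_) (by simp))
  · simp only [inner_add_left, hxz, real_inner_smul_left, real_inner_self_eq_norm_sq]
    ring
  · simp [hxz]

lemma inner_hess_le (h : RadialContact u v vp x) (hH : HasFDerivAt (gradient u) H x) {w : ℝ}
    (hw : HasDerivWithinAt vp w (Ici ‖x‖) ‖x‖) (z : E) :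
    ⟪H z, z⟫_ℝ ≤ ⟪axialMap (vp ‖x‖ / ‖x‖) w (‖x‖⁻¹ • x) z, z⟫_ℝ := by
  wlog hz : 0 ≤ ⟪‖x‖⁻¹ • x, z⟫_ℝ generalizing z
  · have hneg := this (-z) (by rw [inner_neg_right]; linarith)
    simpa only [map_neg, inner_neg_neg] using hneg
  have hx : ‖x‖ ≠ 0 := norm_ne_zero_iff.2 h.ne_zero
  have hq : HasDerivWithinAt (fun ρ => vp ρ / ρ) ((w * ‖x‖ - vp ‖x‖ * 1) / ‖x‖ ^ 2)
      (Ici ‖x‖) ‖x‖ := hw.div (hasDerivWithinAt_id _ _) hx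
  have hinner : HasDerivAt (fun t : ℝ => ⟪x + t • z, z⟫_ℝ) (‖z‖ ^ 2) 0 := by
    have hdir : HasDerivAt (fun t : ℝ => x + t • z) z 0 := by
      simpa using ((hasDerivAt_id (0 : ℝ)).smul_const z).const_add x
    simpa using hdir.inner ℝ (hasDerivAt_const (0 : ℝ) z)
  have hQ := (hasDerivWithinAt_norm_line_comp h.ne_zero hz hq).mul hinner.hasDerivWithinAt
  refine (h.inner_hess_le_of_hasDerivWithinAt hH hQ).trans_eq ?_
  rw [inner_axialMap_self, real_inner_smul_left]
  simp only [zero_smul, add_zero]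
  field_simp
  ring

lemma inner_hess_axialMap_le (h : RadialContact u v vp x) (hH : HasFDerivAt (gradient u) H x)
    {e : ℝ ≃o ℝ} {α β d : ℝ} (hα : 0 ≤ α) (hβ : 0 ≤ β) (heq : e (vp ‖x‖) = vp ‖x‖ * α)
    (he : HasDerivAt e β (vp ‖x‖)) (hd0 : 0 ≤ d)
    (hd : HasDerivWithinAt (fun ρ => e (vp ρ)) d (Ici ‖x‖) ‖x‖) (y : E) :
    let R := axialMap √α √β (‖x‖⁻¹ • x)
    ⟪H (R y), R y⟫_ℝ ≤ ⟪axialMap (e (vp ‖x‖) / ‖x‖) d (‖x‖⁻¹ • x) y, y⟫_ℝ := by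
  intro R
  have hunit := norm_inv_norm_smul_self h.ne_zero
  have hRy : ‖R y‖ ^ 2 =
      α * (‖y‖ ^ 2 - ⟪‖x‖⁻¹ • x, y⟫_ℝ ^ 2) + β * ⟪‖x‖⁻¹ • x, y⟫_ℝ ^ 2 := by
    rw [norm_sq_axialMap hunit, Real.sq_sqrt hα, Real.sq_sqrt hβ]
  have hxRy : ⟪‖x‖⁻¹ • x, R y⟫_ℝ = √β * ⟪‖x‖⁻¹ • x, y⟫_ℝ := inner_axialMap hunit y
  rw [inner_axialMap_self, heq]
  rcases hβ.eq_or_lt with rfl | hβ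
  · have hle := h.inner_hess_le_of_inner_eq_zero hH (z := R y) (by simp [hxRy])
    rw [hRy] at hle
    calc ⟪H (R y), R y⟫_ℝ
        ≤ vp ‖x‖ * α / ‖x‖ * (‖y‖ ^ 2 - ⟪‖x‖⁻¹ • x, y⟫_ℝ ^ 2) := hle.trans_eq (by ring)
      _ ≤ _ := le_add_of_nonneg_right (by positivity)
  · have hinv : HasDerivAt e.symm β⁻¹ (e (vp ‖x‖)) :=
      HasDerivAt.of_local_left_inverse e.symm.continuous.continuousAt
        (by rwa [e.symm_apply_apply]) hβ.ne' (.of_forall e.apply_symm_apply)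
    have hw : HasDerivWithinAt vp (β⁻¹ * d) (Ici ‖x‖) ‖x‖ := by
      simpa [Function.comp_def] using HasDerivAt.comp_hasDerivWithinAt ‖x‖ hinv hd
    refine (h.inner_hess_le hH hw (R y)).trans_eq ?_
    rw [inner_axialMap_self, hRy, hxRy, mul_pow, Real.sq_sqrt hβ.le]
    field_simp
    ring

end RadialContact

lemma hasFDerivAt_fluxField {n : ℕ} {A : ℝ → ℝ} {u : EuclideanSpace ℝ (Fin n) → ℝ}
    {x e : EuclideanSpace ℝ (Fin n)} {H : EuclideanSpace ℝ (Fin n) →L[ℝ] EuclideanSpace ℝ (Fin n)}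
    {p a : ℝ} (hH : HasFDerivAt (gradient u) H x) (he : ‖e‖ = 1) (hp : 0 < p)
    (hgrad : gradient u x = p • e) (hA : HasDerivAt A a p) :
    HasFDerivAt (fluxField A u) (axialMap (A p) (A p + p * a) e ∘L H) x := by
  have hnorm : ‖gradient u x‖ = p := by
    rw [hgrad, norm_smul, he, mul_one, Real.norm_of_nonneg hp.le]
  have hne : gradient u x ≠ 0 := norm_ne_zero_iff.1 (hnorm.trans_ne hp.ne')
  have hdir : ‖gradient u x‖⁻¹ • gradient u x = e := by
    rw [hnorm, hgrad, inv_smul_smul₀ hp.ne']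
  have hAnorm : HasFDerivAt (fun y => A ‖gradient u y‖) _ x :=
    HasDerivAt.comp_hasFDerivAt (h₂ := A) x (by rwa [hnorm])
      ((hasFDerivAt_norm_of_ne_zero hne).comp x hH)
  refine (hAnorm.smul hH).congr_fderiv ?_
  ext1 y
  rw [hdir, hnorm, hgrad]
  simp only [add_apply, smul_apply, ContinuousLinearMap.smulRight_apply,
    ContinuousLinearMap.comp_apply, innerSL_apply_apply, axialMap_apply, smul_smul, smul_eq_mul]
  congr 2
  ring

lemma eigenvalueMultiset_fluxMatrix_eq_roots_conj {n : ℕ} {A : ℝ → ℝ}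
    {u : EuclideanSpace ℝ (Fin n) → ℝ} {x e : EuclideanSpace ℝ (Fin n)}
    {H : EuclideanSpace ℝ (Fin n) →L[ℝ] EuclideanSpace ℝ (Fin n)} {p a : ℝ}
    (hH : HasFDerivAt (gradient u) H x) (he : ‖e‖ = 1) (hp : 0 < p)
    (hgrad : gradient u x = p • e) (hA : HasDerivAt A a p) (hA0 : 0 ≤ A p)
    (hA1 : 0 ≤ A p + p * a) :
    let R := axialMap √(A p) √(A p + p * a) e
    eigenvalueMultiset (fluxMatrix A u x) = (R ∘L H ∘L R).toLinearMap.charpoly.roots := by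
  intro R
  have hR : axialMap (A p) (A p + p * a) e ∘L H = R ∘L (R ∘L H) := by
    ext1 y
    simp only [R, ContinuousLinearMap.comp_apply, axialMap_axialMap he, Real.mul_self_sqrt hA0,
      Real.mul_self_sqrt hA1]
  rw [eigenvalueMultiset_fluxMatrix (hasFDerivAt_fluxField hH he hp hgrad hA), hR,
    ContinuousLinearMap.toLinearMap_comp, charpoly_comp_comm,
    ← ContinuousLinearMap.toLinearMap_comp, ContinuousLinearMap.comp_assoc]

theorem RadialContact.rel_eigenvalues {n : ℕ} {A : ℝ → ℝ}
    {u : EuclideanSpace ℝ (Fin (n + 1)) → ℝ} {v vp : ℝ → ℝ} {x : EuclideanSpace ℝ (Fin (n + 1))}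
    {a d : ℝ} {e : ℝ ≃o ℝ} (h : RadialContact u v vp x) (hp : 0 < vp ‖x‖)
    (hApos : 0 < A (vp ‖x‖)) (hA : HasDerivAt A a (vp ‖x‖))
    (he : ∀ᶠ p in 𝓝 (vp ‖x‖), e p = p * A p)
    (hd : HasDerivWithinAt (fun ρ => e (vp ρ)) d (Ici ‖x‖) ‖x‖) (hd0 : 0 ≤ d) :
    Multiset.Rel (· ≤ ·) (eigenvalueMultiset (fluxMatrix A u x))
      ((d + e (vp ‖x‖) / ‖x‖) ::ₘ Multiset.replicate n (e (vp ‖x‖) / ‖x‖)) := by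
  obtain ⟨H, hH, hsymm⟩ := exists_hasFDerivAt_gradient h.contDiffAt
  have hunit := norm_inv_norm_smul_self h.ne_zero
  have hder : HasDerivAt e (A (vp ‖x‖) + vp ‖x‖ * a) (vp ‖x‖) := by
    refine HasDerivAt.congr_of_eventuallyEq ?_ he
    exact ((hasDerivAt_id (vp ‖x‖)).mul hA).congr_deriv (by simp)
  have hβ : 0 ≤ A (vp ‖x‖) + vp ‖x‖ * a := hder.deriv ▸ e.monotone.deriv_nonneg
  have heq : e (vp ‖x‖) = vp ‖x‖ * A (vp ‖x‖) := he.self_of_nhds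
  have hgrad : gradient u x = vp ‖x‖ • ‖x‖⁻¹ • x := by
    rw [h.gradient_eq, smul_smul, div_eq_mul_inv]
  rw [eigenvalueMultiset_fluxMatrix_eq_roots_conj hH hunit hp hgrad hA hApos.le hβ]
  set R := axialMap √(A (vp ‖x‖)) √(A (vp ‖x‖) + vp ‖x‖ * a) (‖x‖⁻¹ • x)
  have hRsymm : ∀ y z, ⟪R y, z⟫_ℝ = ⟪y, R z⟫_ℝ := isSymmetric_axialMap
  have hbound : ∀ y, ⟪R (H (R y)), y⟫_ℝ ≤ d * ⟪‖x‖⁻¹ • x, y⟫_ℝ ^ 2 +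
      e (vp ‖x‖) / ‖x‖ * (‖y‖ ^ 2 - ⟪‖x‖⁻¹ • x, y⟫_ℝ ^ 2) := by
    intro y
    rw [hRsymm, add_comm (d * _), ← inner_axialMap_self]
    exact h.inner_hess_axialMap_le hH hApos.le hβ heq hder hd0 hd y
  refine rel_roots_charpoly_cons_replicate (e := ‖x‖⁻¹ • x) (fun y z => ?_) (by simp)
    (fun y hy => (hbound y).trans_eq (by rw [hy]; ring)) fun y => (hbound y).trans ?_
  · simp only [ContinuousLinearMap.coe_coe, ContinuousLinearMap.comp_apply, hRsymm]
    exact (hsymm (R y) (R z)).trans (hRsymm y (H (R z)))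
  · have hle := real_inner_sq_le_of_norm_eq_one hunit y
    have hquot : 0 ≤ e (vp ‖x‖) / ‖x‖ := heq ▸ by positivity
    nlinarith [mul_nonneg hquot (sq_nonneg ⟪‖x‖⁻¹ • x, y⟫_ℝ), mul_le_mul_of_nonneg_left hle hd0]

end RadialContact

section RadialRegularity

variable {E : Type*} [NormedAddCommGroup E] [InnerProductSpace ℝ E] {v vp : ℝ → ℝ}

lemma hasGradientAt_radial_of_deriv_zero [CompleteSpace E]
    (hv : ∀ r, 0 ≤ r → HasDerivAt v (vp r) r) (h0 : vp 0 = 0) (x : E) :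
    HasGradientAt (fun y : E => v ‖y‖) ((vp ‖x‖ / ‖x‖) • x) x := by
  rcases eq_or_ne x 0 with rfl | hx
  · have hlittle := hv 0 le_rfl
    rw [h0, hasDerivAt_iff_isLittleO_nhds_zero] at hlittle
    have hcomp := hlittle.comp_tendsto (tendsto_norm_zero (E := E))
    simp only [Function.comp_def, zero_add, smul_zero, sub_zero] at hcomp
    rw [smul_zero, hasGradientAt_iff_hasFDerivAt, map_zero, hasFDerivAt_iff_isLittleO_nhds_zero]
    simpa using hcomp.of_norm_right
  · exact hasGradientAt_radial hx (hv _ (norm_nonneg x))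

lemma norm_radialField (h0 : vp 0 = 0) (x : E) : ‖(vp ‖x‖ / ‖x‖) • x‖ = |vp ‖x‖| := by
  rcases eq_or_ne x 0 with rfl | hx
  · simp [h0]
  · rw [norm_smul, norm_div, norm_norm, Real.norm_eq_abs, div_mul_cancel₀ _ (norm_ne_zero_iff.2 hx)]

lemma continuous_radialField (hc : Continuous vp) (h0 : vp 0 = 0) :
    Continuous fun x : E => (vp ‖x‖ / ‖x‖) • x := by
  refine continuous_iff_continuousAt.2 fun x => ?_
  rcases eq_or_ne x 0 with rfl | hx
  · rw [ContinuousAt, smul_zero, tendsto_zero_iff_norm_tendsto_zero]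
    simp only [norm_radialField h0]
    have hcont : Continuous fun x : E => |vp ‖x‖| := by fun_prop
    simpa [h0] using hcont.tendsto 0
  · have : ‖x‖ ≠ 0 := norm_ne_zero_iff.2 hx
    fun_prop (disch := assumption)

lemma contDiff_one_radial [CompleteSpace E] (hv : ∀ r, 0 ≤ r → HasDerivAt v (vp r) r)
    (hc : Continuous vp) (h0 : vp 0 = 0) : ContDiff ℝ 1 fun x : E => v ‖x‖ := by
  have hgrad := fun x : E => (hasGradientAt_radial_of_deriv_zero hv h0 x).hasFDerivAt
  refine contDiff_one_iff_fderiv.2 ⟨fun x => (hgrad x).differentiableAt, ?_⟩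
  rw [funext fun x => (hgrad x).fderiv]
  exact (InnerProductSpace.toDual ℝ E).continuous.comp (continuous_radialField hc h0)

end RadialRegularity

section Divergence

open scoped InnerProductSpace

variable {n : ℕ}

/-- The divergence of a vector field on `ℝⁿ`. -/
noncomputable def divergence (X : EuclideanSpace ℝ (Fin n) → EuclideanSpace ℝ (Fin n))
    (x : EuclideanSpace ℝ (Fin n)) : ℝ :=
  ∑ i, fderiv ℝ X x (EuclideanSpace.single i 1) i

lemma trace_fluxMatrix (A : ℝ → ℝ) (u : EuclideanSpace ℝ (Fin n) → ℝ)
    (x : EuclideanSpace ℝ (Fin n)) : (fluxMatrix A u x).trace = divergence (fluxField A u) x :=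
  rfl

variable {X Y : EuclideanSpace ℝ (Fin n) → EuclideanSpace ℝ (Fin n)}

lemma continuous_divergence (hX : ContDiff ℝ 1 X) : Continuous (divergence X) := by
  have := hX.continuous_fderiv (by norm_num)
  unfold divergence
  fun_prop

lemma divergence_sub {x : EuclideanSpace ℝ (Fin n)} (hX : DifferentiableAt ℝ X x)
    (hY : DifferentiableAt ℝ Y x) :
    divergence (fun y => X y - Y y) x = divergence X x - divergence Y x := by
  simp [divergence, fderiv_fun_sub hX hY]

lemma divergence_smul_id (μ : ℝ) (x : EuclideanSpace ℝ (Fin n)) :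
    divergence (fun y => μ • y) x = n * μ := by
  have hderiv : HasFDerivAt (fun y => μ • y) (μ • ContinuousLinearMap.id ℝ _) x :=
    (hasFDerivAt_id x).const_smul μ
  simp [divergence, hderiv.fderiv]

lemma fderiv_coord_apply {x : EuclideanSpace ℝ (Fin n)} (hX : DifferentiableAt ℝ X x) (i : Fin n)
    (y : EuclideanSpace ℝ (Fin n)) : fderiv ℝ (fun z => X z i) x y = fderiv ℝ X x y i := by
  have hcoord : HasFDerivAt (fun z => X z i) _ x :=
    (EuclideanSpace.proj (𝕜 := ℝ) i).hasFDerivAt.comp x hX.hasFDerivAt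
  rw [hcoord.fderiv]
  rfl

variable {ψ : EuclideanSpace ℝ (Fin n) → ℝ}

lemma integrable_mul_fderiv_coord (hψ : Continuous ψ) (hψs : HasCompactSupport ψ)
    (hX : ContDiff ℝ 1 X) (i : Fin n) :
    Integrable fun x => ψ x * fderiv ℝ (fun y => X y i) x (EuclideanSpace.single i 1) := by
  have hXi : ContDiff ℝ 1 fun y => X y i := by fun_prop
  have := hXi.continuous_fderiv (by norm_num)
  exact Continuous.integrable_of_hasCompactSupport (by fun_prop) hψs.mul_right

lemma integrable_fderiv_mul_coord (hψ : ContDiff ℝ 1 ψ) (hψs : HasCompactSupport ψ)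
    (hX : Continuous X) (i : Fin n) :
    Integrable fun x => fderiv ℝ ψ x (EuclideanSpace.single i 1) * X x i := by
  have := hψ.continuous_fderiv (by norm_num)
  exact Continuous.integrable_of_hasCompactSupport (by fun_prop)
    (hψs.fderiv_apply (𝕜 := ℝ) _).mul_right

lemma integral_mul_fderiv_coord (hψ : ContDiff ℝ 1 ψ) (hψs : HasCompactSupport ψ)
    (hX : ContDiff ℝ 1 X) (i : Fin n) :
    ∫ x, ψ x * fderiv ℝ (fun y => X y i) x (EuclideanSpace.single i 1) =
      -∫ x, fderiv ℝ ψ x (EuclideanSpace.single i 1) * X x i := by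
  have hXi : ContDiff ℝ 1 fun y => X y i := by fun_prop
  exact integral_mul_fderiv_eq_neg_fderiv_mul_of_integrable
    (integrable_fderiv_mul_coord hψ hψs hX.continuous i)
    (integrable_mul_fderiv_coord hψ.continuous hψs hX i)
    ((hψ.continuous.mul hXi.continuous).integrable_of_hasCompactSupport hψs.mul_right)
    (fun x _ => hψ.differentiable (by norm_num) x) fun x _ => hXi.differentiable (by norm_num) x

lemma integral_mul_divergence (hψ : ContDiff ℝ 1 ψ) (hψs : HasCompactSupport ψ)
    (hX : ContDiff ℝ 1 X) : ∫ x, ψ x * divergence X x = -∫ x, fderiv ℝ ψ x (X x) := by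
  calc ∫ x, ψ x * divergence X x
      = ∫ x, ∑ i, ψ x * fderiv ℝ (fun y => X y i) x (EuclideanSpace.single i 1) := by
        simp only [divergence, Finset.mul_sum,
          fderiv_coord_apply (hX.differentiable (by norm_num) _)]
    _ = -∑ i, ∫ x, fderiv ℝ ψ x (EuclideanSpace.single i 1) * X x i := by
        rw [integral_finsetSum _ fun i _ => integrable_mul_fderiv_coord hψ.continuous hψs hX i]
        simp only [integral_mul_fderiv_coord hψ hψs hX, Finset.sum_neg_distrib]
    _ = -∫ x, ∑ i, fderiv ℝ ψ x (EuclideanSpace.single i 1) * X x i := by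
        rw [integral_finsetSum _ fun i _ => integrable_fderiv_mul_coord hψ hψs hX.continuous i]
    _ = -∫ x, fderiv ℝ ψ x (X x) := by
        congr 2 with x
        conv_rhs => rw [← (EuclideanSpace.basisFun (Fin n) ℝ).sum_repr (X x), map_sum]
        simp [mul_comm]

lemma integrable_mul_divergence (hψ : Continuous ψ) (hψs : HasCompactSupport ψ)
    (hX : ContDiff ℝ 1 X) : Integrable fun x => ψ x * divergence X x :=
  (hψ.mul (continuous_divergence hX)).integrable_of_hasCompactSupport hψs.mul_right

lemma integrable_fderiv_apply (hψ : ContDiff ℝ 1 ψ) (hψs : HasCompactSupport ψ)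
    (hX : Continuous X) : Integrable fun x => fderiv ℝ ψ x (X x) :=
  Continuous.integrable_of_hasCompactSupport
    ((hψ.continuous_fderiv (by norm_num)).clm_apply hX)
    ((hψs.fderiv (𝕜 := ℝ)).mono fun x hx h0 => hx (by simp [h0]))

lemma integral_mul_divergence_add_fderiv (hψ : ContDiff ℝ 1 ψ) (hψs : HasCompactSupport ψ)
    (hX : ContDiff ℝ 1 X) : ∫ x, (ψ x * divergence X x + fderiv ℝ ψ x (X x)) = 0 := by
  rw [integral_add (integrable_mul_divergence hψ.continuous hψs hX)
    (integrable_fderiv_apply hψ hψs hX.continuous), integral_mul_divergence hψ hψs hX,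
    neg_add_cancel]

lemma contDiff_smoothTransition_comp {w : EuclideanSpace ℝ (Fin n) → ℝ} (hw : ContDiff ℝ 1 w) :
    ContDiff ℝ 1 fun x => Real.smoothTransition (w x) :=
  (Real.smoothTransition.contDiff (n := 1)).comp hw

lemma fderiv_smoothTransition_comp_apply {w : EuclideanSpace ℝ (Fin n) → ℝ}
    {x y : EuclideanSpace ℝ (Fin n)} (hw : DifferentiableAt ℝ w x) :
    fderiv ℝ (fun x => Real.smoothTransition (w x)) x y =
      deriv Real.smoothTransition (w x) * fderiv ℝ w x y := by
  have hs : DifferentiableAt ℝ Real.smoothTransition (w x) :=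
    (Real.smoothTransition.contDiffAt (n := 1)).differentiableAt (by norm_num)
  have hcomp : HasFDerivAt (fun x => Real.smoothTransition (w x)) _ x :=
    hs.hasDerivAt.comp_hasFDerivAt x hw.hasFDerivAt
  rw [hcomp.fderiv]
  rfl

variable {w : EuclideanSpace ℝ (Fin n) → ℝ} {Ω : Set (EuclideanSpace ℝ (Fin n))}

lemma contDiff_indicator_smoothTransition (hΩ : IsOpen Ω) (hw : ContDiff ℝ 1 w)
    (hfr : ∀ x ∈ frontier Ω, w x < 0) :
    ContDiff ℝ 1 (Ω.indicator fun x => Real.smoothTransition (w x)) := by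
  refine contDiff_iff_contDiffAt.2 fun x => ?_
  by_cases hx : x ∈ Ω
  · refine (contDiff_smoothTransition_comp hw).contDiffAt.congr_of_eventuallyEq ?_
    filter_upwards [hΩ.mem_nhds hx] with y hy using indicator_of_mem hy _
  · refine (contDiffAt_const (c := (0 : ℝ))).congr_of_eventuallyEq ?_
    by_cases hcl : x ∈ closure Ω
    · have hneg := hfr x (hΩ.frontier_eq ▸ ⟨hcl, hx⟩)
      filter_upwards [hw.continuous.continuousAt.eventually_lt continuousAt_const hneg] with y hy
      exact indicator_apply_eq_zero.2 fun _ => Real.smoothTransition.zero_of_nonpos hy.le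
    · filter_upwards [isClosed_closure.isOpen_compl.mem_nhds hcl] with y hy
      exact indicator_of_notMem (fun h => hy (subset_closure h)) _

lemma indicator_smoothTransition_eq_zero {x : EuclideanSpace ℝ (Fin n)}
    (hx : ¬(x ∈ Ω ∧ 0 < w x)) : Ω.indicator (fun x => Real.smoothTransition (w x)) x = 0 :=
  indicator_apply_eq_zero.2 fun h =>
    Real.smoothTransition.zero_of_nonpos (not_lt.1 fun hpos => hx ⟨h, hpos⟩)

lemma fderiv_indicator_smoothTransition_nonneg {x y : EuclideanSpace ℝ (Fin n)} (hΩ : IsOpen Ω)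
    (hw : DifferentiableAt ℝ w x) (hy : x ∈ Ω → 0 < w x → 0 ≤ fderiv ℝ w x y) :
    0 ≤ fderiv ℝ (Ω.indicator fun x => Real.smoothTransition (w x)) x y := by
  by_cases hx : x ∈ Ω ∧ 0 < w x
  · have heq : Ω.indicator (fun x => Real.smoothTransition (w x)) =ᶠ[𝓝 x]
        fun x => Real.smoothTransition (w x) := by
      filter_upwards [hΩ.mem_nhds hx.1] with z hz using indicator_of_mem hz _
    rw [heq.fderiv_eq, fderiv_smoothTransition_comp_apply hw]
    exact mul_nonneg Real.smoothTransition.monotone.deriv_nonneg (hy hx.1 hx.2)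
  · have hmin : IsLocalMin (Ω.indicator fun x => Real.smoothTransition (w x)) x :=
      .of_forall fun z => (indicator_smoothTransition_eq_zero hx).trans_le
        (indicator_nonneg (fun x _ => Real.smoothTransition.nonneg _) z)
    simp [hmin.fderiv_eq_zero]

theorem nonpos_of_divergence_pos (hΩ : IsOpen Ω) (hbdd : Bornology.IsBounded Ω)
    (hw : ContDiff ℝ 1 w) (hX : ContDiff ℝ 1 X) (hfr : ∀ x ∈ frontier Ω, w x < 0)
    (hdir : ∀ x ∈ Ω, 0 < w x → 0 ≤ fderiv ℝ w x (X x))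
    (hdiv : ∀ x ∈ Ω, 0 < w x → 0 < divergence X x) : ∀ x ∈ Ω, w x ≤ 0 := by
  by_contra! hcon
  obtain ⟨x₀, hx₀, hpos₀⟩ := hcon
  let ψ := Ω.indicator fun x => Real.smoothTransition (w x)
  have hψ : ContDiff ℝ 1 ψ := contDiff_indicator_smoothTransition hΩ hw hfr
  have hψs : HasCompactSupport ψ :=
    HasCompactSupport.intro hbdd.isCompact_closure fun x hx =>
      indicator_of_notMem (fun h => hx (subset_closure h)) _
  have hsource : ∀ x, 0 ≤ ψ x * divergence X x := by
    intro x
    by_cases hx : x ∈ Ω ∧ 0 < w x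
    · exact mul_nonneg (indicator_nonneg (fun x _ => Real.smoothTransition.nonneg _) x)
        (hdiv x hx.1 hx.2).le
    · simp [ψ, indicator_smoothTransition_eq_zero hx]
  have hflux : 0 ≤ ∫ x, fderiv ℝ ψ x (X x) := integral_nonneg fun x =>
    fderiv_indicator_smoothTransition_nonneg hΩ (hw.differentiable (by norm_num) x) (hdir x)
  have hpos : 0 < ∫ x, ψ x * divergence X x := by
    refine (hψ.continuous.mul (continuous_divergence hX))
      |>.integral_pos_of_hasCompactSupport_nonneg_nonzero hψs.mul_right hsource (x := x₀) ?_
    exact mul_ne_zero (by simpa [ψ, hx₀] using hpos₀) (hdiv x₀ hx₀ hpos₀).ne'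
  rw [integral_mul_divergence hψ hψs hX] at hpos
  linarith

end Divergence

section WeakComparison

open scoped InnerProductSpace

variable {n : ℕ} {A : ℝ → ℝ}

lemma inner_sub_fluxField_nonneg {E : Type*} [NormedAddCommGroup E] [InnerProductSpace ℝ E]
    (hA : MonotoneOn (fun p => p * A p) (Ici 0)) (p q : E) :
    0 ≤ ⟪p - q, A ‖p‖ • p - A ‖q‖ • q⟫_ℝ := by
  have hmul (p : E) : 0 ≤ ‖p‖ * A ‖p‖ := by
    simpa using hA self_mem_Ici (norm_nonneg p) (norm_nonneg p)
  have hcauchy (p q : E) : A ‖p‖ * ⟪p, q⟫_ℝ ≤ ‖p‖ * A ‖p‖ * ‖q‖ := by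
    rcases eq_or_ne p 0 with rfl | hp
    · simp
    · have hApos : 0 ≤ A ‖p‖ := nonneg_of_mul_nonneg_right (hmul p) (norm_pos_iff.2 hp)
      linarith [mul_le_mul_of_nonneg_left (real_inner_le_norm p q) hApos]
  have hprod : 0 ≤ (‖p‖ - ‖q‖) * (‖p‖ * A ‖p‖ - ‖q‖ * A ‖q‖) := by
    rcases le_total ‖p‖ ‖q‖ with h | h
    · exact mul_nonneg_of_nonpos_of_nonpos (sub_nonpos.2 h)
        (sub_nonpos.2 (hA (norm_nonneg p) (norm_nonneg q) h))
    · exact mul_nonneg (sub_nonneg.2 h) (sub_nonneg.2 (hA (norm_nonneg q) (norm_nonneg p) h))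
  have hexpand : ⟪p - q, A ‖p‖ • p - A ‖q‖ • q⟫_ℝ =
      ‖p‖ ^ 2 * A ‖p‖ + ‖q‖ ^ 2 * A ‖q‖ - A ‖p‖ * ⟪p, q⟫_ℝ - A ‖q‖ * ⟪q, p⟫_ℝ := by
    simp only [inner_sub_left, inner_sub_right, real_inner_smul_right, real_inner_self_eq_norm_sq,
      real_inner_comm p q]
    ring
  linarith [hcauchy p q, hcauchy q p]

theorem le_of_divergence_lt {u v : EuclideanSpace ℝ (Fin n) → ℝ}
    {Y : EuclideanSpace ℝ (Fin n) → EuclideanSpace ℝ (Fin n)} {Ω : Set (EuclideanSpace ℝ (Fin n))}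
    (hA : MonotoneOn (fun p => p * A p) (Ici 0)) (hΩ : IsOpen Ω) (hbdd : Bornology.IsBounded Ω)
    (hu : ContDiff ℝ 1 u) (hv : ContDiff ℝ 1 v) (hX : ContDiff ℝ 1 (fluxField A u))
    (hY : ContDiff ℝ 1 Y) (hYv : EqOn Y (fluxField A v) Ω) (hfr : ∀ x ∈ frontier Ω, u x < v x)
    (hdiv : ∀ x ∈ Ω, v x < u x → divergence Y x < divergence (fluxField A u) x) :
    ∀ x ∈ Ω, u x ≤ v x := by
  have hdu (x) : DifferentiableAt ℝ u x := hu.differentiable (by norm_num) x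
  have hdv (x) : DifferentiableAt ℝ v x := hv.differentiable (by norm_num) x
  have hle := nonpos_of_divergence_pos hΩ hbdd (hu.sub hv) (hX.sub hY)
    (fun x hx => sub_neg.2 (hfr x hx)) (fun x hx _ => ?_) (fun x hx huv => ?_)
  · exact fun x hx => sub_nonpos.1 (hle x hx)
  · have hgrad : fderiv ℝ (fun y => u y - v y) x =
        InnerProductSpace.toDual ℝ _ (gradient u x - gradient v x) := by
      rw [fderiv_fun_sub (hdu x) (hdv x), map_sub]
      simp [gradient]
    rw [hgrad, hYv hx]
    exact inner_sub_fluxField_nonneg hA (gradient u x) (gradient v x)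
  · rw [divergence_sub (hX.differentiable (by norm_num) x) (hY.differentiable (by norm_num) x)]
    exact sub_pos.2 (hdiv x hx (sub_pos.1 huv))

end WeakComparison

section BoundedFlux

variable {n : ℕ}

lemma mul_pow_le_half_mul_pow_succ_add {a c t : ℝ} (ha : 0 ≤ a) (hc : 0 < c) (ht : 0 ≤ t) (m : ℕ) :
    a * t ^ m ≤ c / 2 * t ^ (m + 1) + c / 2 * (2 * a / c) ^ (m + 1) := by
  obtain ⟨b, hb, rfl⟩ : ∃ b, 0 ≤ b ∧ a = c / 2 * b := ⟨2 * a / c, by positivity, by field_simp⟩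
  have hb' : 2 * (c / 2 * b) / c = b := by field_simp
  rw [hb', ← mul_add, mul_assoc]
  refine mul_le_mul_of_nonneg_left ?_ (by positivity)
  rcases le_total t b with h | h
  · calc b * t ^ m ≤ b * b ^ m := by gcongr
      _ ≤ t ^ (m + 1) + b ^ (m + 1) := by rw [pow_succ' b]; linarith [pow_nonneg ht (m + 1)]
  · calc b * t ^ m ≤ t * t ^ m := by gcongr
      _ ≤ t ^ (m + 1) + b ^ (m + 1) := by rw [pow_succ' t]; linarith [pow_nonneg hb (m + 1)]

lemma exists_cutoff (E : Type*) [NormedAddCommGroup E] [InnerProductSpace ℝ E]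
    [FiniteDimensional ℝ E] : ∃ C : ℝ, ∀ R : ℝ, 0 < R → ∃ ζ : E → ℝ, ContDiff ℝ 1 ζ ∧
      (∀ x, 0 ≤ ζ x ∧ ζ x ≤ 1) ∧ (∀ x, ‖x‖ ≤ R → ζ x = 1) ∧ (∀ x, 2 * R ≤ ‖x‖ → ζ x = 0) ∧
      ∀ x, ‖fderiv ℝ ζ x‖ ≤ C / R := by
  let χ : ContDiffBump (0 : E) := ⟨1, 2, one_pos, one_lt_two⟩
  have hχ : ContDiff ℝ 1 χ := χ.contDiff
  obtain ⟨C, hC⟩ := (χ.hasCompactSupport.fderiv (𝕜 := ℝ)).exists_bound_of_continuous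
    (hχ.continuous_fderiv (by norm_num))
  refine ⟨C, fun R hR => ⟨fun x => χ (R⁻¹ • x), by fun_prop,
    fun x => ⟨χ.nonneg, χ.le_one⟩, fun x hx => χ.one_of_mem_closedBall ?_,
    fun x hx => χ.zero_of_le_dist ?_, fun x => ?_⟩⟩
  · rw [mem_closedBall_zero_iff, norm_smul, norm_inv, Real.norm_of_nonneg hR.le]
    exact (inv_mul_le_one₀ hR).2 hx
  · rw [dist_zero_right, norm_smul, norm_inv, Real.norm_of_nonneg hR.le, inv_mul_eq_div]
    exact (le_div_iff₀ hR).2 hx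
  · rw [fderiv_comp_smul, norm_smul, norm_inv, Real.norm_of_nonneg hR.le, inv_mul_eq_div]
    gcongr
    exact hC _

variable {X : EuclideanSpace ℝ (Fin n) → EuclideanSpace ℝ (Fin n)}
  {u ζ : EuclideanSpace ℝ (Fin n) → ℝ} {f : ℝ → ℝ} {L M K : ℝ}

lemma fderiv_pow_mul_smoothTransition_apply {x y : EuclideanSpace ℝ (Fin n)} (m : ℕ)
    (hu : DifferentiableAt ℝ u x) (hζ : DifferentiableAt ℝ ζ x) :
    fderiv ℝ (fun x => ζ x ^ (m + 1) * Real.smoothTransition (u x - M)) x y =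
      ζ x ^ (m + 1) * (deriv Real.smoothTransition (u x - M) * fderiv ℝ u x y) +
        Real.smoothTransition (u x - M) * ((m + 1) * ζ x ^ m * fderiv ℝ ζ x y) := by
  have hs : DifferentiableAt ℝ (fun x => Real.smoothTransition (u x - M)) x :=
    DifferentiableAt.comp (g := Real.smoothTransition) x
      ((Real.smoothTransition.contDiffAt (n := 1)).differentiableAt (by norm_num)) (hu.sub_const M)
  rw [fderiv_fun_mul (hζ.fun_pow (m + 1)) hs, fderiv_fun_pow _ hζ]
  simp only [add_apply, smul_apply, smul_eq_mul]
  rw [fderiv_smoothTransition_comp_apply (hu.sub_const M), fderiv_sub_const]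
  simp

lemma cutoff_mul_divergence_add_fderiv_ge {x : EuclideanSpace ℝ (Fin n)} (m : ℕ)
    (hu : DifferentiableAt ℝ u x) (hζ : DifferentiableAt ℝ ζ x) (hf : Monotone f) (hfM : 0 < f M)
    (hζ0 : 0 ≤ ζ x) (hK : ‖fderiv ℝ ζ x‖ ≤ K) (hL : ‖X x‖ ≤ L) (hdir : 0 ≤ fderiv ℝ u x (X x))
    (hdiv : f (u x) ≤ divergence X x) :
    let ψ := fun x => ζ x ^ (m + 1) * Real.smoothTransition (u x - M)
    f M / 2 * ψ x - f M / 2 * (2 * ((m + 1) * (K * L)) / f M) ^ (m + 1) ≤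
      ψ x * divergence X x + fderiv ℝ ψ x (X x) := by
  intro ψ
  set h := Real.smoothTransition (u x - M) with hh
  have hh0 : 0 ≤ h := Real.smoothTransition.nonneg _
  have hh1 : h ≤ 1 := Real.smoothTransition.le_one _
  have hK0 : 0 ≤ K := (norm_nonneg _).trans hK
  have hL0 : 0 ≤ L := (norm_nonneg _).trans hL
  have hsource : h * f M ≤ h * divergence X x := by
    rcases le_or_gt (u x) M with hux | hux
    · simp [hh, Real.smoothTransition.zero_of_nonpos (sub_nonpos.2 hux)]
    · exact mul_le_mul_of_nonneg_left ((hf hux.le).trans hdiv) hh0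
  have hfluxζ : -(K * L) ≤ fderiv ℝ ζ x (X x) :=
    (abs_le.1 (((fderiv ℝ ζ x).le_opNorm (X x)).trans (by gcongr))).1
  have htransition : 0 ≤ ζ x ^ (m + 1) *
      (deriv Real.smoothTransition (u x - M) * fderiv ℝ u x (X x)) :=
    mul_nonneg (by positivity) (mul_nonneg Real.smoothTransition.monotone.deriv_nonneg hdir)
  have hyoung := mul_pow_le_half_mul_pow_succ_add (a := (m + 1) * (K * L)) (by positivity) hfM
    hζ0 m
  set y := f M / 2 * (2 * ((m + 1) * (K * L)) / f M) ^ (m + 1)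
  have hy0 : 0 ≤ y := by positivity
  calc f M / 2 * ψ x - y
      ≤ h * (f M * ζ x ^ (m + 1) - (m + 1) * (K * L) * ζ x ^ m) := by
        simp only [ψ, ← hh]
        nlinarith [mul_nonneg hh0 (sub_nonneg.2 hyoung), mul_nonneg (sub_nonneg.2 hh1) hy0]
    _ = ζ x ^ (m + 1) * (h * f M) + h * ((m + 1) * ζ x ^ m * -(K * L)) := by ring
    _ ≤ ζ x ^ (m + 1) * (h * divergence X x) + h * ((m + 1) * ζ x ^ m * fderiv ℝ ζ x (X x)) := by
        gcongr
    _ ≤ ψ x * divergence X x + fderiv ℝ ψ x (X x) := by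
        simp only [ψ]
        rw [fderiv_pow_mul_smoothTransition_apply m hu hζ, ← hh]
        linarith

lemma integral_cutoff_le {R C : ℝ} (hu : ContDiff ℝ 1 u) (hX : ContDiff ℝ 1 X)
    (hf : Monotone f) (hfM : 0 < f M) (hL : ∀ x, ‖X x‖ ≤ L) (hdir : ∀ x, 0 ≤ fderiv ℝ u x (X x))
    (hdiv : ∀ x, f (u x) ≤ divergence X x) (hζ : ContDiff ℝ 1 ζ) (hζ0 : ∀ x, 0 ≤ ζ x)
    (hζR : ∀ x, 2 * R ≤ ‖x‖ → ζ x = 0) (hζ' : ∀ x, ‖fderiv ℝ ζ x‖ ≤ C / R) :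
    ∫ x, ζ x ^ (n + 1) * Real.smoothTransition (u x - M) ≤
      (2 * ((n + 1) * (C / R * L)) / f M) ^ (n + 1) *
        volume.real (Metric.ball (0 : EuclideanSpace ℝ (Fin n)) (2 * R)) := by
  set ψ := fun x => ζ x ^ (n + 1) * Real.smoothTransition (u x - M) with hψdef
  set B := Metric.ball (0 : EuclideanSpace ℝ (Fin n)) (2 * R)
  set y := (2 * ((n + 1) * (C / R * L)) / f M) ^ (n + 1)
  have hψ : ContDiff ℝ 1 ψ :=
    (hζ.pow _).mul (contDiff_smoothTransition_comp (hu.sub contDiff_const))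
  have hψB : ∀ x ∉ B, ψ x = 0 := fun x hx => by
    simp [hψdef, hζR x (by simpa [B] using hx)]
  have hψs : HasCompactSupport ψ := HasCompactSupport.intro (isCompact_closedBall 0 (2 * R))
    fun x hx => hψB x fun h => hx (Metric.ball_subset_closedBall h)
  have hpoint : ∀ x, f M / 2 * ψ x - f M / 2 * B.indicator (fun _ => y) x ≤
      ψ x * divergence X x + fderiv ℝ ψ x (X x) := by
    intro x
    by_cases hx : x ∈ B
    · rw [indicator_of_mem hx]
      exact cutoff_mul_divergence_add_fderiv_ge n (hu.differentiable (by norm_num) x)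
        (hζ.differentiable (by norm_num) x) hf hfM (hζ0 x) (hζ' x) (hL x) (hdir x) (hdiv x)
    · have hmin : IsLocalMin ψ x := .of_forall fun z => by
        rw [hψB x hx]
        exact mul_nonneg (pow_nonneg (hζ0 z) _) (Real.smoothTransition.nonneg _)
      simp [indicator_of_notMem hx, hψB x hx, hmin.fderiv_eq_zero]
  have hψint : Integrable ψ := hψ.continuous.integrable_of_hasCompactSupport hψs
  have hBint : Integrable (B.indicator fun _ => y) :=
    (integrable_indicator_iff Metric.isOpen_ball.measurableSet).2
      (integrableOn_const (measure_ball_lt_top (μ := volume)).ne)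
  have hle : ∫ x, (f M / 2 * ψ x - f M / 2 * B.indicator (fun _ => y) x) ≤
      ∫ x, (ψ x * divergence X x + fderiv ℝ ψ x (X x)) :=
    integral_mono ((hψint.const_mul (f M / 2)).sub (hBint.const_mul (f M / 2)))
      ((integrable_mul_divergence hψ.continuous hψs hX).add
        (integrable_fderiv_apply hψ hψs hX.continuous)) hpoint
  rw [integral_mul_divergence_add_fderiv hψ hψs hX,
    integral_sub (hψint.const_mul _) (hBint.const_mul _), integral_const_mul, integral_const_mul,
    integral_indicator_const _ Metric.isOpen_ball.measurableSet, smul_eq_mul] at hle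
  rw [mul_comm y]
  exact le_of_mul_le_mul_left (sub_nonpos.1 hle) (half_pos hfM)

lemma pow_succ_mul_volume_real_ball {R : ℝ} (hR : 0 < R) (C D : ℝ) :
    (2 * ((n + 1) * (C / R * L)) / D) ^ (n + 1) *
        volume.real (Metric.ball (0 : EuclideanSpace ℝ (Fin n)) (2 * R)) =
      (2 * ((n + 1) * (C * L)) / D) ^ (n + 1) *
        (2 ^ n * volume.real (Metric.ball (0 : EuclideanSpace ℝ (Fin n)) 1)) / R := by
  have hvol : volume.real (Metric.ball (0 : EuclideanSpace ℝ (Fin n)) (2 * R)) =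
      (2 * R) ^ n * volume.real (Metric.ball (0 : EuclideanSpace ℝ (Fin n)) 1) := by
    simp only [measureReal_def]
    rw [Measure.addHaar_ball_of_pos volume 0 (by positivity), ENNReal.toReal_mul,
      ENNReal.toReal_ofReal (by positivity), finrank_euclideanSpace_fin]
  have hbase : 2 * ((n + 1) * (C / R * L)) / D = 2 * ((n + 1) * (C * L)) / D / R := by ring
  rw [hvol, hbase, div_pow, mul_pow 2 R, pow_succ R]
  field_simp

lemma hasCompactSupport_pow_succ_mul {r : ℝ} (hζ : ∀ x, r ≤ ‖x‖ → ζ x = 0) (m : ℕ)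
    (g : EuclideanSpace ℝ (Fin n) → ℝ) : HasCompactSupport fun x => ζ x ^ (m + 1) * g x :=
  HasCompactSupport.intro (isCompact_closedBall 0 r) fun x hx => by
    rw [hζ x (not_le.1 (by simpa using hx)).le, zero_pow m.succ_ne_zero, zero_mul]

theorem not_forall_le_divergence (hu : ContDiff ℝ 1 u) (hX : ContDiff ℝ 1 X)
    (hf : Monotone f) (hfpos : ∀ t, 0 < f t) (hL : ∀ x, ‖X x‖ ≤ L)
    (hdir : ∀ x, 0 ≤ fderiv ℝ u x (X x)) : ¬ ∀ x, f (u x) ≤ divergence X x := by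
  intro hdiv
  obtain ⟨C, hcutoff⟩ := exists_cutoff (EuclideanSpace ℝ (Fin n))
  set M := u 0 - 1 with hM
  set h := fun x => Real.smoothTransition (u x - M) with hh
  have hh_cont : Continuous h :=
    (contDiff_smoothTransition_comp (hu.sub contDiff_const)).continuous
  have hh_nonneg : ∀ x, 0 ≤ h x := fun x => Real.smoothTransition.nonneg _
  obtain ⟨ζ₁, hζ₁, h01₁, hone₁, hzero₁, -⟩ := hcutoff 1 one_pos
  have hmass : 0 < ∫ x, ζ₁ x ^ (n + 1) * h x := by
    refine ((hζ₁.continuous.pow _).mul hh_cont).integral_pos_of_hasCompactSupport_nonneg_nonzero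
      (hasCompactSupport_pow_succ_mul hzero₁ n h)
      (fun x => mul_nonneg (pow_nonneg (h01₁ x).1 _) (hh_nonneg x)) (x := 0) ?_
    simp [hh, hM, hone₁ 0 (by simp)]
  -- The exponent `n + 1` of the cutoff makes the bound of `integral_cutoff_le` decay like `1 / R`.
  obtain ⟨R, hlarge, hR⟩ := ((tendsto_id.const_mul_atTop hmass).eventually_gt_atTop
    ((2 * ((n + 1) * (C * L)) / f M) ^ (n + 1) *
      (2 ^ n * volume.real (Metric.ball (0 : EuclideanSpace ℝ (Fin n)) 1)))
    |>.and (eventually_ge_atTop 2)).exists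
  have hR₀ : 0 < R := two_pos.trans_le hR
  obtain ⟨ζ, hζ, h01, hone, hzero, hζ'⟩ := hcutoff R hR₀
  have hζ_le : ∀ x, ζ₁ x ≤ ζ x := fun x => by
    rcases le_total ‖x‖ R with hx | hx
    · exact (h01₁ x).2.trans_eq (hone x hx).symm
    · exact (hzero₁ x (by linarith)).trans_le (h01 x).1
  have hmono : ∫ x, ζ₁ x ^ (n + 1) * h x ≤ ∫ x, ζ x ^ (n + 1) * h x :=
    integral_mono
      (((hζ₁.continuous.pow _).mul hh_cont).integrable_of_hasCompactSupport
        (hasCompactSupport_pow_succ_mul hzero₁ n h))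
      (((hζ.continuous.pow _).mul hh_cont).integrable_of_hasCompactSupport
        (hasCompactSupport_pow_succ_mul hzero n h))
      fun x => mul_le_mul_of_nonneg_right (pow_le_pow_left₀ (h01₁ x).1 (hζ_le x) _) (hh_nonneg x)
  have hle := hmono.trans (integral_cutoff_le hu hX hf (hfpos M) hL hdir hdiv hζ
    (fun x => (h01 x).1) hzero hζ')
  rw [pow_succ_mul_volume_real_ball hR₀, le_div_iff₀ hR₀] at hle
  exact hlarge.not_ge hle

end BoundedFlux

section LegendreTransform

lemma exists_orderIso_eqOn_Ici {H : ℝ → ℝ} (hm : StrictMonoOn H (Ici 0))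
    (hc : ContinuousOn H (Ici 0)) (h0 : H 0 = 0) (ht : Tendsto H atTop atTop) :
    ∃ e : ℝ ≃o ℝ, ∀ p, 0 ≤ p → e p = H p := by
  let E : ℝ → ℝ := fun p => H (max p 0) + min p 0
  have hpos : ∀ p, 0 ≤ p → E p = H p := fun p hp => by simp [E, max_eq_left hp, min_eq_right hp]
  have hneg : ∀ p, p ≤ 0 → E p = p := fun p hp => by
    simp [E, max_eq_right hp, min_eq_left hp, h0]
  have hmono : StrictMono E := by
    intro p q hpq
    have hmax : H (max p 0) ≤ H (max q 0) :=
      hm.monotoneOn (le_max_right p 0) (le_max_right q 0) (max_le_max hpq.le le_rfl)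
    rcases le_or_gt 0 p with hp | hp
    · rw [hpos p hp, hpos q (hp.trans hpq.le)]
      exact hm hp (hp.trans hpq.le) hpq
    · exact add_lt_add_of_le_of_lt hmax ((min_eq_left hp.le).trans_lt (lt_min hpq hp))
  have hcont : Continuous E :=
    (hc.comp_continuous (by fun_prop) fun p => le_max_right p 0).add (by fun_prop)
  have hsurj : Function.Surjective E := by
    refine hcont.surjective (ht.congr' ?_) (tendsto_id.congr' ?_)
    · filter_upwards [eventually_ge_atTop 0] with p hp using (hpos p hp).symm
    · filter_upwards [eventually_le_atBot 0] with p hp using (hneg p hp).symm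
  exact ⟨hmono.orderIsoOfSurjective E hsurj, hpos⟩

variable {A : ℝ → ℝ} {k : ℕ} {p q : ℝ}

lemma strictMonoOn_mul_Ici (hA_pos : ∀ p : ℝ, 0 < p → 0 < A p)
    (hA_mono : StrictMonoOn (fun p : ℝ => p * A p) (Ioi 0)) :
    StrictMonoOn (fun p : ℝ => p * A p) (Ici 0) := by
  intro p hp q _ hpq
  rcases (mem_Ici.1 hp).eq_or_lt with rfl | hp0
  · simpa using mul_pos hpq (hA_pos q hpq)
  · exact hA_mono hp0 (hp0.trans hpq) hpq

lemma integral_mem_Icc_of_monotoneOn {G : ℝ → ℝ} (hpq : p ≤ q) (hG : MonotoneOn G (Icc p q)) :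
    ∫ t in p..q, G t ∈ Icc ((q - p) * G p) ((q - p) * G q) := by
  have hint : IntervalIntegrable G volume p q := by
    rw [← uIcc_of_le hpq] at hG
    exact hG.intervalIntegrable
  constructor
  · simpa using intervalIntegral.integral_mono_on hpq intervalIntegrable_const hint
      fun t ht => hG (left_mem_Icc.2 hpq) ht ht.1
  · simpa using intervalIntegral.integral_mono_on hpq hint intervalIntegrable_const
      fun t ht => hG ht (right_mem_Icc.2 hpq) ht.2

lemma monotoneOn_mul_pow (hA : MonotoneOn (fun p => p * A p) (Ici 0)) :
    MonotoneOn (fun p => (p * A p) ^ k) (Ici 0) := fun p hp q hq hpq =>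
  pow_le_pow_left₀ (by simpa using hA self_mem_Ici hp hp) (hA hp hq hpq) k

lemma Psi_sub_mem_Icc (hA : MonotoneOn (fun p => p * A p) (Ici 0)) (hp : 0 ≤ p) (hpq : p ≤ q) :
    Psi A k q - Psi A k p ∈
      Icc (p * ((q * A q) ^ k - (p * A p) ^ k)) (q * ((q * A q) ^ k - (p * A p) ^ k)) := by
  have hG := monotoneOn_mul_pow (k := k) hA
  have hint : ∀ b, 0 ≤ b → IntervalIntegrable (fun t => (t * A t) ^ k) volume 0 b := fun b hb =>
    (hG.mono (by rw [uIcc_of_le hb]; exact Icc_subset_Ici_self)).intervalIntegrable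
  have hadd := intervalIntegral.integral_interval_sub_left (hint q (hp.trans hpq)) (hint p hp)
  have hbounds := integral_mem_Icc_of_monotoneOn hpq (hG.mono fun t ht => hp.trans ht.1)
  simp only [Psi, mem_Icc] at hbounds ⊢
  constructor <;> nlinarith

lemma strictMonoOn_Psi (hA : StrictMonoOn (fun p => p * A p) (Ici 0)) (hk : k ≠ 0) :
    StrictMonoOn (Psi A k) (Ici 0) := by
  have hpos : ∀ p q, 0 < p → p < q → Psi A k p < Psi A k q := fun p q hp hpq => by
    have hpow : (p * A p) ^ k < (q * A q) ^ k :=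
      pow_lt_pow_left₀ (hA hp.le (hp.trans hpq).le hpq)
        (by simpa using hA.monotoneOn self_mem_Ici hp.le hp.le) hk
    have hle := (Psi_sub_mem_Icc (k := k) hA.monotoneOn hp.le hpq.le).1
    linarith [mul_pos hp (sub_pos.2 hpow)]
  intro p hp q _ hpq
  rcases (mem_Ici.1 hp).eq_or_lt with rfl | hp0
  · have hhalf := (Psi_sub_mem_Icc (k := k) hA.monotoneOn le_rfl (half_pos hpq).le).1
    linarith [hpos (q / 2) q (half_pos hpq) (half_lt_self hpq)]
  · exact hpos p q hp0 hpq

lemma continuousOn_Psi {e : ℝ ≃o ℝ} (he : ∀ p, 0 ≤ p → e p = p * A p) :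
    ContinuousOn (Psi A k) (Ici 0) := by
  have hpow : Continuous fun t => e t ^ k := e.continuous.pow k
  have hcont : Continuous fun p => p * e p ^ k - ∫ t in (0 : ℝ)..p, e t ^ k :=
    (continuous_id.mul hpow).sub (intervalIntegral.continuous_primitive
      (fun a b => hpow.intervalIntegrable a b) 0)
  refine hcont.continuousOn.congr fun p hp => ?_
  simp only [Psi, he p hp]
  congr 1
  refine intervalIntegral.integral_congr fun t ht => ?_
  rw [uIcc_of_le hp] at ht
  simp only [he t ht.1]

lemma tendsto_Psi_atTop (hA : MonotoneOn (fun p => p * A p) (Ici 0)) (hk : k ≠ 0)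
    (ht : Tendsto (fun p => p * A p) atTop atTop) : Tendsto (Psi A k) atTop atTop := by
  refine tendsto_atTop_mono' _ ?_ (tendsto_atTop_add_const_right atTop (Psi A k 1 - (1 * A 1) ^ k)
    ((tendsto_pow_atTop hk).comp ht))
  filter_upwards [eventually_ge_atTop 1] with p hp
  have := (Psi_sub_mem_Icc (k := k) hA zero_le_one hp).1
  simp only [Function.comp_apply]
  linarith

/-- The increasing homeomorphisms `e` and `ψ` of the line extend `p ↦ p A(p)` and `Ψ` from
`[0, ∞)`; this makes `Ψ⁻¹` and the inverse of `p A(p)` total, continuous and increasing. -/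
structure IsLegendrePair (A : ℝ → ℝ) (k : ℕ) (e ψ : ℝ ≃o ℝ) : Prop where
  flux_eq : ∀ p, 0 ≤ p → e p = p * A p
  psi_eq : ∀ p, 0 ≤ p → ψ p = Psi A k p

theorem exists_isLegendrePair (hk : k ≠ 0) (hA : StrictMonoOn (fun p => p * A p) (Ici 0))
    (hA_cont : ContinuousOn (fun p : ℝ => p * A p) (Ici 0))
    (ht : Tendsto (fun p : ℝ => p * A p) atTop atTop) :
    ∃ e ψ : ℝ ≃o ℝ, IsLegendrePair A k e ψ := by
  obtain ⟨e, he⟩ := exists_orderIso_eqOn_Ici hA hA_cont (zero_mul _) ht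
  obtain ⟨ψ, hψ⟩ := exists_orderIso_eqOn_Ici (strictMonoOn_Psi hA hk)
    (continuousOn_Psi he) (by simp [Psi]) (tendsto_Psi_atTop hA.monotoneOn hk ht)
  exact ⟨e, ψ, he, hψ⟩

lemma hasDerivAt_of_slope_mem_Icc {F φ : ℝ → ℝ} {z : ℝ} {s : Set ℝ} (hs : s ∈ 𝓝 z)
    (hφ : ContinuousAt φ z) (h : ∀ x ∈ s, ∀ y ∈ s, x < y → slope F x y ∈ Icc (φ y) (φ x)) :
    HasDerivAt F (φ z) z := by
  have hmin : Tendsto (fun y => min (φ y) (φ z)) (𝓝[≠] z) (𝓝 (φ z)) := by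
    simpa using (hφ.tendsto.mono_left nhdsWithin_le_nhds).min (tendsto_const_nhds (x := φ z))
  have hmax : Tendsto (fun y => max (φ y) (φ z)) (𝓝[≠] z) (𝓝 (φ z)) := by
    simpa using (hφ.tendsto.mono_left nhdsWithin_le_nhds).max (tendsto_const_nhds (x := φ z))
  have hslope : ∀ᶠ y in 𝓝[≠] z, slope F z y ∈ Icc (min (φ y) (φ z)) (max (φ y) (φ z)) := by
    filter_upwards [self_mem_nhdsWithin, nhdsWithin_le_nhds hs] with y hne hy
    rcases lt_or_gt_of_ne hne with hlt | hlt
    · have := h y hy z (mem_of_mem_nhds hs) hlt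
      rw [slope_comm]
      exact ⟨(min_le_right _ _).trans this.1, this.2.trans (le_max_left _ _)⟩
    · have := h z (mem_of_mem_nhds hs) y hy hlt
      exact ⟨(min_le_left _ _).trans this.1, this.2.trans (le_max_right _ _)⟩
  exact hasDerivAt_iff_tendsto_slope.2 (tendsto_of_tendsto_of_tendsto_of_le_of_le' hmin hmax
    (hslope.mono fun _ h => h.1) (hslope.mono fun _ h => h.2))

namespace IsLegendrePair

variable {e ψ : ℝ ≃o ℝ} {z : ℝ} (h : IsLegendrePair A k e ψ)

include h

lemma flux_zero : e 0 = 0 := by rw [h.flux_eq 0 le_rfl, zero_mul]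

lemma flux_symm_zero : e.symm 0 = 0 := e.symm_apply_eq.2 h.flux_zero.symm

lemma flux_pos (hp : 0 < p) : 0 < e p := h.flux_zero ▸ e.strictMono hp

lemma psi_zero : ψ 0 = 0 := by rw [h.psi_eq 0 le_rfl]; simp [Psi]

lemma psi_pos (hp : 0 < p) : 0 < ψ p := h.psi_zero ▸ ψ.strictMono hp

lemma psi_symm_zero : ψ.symm 0 = 0 := ψ.symm_apply_eq.2 h.psi_zero.symm

lemma psi_symm_nonneg (hz : 0 ≤ z) : 0 ≤ ψ.symm z := h.psi_symm_zero ▸ ψ.symm.monotone hz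

lemma psi_symm_pos (hz : 0 < z) : 0 < ψ.symm z := h.psi_symm_zero ▸ ψ.symm.strictMono hz

lemma psiInv_eq (hz : 0 ≤ z) : PsiInv A k z = ψ.symm z := by
  have hex : ∃ p ∈ Ici (0 : ℝ), Psi A k p = z :=
    ⟨ψ.symm z, h.psi_symm_nonneg hz,
      by rw [← h.psi_eq _ (h.psi_symm_nonneg hz), ψ.apply_symm_apply]⟩
  have hmem : PsiInv A k z ∈ Ici (0 : ℝ) := Function.invFunOn_mem hex
  have hinv : Psi A k (PsiInv A k z) = z := Function.invFunOn_eq hex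
  rw [← h.psi_eq _ hmem] at hinv
  exact (ψ.symm_apply_eq.2 hinv.symm).symm

lemma monotoneOn : MonotoneOn (fun p => p * A p) (Ici 0) := fun p hp q hq hpq => by
  simpa only [← h.flux_eq p hp, ← h.flux_eq q hq] using e.monotone hpq

lemma psi_sub_mem_Icc (hp : 0 ≤ p) (hpq : p ≤ q) :
    ψ q - ψ p ∈ Icc (p * (e q ^ k - e p ^ k)) (q * (e q ^ k - e p ^ k)) := by
  have hq := hp.trans hpq
  rw [h.psi_eq p hp, h.psi_eq q hq, h.flux_eq p hp, h.flux_eq q hq]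
  exact Psi_sub_mem_Icc h.monotoneOn hp hpq

lemma slope_flux_pow_mem_Icc {x y : ℝ} (hx : 0 < x) (hxy : x < y) :
    slope (fun z => e (ψ.symm z) ^ k) x y ∈ Icc (ψ.symm y)⁻¹ (ψ.symm x)⁻¹ := by
  have hPx := h.psi_symm_pos hx
  have hPy := h.psi_symm_pos (hx.trans hxy)
  have hbounds := h.psi_sub_mem_Icc hPx.le (ψ.symm.monotone hxy.le)
  rw [ψ.apply_symm_apply, ψ.apply_symm_apply] at hbounds
  rw [slope_def_field]
  constructor
  · rw [inv_le_iff_one_le_mul₀ hPy, div_mul_eq_mul_div, le_div_iff₀ (sub_pos.2 hxy)]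
    linarith [hbounds.2]
  · rw [div_le_iff₀ (sub_pos.2 hxy), inv_mul_eq_div, le_div_iff₀ hPx]
    linarith [hbounds.1]

theorem hasDerivAt_flux_pow (hz : 0 < z) :
    HasDerivAt (fun z => e (ψ.symm z) ^ k) (ψ.symm z)⁻¹ z :=
  hasDerivAt_of_slope_mem_Icc (φ := fun z => (ψ.symm z)⁻¹) (Ioi_mem_nhds hz)
    (ψ.symm.continuous.continuousAt.inv₀ (h.psi_symm_pos hz).ne')
    fun _ hx _ _ hxy => h.slope_flux_pow_mem_Icc hx hxy

end IsLegendrePair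

end LegendreTransform

section KellerOsserman

/-- The right-hand sides considered here: positive, continuous and nondecreasing functions. -/
structure IsWeight (w : ℝ → ℝ) : Prop where
  continuous : Continuous w
  monotone : Monotone w
  pos : ∀ t, 0 < w t

namespace IsWeight

variable {w : ℝ → ℝ} {a b s : ℝ}

lemma pow (hw : IsWeight w) (k : ℕ) : IsWeight fun t => w t ^ k where
  continuous := hw.continuous.pow k
  monotone _ _ hst := pow_le_pow_left₀ (hw.pos _).le (hw.monotone hst) k
  pos t := pow_pos (hw.pos t) k

lemma const_mul (hw : IsWeight w) {C : ℝ} (hC : 0 < C) : IsWeight fun t => C * w t where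
  continuous := hw.continuous.const_mul C
  monotone := hw.monotone.const_mul hC.le
  pos t := mul_pos hC (hw.pos t)

variable (hw : IsWeight w)

include hw

lemma integral_add (a b s : ℝ) : (∫ t in a..b, w t) + ∫ t in b..s, w t = ∫ t in a..s, w t :=
  intervalIntegral.integral_add_adjacent_intervals (hw.continuous.intervalIntegrable a b)
    (hw.continuous.intervalIntegrable b s)

lemma mul_sub_le_integral (h : a ≤ s) : w a * (s - a) ≤ ∫ t in a..s, w t :=
  mul_comm (w a) _ ▸ (integral_mem_Icc_of_monotoneOn h (hw.monotone.monotoneOn _)).1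

lemma integral_pos (h : a < s) : 0 < ∫ t in a..s, w t :=
  (mul_pos (hw.pos a) (sub_pos.2 h)).trans_le (hw.mul_sub_le_integral h.le)

lemma integral_nonneg (h : a ≤ s) : 0 ≤ ∫ t in a..s, w t :=
  intervalIntegral.integral_nonneg h fun t _ => (hw.pos t).le

lemma monotone_integral (a : ℝ) : Monotone fun s => ∫ t in a..s, w t := fun s t hst => by
  simpa only [hw.integral_add] using le_add_of_nonneg_right (a := ∫ t in a..s, w t)
    (hw.integral_nonneg hst)

lemma tendsto_integral (a : ℝ) : Tendsto (fun s => ∫ t in a..s, w t) atTop atTop := by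
  refine tendsto_atTop_mono' _ ?_
    ((tendsto_atTop_add_const_right _ (-a) tendsto_id).const_mul_atTop (hw.pos a))
  filter_upwards [eventually_ge_atTop a] with s hs using hw.mul_sub_le_integral hs

lemma integral_dilation_le {θ : ℝ} (h : a ≤ s) (h0 : 0 ≤ θ) (h1 : θ ≤ 1) :
    ∫ t in a..(a + θ * (s - a)), w t ≤ θ * ∫ t in a..s, w t := by
  set τ := a + θ * (s - a) with hτ
  have haτ : a ≤ τ := le_add_of_nonneg_right (mul_nonneg h0 (sub_nonneg.2 h))
  have hτs : τ ≤ s := by nlinarith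
  have hleft := (integral_mem_Icc_of_monotoneOn haτ (hw.monotone.monotoneOn _)).2
  have hright := hw.mul_sub_le_integral hτs
  rw [← hw.integral_add a τ s]
  rw [show τ - a = θ * (s - a) by rw [hτ]; ring] at hleft
  rw [show s - τ = (1 - θ) * (s - a) by rw [hτ]; ring] at hright
  nlinarith [mul_le_mul_of_nonneg_left hright h0, mul_le_mul_of_nonneg_left hleft (sub_nonneg.2 h1)]

lemma eventually_add_mul_integral_le {c C D : ℝ} (hCD : C < D) (a E : ℝ) :
    ∀ᶠ s in atTop, E + C * ∫ t in a..s, w t ≤ D * ∫ t in c..s, w t := by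
  filter_upwards [(hw.tendsto_integral c).eventually_ge_atTop
    ((E + C * ∫ t in a..c, w t) / (D - C))] with s hs
  rw [div_le_iff₀ (sub_pos.2 hCD)] at hs
  rw [← hw.integral_add a c s]
  linarith

end IsWeight

lemma integrableAtFilter_atTop_comp_dilation {q : ℝ → ℝ} {θ : ℝ} (hθ : 0 < θ) (a : ℝ)
    (h : IntegrableAtFilter q atTop) :
    IntegrableAtFilter (fun s => q (a + θ * (s - a))) atTop := by
  obtain ⟨b, hb⟩ := integrableAtFilter_atTop_iff.1 h
  refine integrableAtFilter_atTop_iff.2 ⟨a + (b - a) / θ, ?_⟩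
  rw [← integrable_indicator_iff measurableSet_Ici] at hb ⊢
  refine (((hb.comp_add_left a).comp_mul_left' hθ.ne').comp_sub_right a).congr
    (.of_forall fun s => ?_)
  have hiff : b ≤ a + θ * (s - a) ↔ a + (b - a) / θ ≤ s := by
    rw [← sub_le_iff_le_add', ← le_sub_iff_add_le', div_le_iff₀' hθ]
  simp only [indicator, mem_Ici, hiff]

/-- The kernels `Q` occurring in the Keller–Osserman conditions `∫^∞ Q(∫_c^s w) ds = ∞`. -/
structure IsKernel (Q : ℝ → ℝ) : Prop where
  pos : ∀ z, 0 < z → 0 < Q z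
  antitoneOn : AntitoneOn Q (Ioi 0)
  integrableOn : ∀ z, IntegrableOn Q (Ioc 0 z)

namespace IsKernel

variable {Q w z z' : ℝ → ℝ} {a b c : ℝ} (hQ : IsKernel Q)

include hQ

lemma aestronglyMeasurable_comp (hz : MonotoneOn z (Ioi a)) (hpos : ∀ s, a < s → 0 < z s) :
    AEStronglyMeasurable (fun s => Q (z s)) (volume.restrict (Ioi a)) :=
  (aemeasurable_restrict_of_antitoneOn measurableSet_Ioi fun _ hs _ ht hst =>
    hQ.antitoneOn (hpos _ hs) (hpos _ ht) (hz hs ht hst)).aestronglyMeasurable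

lemma integrableAtFilter_mono (hz' : Monotone z') (hpos : ∀ᶠ s in atTop, 0 < z s)
    (hle : ∀ᶠ s in atTop, z s ≤ z' s) (h : IntegrableAtFilter (fun s => Q (z s)) atTop) :
    IntegrableAtFilter (fun s => Q (z' s)) atTop := by
  have hpos' : ∀ᶠ s in atTop, 0 < z' s := (hpos.and hle).mono fun s hs => hs.1.trans_le hs.2
  obtain ⟨b, hb⟩ := eventually_atTop.1 hpos'
  refine Asymptotics.IsBigO.integrableAtFilter (.of_bound 1 ?_)
    ⟨Ioi b, Ioi_mem_atTop b, hQ.aestronglyMeasurable_comp (hz'.monotoneOn _)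
      fun s hs => hb s (le_of_lt hs)⟩ h
  filter_upwards [hpos, hpos', hle] with s hs hs' hss'
  rw [one_mul, Real.norm_of_nonneg (hQ.pos _ hs').le, Real.norm_of_nonneg (hQ.pos _ hs).le]
  exact hQ.antitoneOn hs hs' hss'

theorem integrableAtFilter_of_eventually_mul_integral_le (hw : IsWeight w) {ε : ℝ} (hε : 0 < ε)
    (hz : Monotone z) (hle : ∀ᶠ s in atTop, ε * ∫ t in c..s, w t ≤ z s)
    (h : IntegrableAtFilter (fun s => Q (∫ t in c..s, w t)) atTop) :
    IntegrableAtFilter (fun s => Q (z s)) atTop := by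
  have hθ : 0 < min 1 ε := lt_min one_pos hε
  refine hQ.integrableAtFilter_mono (z := fun s => ∫ t in c..(c + min 1 ε * (s - c)), w t) hz ?_ ?_
    (integrableAtFilter_atTop_comp_dilation (q := fun s => Q (∫ t in c..s, w t)) hθ c h)
  · filter_upwards [eventually_gt_atTop c] with s hs
    exact hw.integral_pos (lt_add_of_pos_right _ (mul_pos hθ (sub_pos.2 hs)))
  · filter_upwards [eventually_ge_atTop c, hle] with s hs hle
    calc ∫ t in c..(c + min 1 ε * (s - c)), w t
        ≤ min 1 ε * ∫ t in c..s, w t := hw.integral_dilation_le hs hθ.le (min_le_left _ _)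
      _ ≤ ε * ∫ t in c..s, w t :=
        mul_le_mul_of_nonneg_right (min_le_right _ _) (hw.integral_nonneg hs)
      _ ≤ z s := hle

lemma integrableAtFilter_of_const_mul (hw : IsWeight w) {C : ℝ} (hC : 0 < C)
    (h : IntegrableAtFilter (fun s => Q (C * ∫ t in c..s, w t)) atTop) :
    IntegrableAtFilter (fun s => Q (∫ t in c..s, w t)) atTop := by
  refine hQ.integrableAtFilter_of_eventually_mul_integral_le (c := c) (hw.const_mul hC)
    (inv_pos.2 hC) (hw.monotone_integral c) (.of_forall fun s => ?_) ?_
  · rw [intervalIntegral.integral_const_mul, inv_mul_cancel_left₀ hC.ne']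
  · simpa only [intervalIntegral.integral_const_mul] using h

lemma integrableOn_Ioi {κ : ℝ} (hκ : 0 < κ) (hz : MonotoneOn z (Ioi a))
    (hle : ∀ s, a < s → κ * (s - a) ≤ z s) (h : IntegrableAtFilter (fun s => Q (z s)) atTop) :
    IntegrableOn (fun s => Q (z s)) (Ioi a) := by
  obtain ⟨b, hb⟩ := integrableAtFilter_atTop_iff.1 h
  have hlin : ∀ s, a < s → 0 < κ * (s - a) := fun s hs => mul_pos hκ (sub_pos.2 hs)
  have hpos : ∀ s, a < s → 0 < z s := fun s hs => (hlin s hs).trans_le (hle s hs)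
  have hab : a ≤ max a b := le_max_left _ _
  have hnear : IntegrableOn (fun s => Q (κ * (s - a))) (Ioc a (max a b)) := by
    have hQint : IntervalIntegrable Q volume 0 (κ * (max a b - a)) :=
      (intervalIntegrable_iff_integrableOn_Ioc_of_le
        (mul_nonneg hκ.le (sub_nonneg.2 hab))).2 (hQ.integrableOn _)
    have hcomp := (hQint.comp_mul_left (c := κ)).comp_sub_right a
    rw [zero_div, zero_add, mul_div_cancel_left₀ _ hκ.ne', sub_add_cancel] at hcomp
    exact (intervalIntegrable_iff_integrableOn_Ioc_of_le hab).1 hcomp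
  rw [← Ioc_union_Ioi_eq_Ioi hab]
  refine .union (hnear.mono' ?_ ?_)
    (hb.mono_set ((Ioi_subset_Ioi (le_max_right a b)).trans Ioi_subset_Ici_self))
  · exact (hQ.aestronglyMeasurable_comp hz hpos).mono_set Ioc_subset_Ioi_self
  · refine (ae_restrict_iff' measurableSet_Ioc).2 (.of_forall fun s hs => ?_)
    rw [Real.norm_of_nonneg (hQ.pos _ (hpos s hs.1)).le]
    exact hQ.antitoneOn (hlin s hs.1) (hpos s hs.1) (hle s hs.1)

lemma lintegral_eq_top_iff (hw : IsWeight w) (hcb : c ≤ b) :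
    ∫⁻ s in Ioi b, ENNReal.ofReal (Q (∫ t in c..s, w t)) = ⊤ ↔
      ¬ IntegrableAtFilter (fun s => Q (∫ t in c..s, w t)) atTop := by
  have hmono := (hw.monotone_integral c).monotoneOn (Ioi c)
  rw [← not_ne_iff, lintegral_ofReal_ne_top_iff_integrable, not_iff_not]
  · refine ⟨fun h => ⟨Ioi b, Ioi_mem_atTop b, h⟩, fun h => ?_⟩
    exact (hQ.integrableOn_Ioi (hw.pos c) hmono
      (fun s hs => hw.mul_sub_le_integral (le_of_lt hs)) h).mono_set (Ioi_subset_Ioi hcb)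
  · exact (hQ.aestronglyMeasurable_comp hmono fun s hs => hw.integral_pos hs).mono_set
      (Ioi_subset_Ioi hcb)
  · refine (ae_restrict_iff' measurableSet_Ioi).2 (.of_forall fun s hs => ?_)
    exact (hQ.pos _ (hw.integral_pos (hcb.trans_lt hs))).le

lemma integrableAtFilter_of_isBigO {Q' : ℝ → ℝ} (hw : IsWeight w) (hO : Q =O[atTop] Q')
    (h : IntegrableAtFilter (fun s => Q' (∫ t in c..s, w t)) atTop) :
    IntegrableAtFilter (fun s => Q (∫ t in c..s, w t)) atTop :=
  (hO.comp_tendsto (hw.tendsto_integral c)).integrableAtFilter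
    ⟨Ioi c, Ioi_mem_atTop c, hQ.aestronglyMeasurable_comp ((hw.monotone_integral c).monotoneOn _)
      fun _ hs => hw.integral_pos hs⟩ h

end IsKernel

lemma IsLegendrePair.isKernel {A : ℝ → ℝ} {k : ℕ} {e ψ : ℝ ≃o ℝ} (h : IsLegendrePair A k e ψ) :
    IsKernel fun z => (ψ.symm z)⁻¹ where
  pos _ hz := inv_pos.2 (h.psi_symm_pos hz)
  antitoneOn _ hx _ _ hxy := inv_anti₀ (h.psi_symm_pos hx) (ψ.symm.monotone hxy)
  integrableOn _ := intervalIntegral.integrableOn_deriv_of_nonneg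
    ((e.continuous.comp ψ.symm.continuous).pow k).continuousOn
    (fun _ hz => h.hasDerivAt_flux_pow hz.1) fun _ hz => (inv_pos.2 (h.psi_symm_pos hz.1)).le

lemma isKernel_rpow {γ : ℝ} (h0 : 0 ≤ γ) (h1 : γ < 1) : IsKernel fun z => z ^ (-γ) where
  pos _ hz := Real.rpow_pos_of_pos hz _
  antitoneOn _ hx _ _ hxy := Real.rpow_le_rpow_of_nonpos hx hxy (neg_nonpos.2 h0)
  integrableOn _ := (intervalIntegral.intervalIntegrable_rpow' (neg_lt_neg h1)).1

theorem psiKellerOsserman_iff {A f : ℝ → ℝ} {k : ℕ} {e ψ : ℝ ≃o ℝ} (h : IsLegendrePair A k e ψ)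
    (hf : IsWeight f) {b c : ℝ} (hcb : c ≤ b) : PsiKellerOsserman A f k c b ↔
      ¬ IntegrableAtFilter (fun s => (ψ.symm (∫ t in c..s, f t ^ k))⁻¹) atTop := by
  rw [← h.isKernel.lintegral_eq_top_iff (hf.pow k) hcb, PsiKellerOsserman,
    setLIntegral_congr_fun measurableSet_Ioi fun s hs => by
      rw [h.psiInv_eq ((hf.pow k).integral_nonneg (hcb.trans (le_of_lt hs)))]]

theorem powerKellerOsserman_iff {f : ℝ → ℝ} {k : ℕ} {m : ℝ} (hk : 1 ≤ k) (hm : 1 < m)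
    (hf : IsWeight f) {b c : ℝ} (hcb : c ≤ b) : PowerKellerOsserman f k m c b ↔
      ¬ IntegrableAtFilter
        (fun s => (∫ t in c..s, f t ^ k) ^ (-(1 / ((k : ℝ) * (m - 1) + 1)))) atTop := by
  have hden : 1 < (k : ℝ) * (m - 1) + 1 := by
    have : (0 : ℝ) < k := by exact_mod_cast hk
    linarith [mul_pos this (sub_pos.2 hm)]
  have hkernel := isKernel_rpow (γ := 1 / ((k : ℝ) * (m - 1) + 1)) (by positivity)
    ((div_lt_one (by linarith)).2 hden)
  rw [← hkernel.lintegral_eq_top_iff (hf.pow k) hcb, PowerKellerOsserman]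

end KellerOsserman

section PowerGrowthComparison

open Asymptotics

lemma PowerGrowth.isTheta {A : ℝ → ℝ} {m : ℝ} (h : PowerGrowth A m) :
    (fun p => p * A p) =Θ[atTop] fun p => p ^ (m - 1) := by
  obtain ⟨c₁, hc₁, hliminf⟩ := EReal.lt_iff_exists_real_btwn.1 h.1
  obtain ⟨c₂, hlimsup, -⟩ := EReal.lt_iff_exists_real_btwn.1 h.2
  rw [EReal.coe_pos] at hc₁
  have hquot : (fun p => A p / p ^ (m - 2)) =Θ[atTop] fun _ => (1 : ℝ) := by
    constructor
    · refine .of_bound c₂ ?_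
      filter_upwards [eventually_lt_of_lt_liminf hliminf, eventually_lt_of_limsup_lt hlimsup]
        with p hp hp'
      rw [EReal.coe_lt_coe_iff] at hp hp'
      rw [Real.norm_of_nonneg (hc₁.trans hp).le, norm_one, mul_one]
      exact hp'.le
    · refine .of_bound c₁⁻¹ ?_
      filter_upwards [eventually_lt_of_lt_liminf hliminf] with p hp
      rw [EReal.coe_lt_coe_iff] at hp
      rw [Real.norm_of_nonneg (hc₁.trans hp).le, norm_one, ← inv_mul_cancel₀ hc₁.ne']
      exact mul_le_mul_of_nonneg_left hp.le (inv_nonneg.2 hc₁.le)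
  have hmul := (isTheta_refl (fun p : ℝ => p ^ (m - 1)) atTop).mul hquot
  simp only [mul_one] at hmul
  refine EventuallyEq.trans_isTheta ?_ hmul
  filter_upwards [eventually_gt_atTop 0] with p hp
  have hpow : p ^ (m - 2) ≠ 0 := (Real.rpow_pos_of_pos hp _).ne'
  rw [show m - 1 = 1 + (m - 2) by ring, Real.rpow_add hp, Real.rpow_one]
  field_simp

lemma PowerGrowth.tendsto {A : ℝ → ℝ} {m : ℝ} (hm : 1 < m) (h : PowerGrowth A m)
    (hA : ∀ p, 0 < p → 0 < A p) : Tendsto (fun p => p * A p) atTop atTop := by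
  have hnorm := h.isTheta.tendsto_norm_atTop_iff.2
    (tendsto_norm_atTop_atTop.comp (tendsto_rpow_atTop (sub_pos.2 hm)))
  refine hnorm.congr' ?_
  filter_upwards [eventually_gt_atTop 0] with p hp
  exact Real.norm_of_nonneg (mul_pos hp (hA p hp)).le

namespace IsLegendrePair

variable {A : ℝ → ℝ} {k : ℕ} {e ψ : ℝ ≃o ℝ} {m : ℝ} (h : IsLegendrePair A k e ψ)

include h

lemma flux_pow_isTheta (hA : PowerGrowth A m) :
    (fun p => e p ^ k) =Θ[atTop] fun p => p ^ ((k : ℝ) * (m - 1)) := by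
  refine (EventuallyEq.trans_isTheta ?_ (hA.isTheta.pow k)).trans_eventuallyEq ?_
  · filter_upwards [eventually_ge_atTop 0] with p hp
    rw [h.flux_eq p hp]
  · filter_upwards [eventually_ge_atTop 0] with p hp
    rw [mul_comm, Real.rpow_mul_natCast hp]

lemma psi_isBigO : ψ =O[atTop] fun p => p * e p ^ k := by
  refine .of_bound 1 ?_
  filter_upwards [eventually_gt_atTop 0] with p hp
  have hψ := (h.psi_sub_mem_Icc le_rfl hp.le).2
  rw [h.psi_zero, h.flux_zero, sub_zero] at hψ
  rw [one_mul, Real.norm_of_nonneg (h.psi_pos hp).le]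
  refine hψ.trans ((mul_le_mul_of_nonneg_left (sub_le_self _ ?_) hp.le).trans (le_abs_self _))
  positivity

/-- Most of the growth of `e ^ k` on `[0, p]` takes place on `[θ p, p]`. -/
lemma isBigO_psi {θ : ℝ} (hθ : 0 < θ) (hθ1 : θ < 1)
    (hle : ∀ᶠ p in atTop, e (θ * p) ^ k ≤ e p ^ k / 2) :
    (fun p => p * e p ^ k) =O[atTop] ψ := by
  refine .of_bound (2 / θ) ?_
  filter_upwards [eventually_gt_atTop 0, hle] with p hp hle
  have hθp : 0 < θ * p := mul_pos hθ hp
  have hψ := (h.psi_sub_mem_Icc hθp.le (mul_le_of_le_one_left hp.le hθ1.le)).1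
  have hpos : 0 < e p ^ k := pow_pos (h.flux_pos hp) k
  rw [Real.norm_of_nonneg (mul_pos hp hpos).le, Real.norm_of_nonneg (h.psi_pos hp).le,
    div_mul_eq_mul_div, le_div_iff₀ hθ]
  nlinarith [h.psi_pos hθp, mul_le_mul_of_nonneg_left hle hθp.le]

lemma psi_isTheta (hA : PowerGrowth A m) (hN : 0 < (k : ℝ) * (m - 1)) :
    ψ =Θ[atTop] fun p => p ^ ((k : ℝ) * (m - 1) + 1) := by
  set N := (k : ℝ) * (m - 1)
  have hflux := h.flux_pow_isTheta hA
  have hmul : (fun p => p * e p ^ k) =Θ[atTop] fun p => p ^ (N + 1) := by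
    refine ((isTheta_refl (fun p : ℝ => p) atTop).mul hflux).trans_eventuallyEq ?_
    filter_upwards [eventually_gt_atTop 0] with p hp
    rw [Real.rpow_add hp, Real.rpow_one, mul_comm]
  obtain ⟨C, hC, hCle⟩ := hflux.1.exists_pos
  obtain ⟨c, -, hcle⟩ := hflux.2.exists_pos
  have hsmall : Tendsto (fun θ : ℝ => C * θ ^ N * c) (𝓝[>] 0) (𝓝 0) := by
    have := ((Real.continuousAt_rpow_const 0 N (.inr hN.le)).const_mul C).mul_const c
    simpa [ContinuousAt, Real.zero_rpow hN.ne'] using this.mono_left nhdsWithin_le_nhds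
  obtain ⟨θ, hθC, hθ0, hθ1⟩ := ((hsmall.eventually (gt_mem_nhds one_half_pos)).and
    (Ioo_mem_nhdsGT one_pos)).exists
  refine ⟨h.psi_isBigO.trans hmul.1, hmul.2.trans (h.isBigO_psi hθ0 hθ1 ?_)⟩
  filter_upwards [(tendsto_id.const_mul_atTop hθ0).eventually hCle.bound, hcle.bound,
    eventually_gt_atTop 0] with p hup hlow hp
  have hθp : 0 < θ * p := mul_pos hθ0 hp
  rw [id, Real.norm_of_nonneg (Real.rpow_nonneg hθp.le _),
    Real.norm_of_nonneg (pow_pos (h.flux_pos hθp) k).le]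
    at hup
  rw [Real.norm_of_nonneg (Real.rpow_nonneg hp.le _),
    Real.norm_of_nonneg (pow_pos (h.flux_pos hp) k).le]
    at hlow
  calc e (θ * p) ^ k ≤ C * θ ^ N * p ^ N := by rwa [mul_assoc, ← Real.mul_rpow hθ0.le hp.le]
    _ ≤ C * θ ^ N * (c * e p ^ k) := mul_le_mul_of_nonneg_left hlow (by positivity)
    _ ≤ e p ^ k / 2 := by nlinarith [pow_pos (h.flux_pos hp) k]

lemma inv_psi_symm_isTheta (hA : PowerGrowth A m) (hN : 0 < (k : ℝ) * (m - 1)) :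
    (fun z => (ψ.symm z)⁻¹) =Θ[atTop] fun z => z ^ (-(1 / ((k : ℝ) * (m - 1) + 1))) := by
  set N := (k : ℝ) * (m - 1)
  have hψ := h.psi_isTheta hA hN
  have hz : (fun z => ψ.symm z ^ (N + 1)) =Θ[atTop] fun z => z := by
    simpa only [Function.comp_def, OrderIso.apply_symm_apply] using
      IsTheta.symm ⟨hψ.1.comp_tendsto ψ.symm.tendsto_atTop, hψ.2.comp_tendsto ψ.symm.tendsto_atTop⟩
  refine EventuallyEq.trans_isTheta ?_ (IsTheta.rpow ?_ ?_ hz)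
  · filter_upwards [eventually_gt_atTop 0] with z hz
    have hp := h.psi_symm_pos hz
    rw [← Real.rpow_mul hp.le, mul_neg, mul_one_div_cancel (by positivity), Real.rpow_neg_one]
  · filter_upwards [eventually_gt_atTop 0] with z hz
    exact Real.rpow_nonneg (h.psi_symm_pos hz).le _
  · exact eventually_ge_atTop 0

theorem powerKellerOsserman_iff_psiKellerOsserman {f : ℝ → ℝ} (hk : 1 ≤ k) (hm : 1 < m)
    (hA : PowerGrowth A m) (hf : IsWeight f) {b c : ℝ} (hcb : c ≤ b) :
    PowerKellerOsserman f k m c b ↔ PsiKellerOsserman A f k c b := by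
  have hN : 0 < (k : ℝ) * (m - 1) :=
    mul_pos (by exact_mod_cast hk) (sub_pos.2 hm)
  have hkernel := isKernel_rpow (γ := 1 / ((k : ℝ) * (m - 1) + 1)) (by positivity)
    ((div_lt_one (by linarith)).2 (by linarith))
  have hΘ := h.inv_psi_symm_isTheta hA hN
  rw [powerKellerOsserman_iff hk hm hf hcb, psiKellerOsserman_iff h hf hcb, not_iff_not]
  exact ⟨h.isKernel.integrableAtFilter_of_isBigO (hf.pow k) hΘ.1,
    hkernel.integrableAtFilter_of_isBigO (hf.pow k) hΘ.2⟩

end IsLegendrePair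

end PowerGrowthComparison

section Profile

lemma tendsto_integral_atBot_of_eqOn_Iic {q : ℝ → ℝ} {a c : ℝ} (hc : 0 < c)
    (hq : ∀ t ≤ a, q t = c) : Tendsto (fun s => ∫ t in a..s, q t) atBot atBot := by
  refine ((tendsto_atBot_add_const_right _ (-a) tendsto_id).const_mul_atBot hc).congr' ?_
  filter_upwards [eventually_le_atBot a] with s hs
  have hcongr : ∫ t in a..s, q t = ∫ _ in a..s, c :=
    intervalIntegral.integral_congr fun t ht => hq t (uIcc_of_ge hs ▸ ht).2
  rw [hcongr, intervalIntegral.integral_const, smul_eq_mul, mul_comm]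
  rfl

theorem exists_orderIso_hasDerivAt_inv {q : ℝ → ℝ} (hq : Continuous q) (hq0 : ∀ t, 0 < q t)
    (a r₀ : ℝ) (htop : Tendsto (fun s => ∫ t in a..s, q t) atTop atTop)
    (hbot : Tendsto (fun s => ∫ t in a..s, q t) atBot atBot) :
    ∃ V : ℝ ≃o ℝ, (∀ s, V.symm s = r₀ + ∫ t in a..s, q t) ∧
      ∀ r, HasDerivAt V (q (V r))⁻¹ r := by
  let R : ℝ → ℝ := fun s => r₀ + ∫ t in a..s, q t
  have hR : ∀ s, HasDerivAt R (q s) s := fun s =>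
    (hq.integral_hasStrictDerivAt a s).hasDerivAt.const_add r₀
  have hmono : StrictMono R := strictMono_of_deriv_pos fun s => (hR s).deriv ▸ hq0 s
  have hsurj : Function.Surjective R :=
    (continuous_iff_continuousAt.2 fun s => (hR s).continuousAt).surjective
      (tendsto_atTop_add_const_left _ _ htop) (tendsto_atBot_add_const_left _ _ hbot)
  let V : ℝ ≃o ℝ := (hmono.orderIsoOfSurjective R hsurj).symm
  exact ⟨V, fun s => rfl, fun r => HasDerivAt.of_local_left_inverse V.continuous.continuousAt
    (hR (V r)) (hq0 _).ne' (.of_forall V.symm_apply_apply)⟩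

/-- The value of `Ψ(v')` when `v = s`, for the solution of `(Ψ(v'))' = w(v) v'` which has slope
`p₀` at height `s₀`. -/
noncomputable def energy (ψ : ℝ ≃o ℝ) (w : ℝ → ℝ) (s₀ p₀ s : ℝ) : ℝ :=
  ψ p₀ + ∫ t in s₀..s, w t

/-- A `C¹` profile `v` of height `s₀` at the radius `r₀`, with derivative `vp`. Its flux `e ∘ vp`
is linear on `r ≤ r₀`, and from `r₀` on `v` solves `Ψ(v') = energy(v)` with slope `p₀` at `r₀`;
`radius_eq` is this separable equation in integrated form. -/
structure IsProfile (e ψ : ℝ ≃o ℝ) (w : ℝ → ℝ) (s₀ p₀ r₀ : ℝ) (v vp : ℝ → ℝ) : Prop where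
  continuous : Continuous vp
  hasDerivAt : ∀ r, HasDerivAt v (vp r) r
  value_eq : v r₀ = s₀
  flux_eq : ∀ r ≤ r₀, e (vp r) = e p₀ / r₀ * r
  le_value : ∀ r, r₀ ≤ r → s₀ ≤ v r
  psi_eq : ∀ r, r₀ ≤ r → ψ (vp r) = energy ψ w s₀ p₀ (v r)
  radius_eq : ∀ r, r₀ ≤ r → r₀ + ∫ t in s₀..v r, (ψ.symm (energy ψ w s₀ p₀ t))⁻¹ = r

variable {A w : ℝ → ℝ} {k : ℕ} {e ψ : ℝ ≃o ℝ} {s s₀ p₀ r₀ : ℝ}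

lemma hasDerivAt_energy (hw : Continuous w) : HasDerivAt (energy ψ w s₀ p₀) (w s) s :=
  (hw.integral_hasStrictDerivAt s₀ s).hasDerivAt.const_add _

lemma continuous_energy (hw : Continuous w) : Continuous (energy ψ w s₀ p₀) :=
  continuous_iff_continuousAt.2 fun _ => (hasDerivAt_energy hw).continuousAt

lemma energy_self : energy ψ w s₀ p₀ s₀ = ψ p₀ := by simp [energy]

lemma energy_pos (h : IsLegendrePair A k e ψ) (hw : IsWeight w) (hp₀ : 0 < p₀) (hs : s₀ ≤ s) :
    0 < energy ψ w s₀ p₀ s :=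
  add_pos_of_pos_of_nonneg (h.psi_pos hp₀) (hw.integral_nonneg hs)

lemma exists_orderIso_separable (h : IsLegendrePair A k e ψ) (hw : IsWeight w) (hp₀ : 0 < p₀)
    (htop : Tendsto (fun s => ∫ t in s₀..s, (ψ.symm (energy ψ w s₀ p₀ t))⁻¹) atTop atTop) :
    ∃ V : ℝ ≃o ℝ, V r₀ = s₀ ∧
      (∀ r, HasDerivAt V (ψ.symm (energy ψ w s₀ p₀ (max s₀ (V r)))) r) ∧
      ∀ r, r₀ ≤ r → r₀ + ∫ t in s₀..V r, (ψ.symm (energy ψ w s₀ p₀ t))⁻¹ = r := by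
  set q : ℝ → ℝ := fun t => (ψ.symm (energy ψ w s₀ p₀ (max s₀ t)))⁻¹ with hq_def
  have hpos : ∀ t, 0 < ψ.symm (energy ψ w s₀ p₀ (max s₀ t)) := fun t =>
    h.psi_symm_pos (energy_pos h hw hp₀ (le_max_left _ _))
  have hq : Continuous q :=
    (ψ.symm.continuous.comp ((continuous_energy hw.continuous).comp (by fun_prop))).inv₀
      fun t => (hpos t).ne'
  have hint : ∀ s, s₀ ≤ s →
      ∫ t in s₀..s, (ψ.symm (energy ψ w s₀ p₀ t))⁻¹ = ∫ t in s₀..s, q t := fun s hs =>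
    intervalIntegral.integral_congr fun t ht => by
      simp only [hq_def, max_eq_right (uIcc_of_le hs ▸ ht).1]
  have hbot := tendsto_integral_atBot_of_eqOn_Iic (inv_pos.2 (hpos s₀)) fun t (ht : t ≤ s₀) =>
    show q t = q s₀ by simp only [hq_def, max_eq_left ht, max_self]
  obtain ⟨V, hVsymm, hV⟩ := exists_orderIso_hasDerivAt_inv hq (fun t => inv_pos.2 (hpos t)) s₀ r₀
    (htop.congr' ((eventually_ge_atTop s₀).mono hint)) hbot
  have hV₀ : V r₀ = s₀ := (V.symm_apply_eq.1 (by simp [hVsymm])).symm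
  refine ⟨V, hV₀, fun r => inv_inv (ψ.symm _) ▸ hV r, fun r hr => ?_⟩
  rw [hint _ (hV₀ ▸ V.monotone hr), ← hVsymm, V.symm_apply_apply]

theorem exists_isProfile (h : IsLegendrePair A k e ψ) (hw : IsWeight w) (hp₀ : 0 < p₀)
    (hr₀ : r₀ ≠ 0)
    (htop : Tendsto (fun s => ∫ t in s₀..s, (ψ.symm (energy ψ w s₀ p₀ t))⁻¹) atTop atTop) :
    ∃ v vp : ℝ → ℝ, IsProfile e ψ w s₀ p₀ r₀ v vp := by
  obtain ⟨V, hV₀, hV, hradius⟩ := exists_orderIso_separable (r₀ := r₀) h hw hp₀ htop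
  set slope : ℝ → ℝ := fun r => ψ.symm (energy ψ w s₀ p₀ (max s₀ (V r))) with hslope
  have hslope_cont : Continuous slope :=
    ψ.symm.continuous.comp ((continuous_energy hw.continuous).comp (by fun_prop))
  have hslope₀ : slope r₀ = p₀ := by
    simp only [hslope, hV₀, max_self, energy_self, ψ.symm_apply_apply]
  set vp : ℝ → ℝ := fun r => if r ≤ r₀ then e.symm (e p₀ / r₀ * r) else slope r with hvp
  have hvp_cont : Continuous vp := by
    refine Continuous.if_le (by fun_prop) hslope_cont continuous_id continuous_const ?_
    rintro r rfl
    rw [hslope₀, div_mul_cancel₀ _ hr₀, e.symm_apply_apply]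
  have hvp_eq : ∀ r, r₀ ≤ r → vp r = slope r := fun r hr => by
    rcases hr.eq_or_lt with rfl | hr
    · simp only [hvp, le_refl, if_true, hslope₀, div_mul_cancel₀ _ hr₀, e.symm_apply_apply]
    · simp only [hvp, not_le.2 hr, if_false]
  have hV_ge : ∀ r, r₀ ≤ r → s₀ ≤ V r := fun r hr => hV₀ ▸ V.monotone hr
  have hv_eq : ∀ r, r₀ ≤ r → s₀ + ∫ ρ in r₀..r, vp ρ = V r := fun r hr => by
    rw [intervalIntegral.integral_congr fun ρ hρ => hvp_eq ρ (uIcc_of_le hr ▸ hρ).1,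
      intervalIntegral.integral_eq_sub_of_hasDerivAt (fun ρ _ => hV ρ)
        (hslope_cont.intervalIntegrable _ _), hV₀, add_sub_cancel]
  exact ⟨fun r => s₀ + ∫ ρ in r₀..r, vp ρ, vp,
    { continuous := hvp_cont
      hasDerivAt := fun r => (hvp_cont.integral_hasStrictDerivAt r₀ r).hasDerivAt.const_add s₀
      value_eq := by simp
      flux_eq := fun r hr => by simp only [hvp, hr, if_true, e.apply_symm_apply]
      le_value := fun r hr => hv_eq r hr ▸ hV_ge r hr
      psi_eq := fun r hr => by
        rw [hv_eq r hr, hvp_eq r hr, ψ.apply_symm_apply, max_eq_right (hV_ge r hr)]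
      radius_eq := fun r hr => hv_eq r hr ▸ hradius r hr }⟩

lemma hasDerivWithinAt_of_pow {g : ℝ → ℝ} {S : Set ℝ} {r d : ℝ} (hk : k ≠ 0)
    (hr : r ∈ S) (hg : ∀ ρ ∈ S, 0 < g ρ) (h : HasDerivWithinAt (fun ρ => g ρ ^ k) d S r) :
    HasDerivWithinAt g (d / (k * g r ^ (k - 1))) S r := by
  have hroot : ∀ ρ ∈ S, (g ρ ^ k) ^ (k : ℝ)⁻¹ = g ρ := fun ρ hρ =>
    Real.pow_rpow_inv_natCast (hg ρ hρ).le hk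
  refine ((h.rpow_const (p := (k : ℝ)⁻¹) (.inl (pow_pos (hg r hr) k).ne')).congr
    (fun ρ hρ => (hroot ρ hρ).symm) (hroot r hr).symm).congr_deriv ?_
  obtain ⟨j, rfl⟩ := Nat.exists_eq_succ_of_ne_zero hk
  have hgr := (hg r hr).ne'
  rw [Real.rpow_sub_one (pow_ne_zero _ hgr), hroot r hr, Nat.succ_sub_one, pow_succ]
  field_simp

namespace IsProfile

variable {v vp : ℝ → ℝ} {r : ℝ} (hv : IsProfile e ψ w s₀ p₀ r₀ v vp)
  (h : IsLegendrePair A k e ψ) (hw : IsWeight w) (hp₀ : 0 < p₀) (hr₀ : 0 < r₀)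

include hv h

lemma deriv_zero (hr₀ : 0 ≤ r₀) : vp 0 = 0 :=
  e.injective (by rw [hv.flux_eq 0 hr₀, mul_zero, h.flux_zero])

include hw hp₀

lemma flux_pow_hasDerivWithinAt (hr : r₀ ≤ r) :
    HasDerivWithinAt (fun ρ => e (vp ρ) ^ k) (w (v r)) (Ici r₀) r := by
  have hE := energy_pos h hw hp₀ (hv.le_value r hr)
  have hcomp := (h.hasDerivAt_flux_pow hE).comp r
    ((hasDerivAt_energy hw.continuous).comp r (hv.hasDerivAt r))
  have hvp : ∀ ρ ∈ Ici r₀, ψ.symm (energy ψ w s₀ p₀ (v ρ)) = vp ρ := fun ρ hρ => by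
    rw [← hv.psi_eq ρ hρ, ψ.symm_apply_apply]
  have hderiv : (ψ.symm (energy ψ w s₀ p₀ (v r)))⁻¹ * (w (v r) * vp r) = w (v r) := by
    have hpos := h.psi_symm_pos hE
    rw [hvp r hr] at hpos ⊢
    field_simp
  exact (hcomp.hasDerivWithinAt.congr_deriv hderiv).congr
    (fun ρ hρ => by simp only [Function.comp_apply, hvp ρ hρ])
    (by simp only [Function.comp_apply, hvp r hr])

include hr₀

lemma deriv_pos (hr : 0 < r) : 0 < vp r := by
  rcases le_total r r₀ with hle | hle
  · rw [← e.lt_iff_lt, h.flux_zero, hv.flux_eq r hle]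
    exact mul_pos (div_pos (h.flux_pos hp₀) hr₀) hr
  · rw [← ψ.lt_iff_lt, h.psi_zero, hv.psi_eq r hle]
    exact energy_pos h hw hp₀ (hv.le_value r hle)

lemma monotoneOn : MonotoneOn v (Ici 0) :=
  monotoneOn_of_hasDerivWithinAt_nonneg (convex_Ici 0)
    (fun r _ => (hv.hasDerivAt r).continuousAt.continuousWithinAt)
    (fun r _ => (hv.hasDerivAt r).hasDerivWithinAt)
    fun r hr => (hv.deriv_pos h hw hp₀ hr₀ (by simpa using hr)).le

lemma flux_hasDerivWithinAt (hk : k ≠ 0) (hr : r₀ ≤ r) :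
    HasDerivWithinAt (fun ρ => e (vp ρ)) (w (v r) / (k * e (vp r) ^ (k - 1))) (Ici r₀) r :=
  hasDerivWithinAt_of_pow hk hr
    (fun _ hρ => h.flux_pos (hv.deriv_pos h hw hp₀ hr₀ (hr₀.trans_le hρ)))
    (hv.flux_pow_hasDerivWithinAt h hw hp₀ hr)

lemma flux_pow_le (hr : r₀ ≤ r) : e (vp r) ^ k ≤ e p₀ ^ k + w (v r) * (r - r₀) := by
  have hslope : vp r₀ = p₀ := e.injective (by rw [hv.flux_eq r₀ le_rfl, div_mul_cancel₀ _ hr₀.ne'])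
  have hcont : ContinuousOn (fun ρ => e (vp ρ) ^ k) (Icc r₀ r) :=
    ((e.continuous.comp hv.continuous).pow k).continuousOn
  refine image_le_of_deriv_right_le_deriv_boundary hcont
    (B := fun ρ => e p₀ ^ k + w (v r) * (ρ - r₀)) (B' := fun _ => w (v r))
    (fun ρ hρ => (hv.flux_pow_hasDerivWithinAt h hw hp₀ hρ.1).mono (Ici_subset_Ici.2 hρ.1))
    (by simp [hslope]) (by fun_prop) (fun ρ _ => ?_) (fun ρ hρ => ?_) (right_mem_Icc.2 hr)
  · simpa using ((((hasDerivAt_id ρ).sub_const r₀).const_mul (w (v r))).const_add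
      (e p₀ ^ k)).hasDerivWithinAt
  · exact hw.monotone (hv.monotoneOn h hw hp₀ hr₀ (hr₀.le.trans hρ.1) (hr₀.le.trans hr) hρ.2.le)

end IsProfile

end Profile

section EntireSolution

variable {n k : ℕ} {A f : ℝ → ℝ}

lemma fluxField_radial {v vp : ℝ → ℝ} (hv : ∀ r, 0 ≤ r → HasDerivAt v (vp r) r) (h0 : vp 0 = 0)
    (hvp : ∀ r, 0 ≤ r → 0 ≤ vp r) (x : EuclideanSpace ℝ (Fin n)) :
    fluxField A (fun y => v ‖y‖) x = (vp ‖x‖ * A (vp ‖x‖) / ‖x‖) • x := by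
  rw [fluxField, (hasGradientAt_radial_of_deriv_zero hv h0 x).gradient, norm_radialField h0,
    abs_of_nonneg (hvp _ (norm_nonneg x)), smul_smul]
  ring_nf

namespace IsEntireSolution

variable {u : EuclideanSpace ℝ (Fin n) → ℝ} (hu : IsEntireSolution n k A f u)

include hu

lemma contDiff : ContDiff ℝ 1 u := hu.2.1.1

lemma contDiff_fluxField : ContDiff ℝ 1 (fluxField A u) := hu.2.1.2.1

lemma mem_gammaCone (x : EuclideanSpace ℝ (Fin n)) :
    eigenvalueMultiset (fluxMatrix A u x) ∈ gammaCone n k := hu.2.1.2.2 x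

lemma pow_le_esymm (hk : k ≠ 0) (hf : ∀ t, 0 < f t) (x : EuclideanSpace ℝ (Fin n)) :
    f (u x) ^ k ≤ (eigenvalueMultiset (fluxMatrix A u x)).esymm k := by
  have hle := pow_le_pow_left₀ (hf (u x)).le (hu.2.2 x) k
  rwa [one_div, Real.rpow_inv_natCast_pow
    (esymm_pos_of_mem_gammaCone (hu.mem_gammaCone x) le_rfl).le hk] at hle

lemma le_divergence (hk : k ≠ 0) (hf : ∀ t, 0 < f t) (x : EuclideanSpace ℝ (Fin n)) :
    f (u x) ≤ divergence (fluxField A u) x := by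
  have hmem := hu.mem_gammaCone x
  have hsplits : (fluxMatrix A u x).charpoly.Splits := by
    rw [Polynomial.splits_iff_card_roots, Matrix.charpoly_natDegree_eq_dim, Fintype.card_fin]
    exact hmem.1
  have htrace :
      divergence (fluxField A u) x = (eigenvalueMultiset (fluxMatrix A u x)).esymm 1 := by
    rw [← trace_fluxMatrix, Matrix.trace_eq_sum_roots_charpoly_of_splits hsplits,
      multiset_esymm_one, eigenvalueMultiset]
  rw [htrace]
  exact (pow_le_pow_iff_left₀ (hf _).le
    (esymm_pos_of_mem_gammaCone hmem (Nat.one_le_iff_ne_zero.2 hk)).le hk).1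
    ((hu.pow_le_esymm hk hf x).trans (esymm_le_esymm_one_pow hmem))

end IsEntireSolution

theorem not_isEntireSolution_of_flux_le {u : EuclideanSpace ℝ (Fin n) → ℝ} {L : ℝ} (hk : k ≠ 0)
    (hf : IsWeight f) (hA : ∀ p, 0 < p → 0 < A p) (hL : ∀ p, 0 ≤ p → p * A p ≤ L) :
    ¬ IsEntireSolution n k A f u := by
  intro hu
  have hflux : ∀ x, 0 ≤ ‖gradient u x‖ * A ‖gradient u x‖ := fun x => by
    rcases (norm_nonneg (gradient u x)).eq_or_lt with h0 | h0
    · simp [← h0]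
    · exact mul_nonneg h0.le (hA _ h0).le
  refine not_forall_le_divergence (L := L) hu.contDiff hu.contDiff_fluxField hf.monotone hf.pos
    (fun x => ?_) (fun x => ?_) (hu.le_divergence hk hf.pos)
  · calc ‖fluxField A u x‖ = |‖gradient u x‖ * A ‖gradient u x‖| := by
          rw [fluxField, norm_smul, abs_mul, abs_norm, mul_comm, Real.norm_eq_abs]
      _ ≤ L := (abs_of_nonneg (hflux x)).trans_le (hL _ (norm_nonneg _))
  · have hgrad := ((hu.contDiff.differentiable one_ne_zero) x).hasGradientAt.hasFDerivAt.fderiv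
    rw [hgrad, InnerProductSpace.toDual_apply_apply, fluxField, real_inner_smul_right,
      real_inner_self_eq_norm_mul_norm, ← mul_assoc, mul_comm (A _)]
    exact mul_nonneg (hflux x) (norm_nonneg _)

end EntireSolution

section Necessity

variable {n k : ℕ} {A f w : ℝ → ℝ} {e ψ : ℝ ≃o ℝ} {s₀ p₀ r₀ : ℝ} {v vp : ℝ → ℝ}

lemma IsWeight.comp_min (hw : IsWeight w) (b : ℝ) : IsWeight fun t => w (min t b) where
  continuous := hw.continuous.comp (by fun_prop)
  monotone _ _ hst := hw.monotone (min_le_min_right b hst)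
  pos _ := hw.pos _

lemma tendsto_energy (hw : IsWeight w) : Tendsto (energy ψ w s₀ p₀) atTop atTop :=
  tendsto_atTop_add_const_left _ _ (hw.tendsto_integral s₀)

lemma tendsto_integral_inv_psi_symm_energy (h : IsLegendrePair A k e ψ) (hk : k ≠ 0)
    (hw : IsWeight w) (hp₀ : 0 < p₀) {C : ℝ} (hC : ∀ t, w t ≤ C) :
    Tendsto (fun s => ∫ t in s₀..s, (ψ.symm (energy ψ w s₀ p₀ t))⁻¹) atTop atTop := by
  have hC0 : 0 < C := (hw.pos 0).trans_le (hC 0)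
  have hflux : Tendsto (fun s => e (ψ.symm (energy ψ w s₀ p₀ s)) ^ k) atTop atTop :=
    (tendsto_pow_atTop hk).comp
      (e.tendsto_atTop.comp (ψ.symm.tendsto_atTop.comp (tendsto_energy hw)))
  refine tendsto_atTop_mono' _ ?_ ((tendsto_atTop_add_const_right _ (-(e p₀ ^ k))
    hflux).const_mul_atTop (inv_pos.2 hC0))
  filter_upwards [eventually_ge_atTop s₀] with s hs
  have hE : ∀ t ∈ uIcc s₀ s, 0 < energy ψ w s₀ p₀ t := fun t ht =>
    energy_pos h hw hp₀ (uIcc_of_le hs ▸ ht).1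
  have hq : ContinuousOn (fun t => (ψ.symm (energy ψ w s₀ p₀ t))⁻¹) (uIcc s₀ s) :=
    (ψ.symm.continuous.comp (continuous_energy hw.continuous)).continuousOn.inv₀
      fun t ht => (h.psi_symm_pos (hE t ht)).ne'
  have hwq : IntervalIntegrable (fun t => (ψ.symm (energy ψ w s₀ p₀ t))⁻¹ * w t) volume s₀ s :=
    (hq.mul hw.continuous.continuousOn).intervalIntegrable
  have hFTC := intervalIntegral.integral_eq_sub_of_hasDerivAt
    (fun t ht => (h.hasDerivAt_flux_pow (hE t ht)).comp t (hasDerivAt_energy hw.continuous)) hwq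
  have hle := intervalIntegral.integral_mono_on hs hwq (hq.intervalIntegrable.mul_const C)
    fun t ht => mul_le_mul_of_nonneg_left (hC t)
      (inv_pos.2 (h.psi_symm_pos (hE t (uIcc_of_le hs ▸ ht)))).le
  rw [hFTC, intervalIntegral.integral_mul_const] at hle
  simp only [Function.comp_apply, energy_self, ψ.symm_apply_apply] at hle
  rw [inv_mul_le_iff₀ hC0]
  linarith

namespace IsProfile

variable (hv : IsProfile e ψ w s₀ p₀ r₀ v vp) (h : IsLegendrePair A k e ψ) (hw : IsWeight w)
  (hp₀ : 0 < p₀) {r : ℝ}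

include hv h hw hp₀

lemma sub_le_value (hr₀ : 0 < r₀) (hr : 0 ≤ r) : s₀ - p₀ * r₀ ≤ v r := by
  have hvp : ∀ ρ ∈ interior (Icc 0 r₀), deriv v ρ ≤ p₀ := fun ρ hρ => by
    rw [interior_Icc] at hρ
    rw [(hv.hasDerivAt ρ).deriv, ← e.le_iff_le, hv.flux_eq ρ hρ.2.le, div_mul_eq_mul_div,
      div_le_iff₀ hr₀]
    exact mul_le_mul_of_nonneg_left hρ.2.le (h.flux_pos hp₀).le
  have hinner := (convex_Icc 0 r₀).image_sub_le_mul_sub_of_deriv_le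
    (fun ρ _ => (hv.hasDerivAt ρ).continuousAt.continuousWithinAt)
    (fun ρ _ => (hv.hasDerivAt ρ).differentiableAt.differentiableWithinAt) hvp
    0 (left_mem_Icc.2 hr₀.le) r₀ (right_mem_Icc.2 hr₀.le) hr₀.le
  rw [hv.value_eq, sub_zero] at hinner
  linarith [hv.monotoneOn h hw hp₀ hr₀ self_mem_Ici hr hr]

theorem radius_le {w₁ : ℝ → ℝ} (hw₁ : IsWeight w₁)
    (hint : IntegrableOn (fun s => (ψ.symm (∫ t in s₀..s, w₁ t))⁻¹) (Ioi s₀)) (hr : r₀ ≤ r)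
    (hle : ∀ t ≤ v r, w₁ t ≤ w t) :
    r ≤ r₀ + ∫ s in Ioi s₀, (ψ.symm (∫ t in s₀..s, w₁ t))⁻¹ := by
  have henergy : ∀ s ∈ Ioc s₀ (v r), ∫ t in s₀..s, w₁ t ≤ energy ψ w s₀ p₀ s := fun s hs =>
    (intervalIntegral.integral_mono_on hs.1.le (hw₁.continuous.intervalIntegrable _ _)
      (hw.continuous.intervalIntegrable _ _) fun t ht => hle t (ht.2.trans hs.2)).trans
      (le_add_of_nonneg_left (h.psi_pos hp₀).le)
  have hcont : ContinuousOn (fun s => (ψ.symm (energy ψ w s₀ p₀ s))⁻¹) (Icc s₀ (v r)) :=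
    (ψ.symm.continuous.comp (continuous_energy hw.continuous)).continuousOn.inv₀
      fun s hs => (h.psi_symm_pos (energy_pos h hw hp₀ hs.1)).ne'
  have hpos : ∀ s ∈ Ioi s₀, 0 < ψ.symm (∫ t in s₀..s, w₁ t) := fun s hs =>
    h.psi_symm_pos (hw₁.integral_pos hs)
  calc r = r₀ + ∫ s in Ioc s₀ (v r), (ψ.symm (energy ψ w s₀ p₀ s))⁻¹ := by
        rw [← intervalIntegral.integral_of_le (hv.le_value r hr), hv.radius_eq r hr]
    _ ≤ r₀ + ∫ s in Ioc s₀ (v r), (ψ.symm (∫ t in s₀..s, w₁ t))⁻¹ := by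
        gcongr r₀ + ?_
        exact setIntegral_mono_on (hcont.integrableOn_Icc.mono_set Ioc_subset_Icc_self)
          (hint.mono_set Ioc_subset_Ioi_self) measurableSet_Ioc fun s hs =>
          inv_anti₀ (hpos s hs.1) (ψ.symm.monotone (henergy s hs))
    _ ≤ _ := by
        gcongr r₀ + ?_
        exact setIntegral_mono_set hint ((ae_restrict_iff' measurableSet_Ioi).2
          (.of_forall fun s hs => (inv_pos.2 (hpos s hs)).le)) Ioc_subset_Ioi_self.eventuallyLE

end IsProfile

lemma esymm_le_of_rel_cons_replicate {s : Multiset ℝ} {d t : ℝ}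
    (hs : s ∈ gammaCone (n + 1) (k + 1)) (h : s.Rel (· ≤ ·) ((d + t) ::ₘ Multiset.replicate n t))
    (hd : 0 ≤ d) (ht : 0 ≤ t) :
    s.esymm (k + 1) ≤ (n + 1).choose (k + 1) * (d * t ^ k + t ^ (k + 1)) := by
  refine (esymm_le_esymm_of_rel hs h).trans ?_
  rw [multiset_esymm_cons_replicate, Nat.choose_succ_succ', Nat.cast_add]
  have : 0 ≤ (n.choose (k + 1) : ℝ) * (d * t ^ k) := by positivity
  rw [pow_succ']
  linarith

namespace IsEntireSolution

theorem esymm_le_of_isLocalMax {u : EuclideanSpace ℝ (Fin (n + 1)) → ℝ}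
    (hu : IsEntireSolution (n + 1) (k + 1) A f u) (h : IsLegendrePair A (k + 1) e ψ)
    (hA_pos : ∀ p : ℝ, 0 < p → 0 < A p) (hA_smooth : ContDiffOn ℝ 1 A (Ioi 0))
    (hw : IsWeight w) (hp₀ : 0 < p₀) (hv : IsProfile e ψ w s₀ p₀ 1 v vp)
    {x : EuclideanSpace ℝ (Fin (n + 1))} (hx : 1 ≤ ‖x‖)
    (hmax : IsLocalMax (fun y => u y - v ‖y‖) x) :
    (eigenvalueMultiset (fluxMatrix A u x)).esymm (k + 1) ≤
      (n + 1).choose (k + 1) * (2 * w (v ‖x‖) + e p₀ ^ (k + 1)) := by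
  have hr : 0 < ‖x‖ := one_pos.trans_le hx
  have hx0 : x ≠ 0 := norm_pos_iff.1 hr
  have hp := hv.deriv_pos h hw hp₀ one_pos hr
  have hcontact : RadialContact u v vp x :=
    ⟨hx0, hu.1.contDiffAt (isOpen_compl_singleton.mem_nhds hx0), .of_forall hv.hasDerivAt,
      hv.continuous.continuousAt, hmax⟩
  have hW := hw.pos (v ‖x‖)
  have hg := h.flux_pos hp
  have hpow := hv.flux_pow_le h hw hp₀ one_pos hx
  have hrel := hcontact.rel_eigenvalues hp (hA_pos _ hp)
    ((hA_smooth.contDiffAt (Ioi_mem_nhds hp)).differentiableAt (by norm_num)).hasDerivAt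
    ((eventually_gt_nhds hp).mono fun p hp' => h.flux_eq p hp'.le)
    ((hv.flux_hasDerivWithinAt h hw hp₀ one_pos k.succ_ne_zero hx).mono (Ici_subset_Ici.2 hx))
    (by positivity)
  set W := w (v ‖x‖)
  set g := e (vp ‖x‖)
  refine (esymm_le_of_rel_cons_replicate (hu.mem_gammaCone x) hrel (by positivity)
    (by positivity)).trans (mul_le_mul_of_nonneg_left ?_ (by positivity))
  have hradial : W / ((k + 1 : ℕ) * g ^ (k + 1 - 1)) * (g / ‖x‖) ^ k ≤ W := by
    have hdenom : 1 ≤ ((k + 1 : ℕ) : ℝ) * ‖x‖ ^ k :=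
      one_le_mul_of_one_le_of_one_le (by simp) (one_le_pow₀ hx)
    calc _ = W / ((k + 1 : ℕ) * ‖x‖ ^ k) := by
          rw [Nat.add_sub_cancel, div_pow]; field_simp
      _ ≤ W := div_le_self hW.le hdenom
  have htangential : (g / ‖x‖) ^ (k + 1) ≤ W + e p₀ ^ (k + 1) := by
    rw [div_pow, div_le_iff₀ (by positivity)]
    have hrr : ‖x‖ ≤ ‖x‖ ^ (k + 1) := le_self_pow₀ hx k.succ_ne_zero
    have hμ := pow_pos (h.flux_pos hp₀) (k + 1)
    nlinarith [mul_le_mul_of_nonneg_left hrr hW.le, mul_le_mul_of_nonneg_left (hx.trans hrr) hμ.le]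
  linarith

lemma le_value_add {u : EuclideanSpace ℝ (Fin n) → ℝ} (hu : IsEntireSolution n k A f u)
    (h : IsLegendrePair A k e ψ) (hk : k ≠ 0) (hf : IsWeight f) (hw : IsWeight w) (hp₀ : 0 < p₀)
    (hr₀ : 0 < r₀) (hv : IsProfile e ψ w s₀ p₀ r₀ v vp)
    (hflux : n * (e p₀ / r₀) < f (s₀ - p₀ * r₀)) {M : ℝ} (hM : 0 ≤ M)
    (hsphere : ∀ x, ‖x‖ = r₀ → u x ≤ v ‖x‖ + M) (x : EuclideanSpace ℝ (Fin n)) (hx : ‖x‖ < r₀) :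
    u x ≤ v ‖x‖ + M := by
  refine le_of_forall_gt_imp_ge_of_dense fun b hb => ?_
  obtain ⟨M', hM', rfl⟩ : ∃ M', M < M' ∧ v ‖x‖ + M' = b := ⟨b - v ‖x‖, by linarith, by ring⟩
  have hvp0 := hv.deriv_zero h hr₀.le
  have hvp : ∀ r, 0 ≤ r → 0 ≤ vp r := fun r hr => hr.eq_or_lt.elim (fun h0 => h0 ▸ hvp0.ge)
    fun h0 => (hv.deriv_pos h hw hp₀ hr₀ h0).le
  have hderiv : ∀ r, 0 ≤ r → HasDerivAt (fun r => v r + M') (vp r) r := fun r _ =>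
    (hv.hasDerivAt r).add_const M'
  refine le_of_divergence_lt (v := fun y => v ‖y‖ + M') (Y := fun y => (e p₀ / r₀) • y)
    h.monotoneOn Metric.isOpen_ball Metric.isBounded_ball hu.contDiff
    (contDiff_one_radial hderiv hv.continuous hvp0) hu.contDiff_fluxField (by fun_prop)
    (fun y hy => ?_) (fun y hy => ?_) (fun y _ hy => ?_) x (mem_ball_zero_iff.2 hx)
  · have hy' := (mem_ball_zero_iff.1 hy).le
    rw [fluxField_radial hderiv hvp0 hvp, ← h.flux_eq _ (hvp _ (norm_nonneg y)), hv.flux_eq _ hy']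
    rcases eq_or_ne y 0 with rfl | hy0
    · simp
    · rw [mul_div_cancel_right₀ _ (norm_ne_zero_iff.2 hy0)]
  · rw [frontier_ball _ hr₀.ne', mem_sphere_zero_iff_norm] at hy
    linarith [hsphere y hy]
  · rw [divergence_smul_id]
    refine (hflux.trans_le (hf.monotone ?_)).trans_le (hu.le_divergence hk hf.pos y)
    linarith [hv.sub_le_value h hw hp₀ hr₀ (norm_nonneg y)]

lemma le_value_of_isLocalMax {u : EuclideanSpace ℝ (Fin (n + 1)) → ℝ}
    (hu : IsEntireSolution (n + 1) (k + 1) A f u) (h : IsLegendrePair A (k + 1) e ψ)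
    (hA_pos : ∀ p : ℝ, 0 < p → 0 < A p) (hA_smooth : ContDiffOn ℝ 1 A (Ioi 0)) (hf : IsWeight f)
    (hw : IsWeight w) (hwf : ∀ t, 4 * (n + 1).choose (k + 1) * w t ≤ f t ^ (k + 1)) (hp₀ : 0 < p₀)
    (hflux : 2 * (n + 1).choose (k + 1) * e p₀ ^ (k + 1) < f (s₀ - p₀) ^ (k + 1))
    (hv : IsProfile e ψ w s₀ p₀ 1 v vp) {x : EuclideanSpace ℝ (Fin (n + 1))} (hx : 1 ≤ ‖x‖)
    (hmax : IsLocalMax (fun y => u y - v ‖y‖) x) : u x ≤ v ‖x‖ := by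
  by_contra! hlt
  have hlow := hv.sub_le_value h hw hp₀ one_pos (norm_nonneg x)
  rw [mul_one] at hlow
  have hlower := hu.pow_le_esymm k.succ_ne_zero hf.pos x
  have hupper := hu.esymm_le_of_isLocalMax h hA_pos hA_smooth hw hp₀ hv hx hmax
  linarith [(hf.pow (k + 1)).monotone hlow, (hf.pow (k + 1)).monotone hlt.le, hwf (v ‖x‖)]

theorem le_value_of_le_on_sphere {u : EuclideanSpace ℝ (Fin (n + 1)) → ℝ}
    (hu : IsEntireSolution (n + 1) (k + 1) A f u) (h : IsLegendrePair A (k + 1) e ψ)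
    (hA_pos : ∀ p : ℝ, 0 < p → 0 < A p) (hA_smooth : ContDiffOn ℝ 1 A (Ioi 0)) (hf : IsWeight f)
    (hw : IsWeight w) (hwf : ∀ t, 4 * (n + 1).choose (k + 1) * w t ≤ f t ^ (k + 1)) (hp₀ : 0 < p₀)
    (hflux : (n + 1 : ℕ) * e p₀ < f (s₀ - p₀))
    (hflux_pow : 2 * (n + 1).choose (k + 1) * e p₀ ^ (k + 1) < f (s₀ - p₀) ^ (k + 1))
    (hv : IsProfile e ψ w s₀ p₀ 1 v vp) {ρ : ℝ} (hρ : 1 ≤ ρ)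
    (hsphere : ∀ x, ‖x‖ = ρ → u x ≤ v ‖x‖) (x : EuclideanSpace ℝ (Fin (n + 1))) (hx : ‖x‖ ≤ ρ) :
    u x ≤ v ‖x‖ := by
  have hcont : Continuous fun y => u y - v ‖y‖ := hu.contDiff.continuous.sub
    ((continuous_iff_continuousAt.2 fun r => (hv.hasDerivAt r).continuousAt).comp continuous_norm)
  have hcompact : IsCompact {y : EuclideanSpace ℝ (Fin (n + 1)) | 1 ≤ ‖y‖ ∧ ‖y‖ ≤ ρ} :=
    (isCompact_closedBall 0 ρ).of_isClosed_subset
      ((isClosed_le continuous_const continuous_norm).inter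
        (isClosed_le continuous_norm continuous_const)) fun y hy => mem_closedBall_zero_iff.2 hy.2
  obtain ⟨x₁, ⟨hx₁, hx₁ρ⟩, hmax⟩ := hcompact.exists_isMaxOn
    ⟨EuclideanSpace.single 0 1, by simpa using hρ⟩ hcont.continuousOn
  have hbound : ∀ y, ‖y‖ ≤ ρ → u y ≤ v ‖y‖ + max (u x₁ - v ‖x₁‖) 0 := fun y hy => by
    have hannulus : ∀ y, 1 ≤ ‖y‖ → ‖y‖ ≤ ρ → u y ≤ v ‖y‖ + max (u x₁ - v ‖x₁‖) 0 :=
      fun y hy hyρ => sub_le_iff_le_add'.1 ((hmax ⟨hy, hyρ⟩).trans (le_max_left _ _))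
    rcases le_or_gt 1 ‖y‖ with hy1 | hy1
    · exact hannulus y hy1 hy
    · exact hu.le_value_add h k.succ_ne_zero hf hw hp₀ one_pos hv (by simpa using hflux)
        (le_max_right _ _) (fun z hz => hannulus z hz.ge (hz.le.trans hρ)) y hy1
  suffices hx₁0 : u x₁ - v ‖x₁‖ ≤ 0 by simpa [max_eq_right hx₁0] using hbound x hx
  by_contra! hpos
  have hlt : ‖x₁‖ < ρ := hx₁ρ.lt_of_ne fun heq => (sub_pos.1 hpos).not_ge (hsphere x₁ heq)
  have hlocal : IsLocalMax (fun y => u y - v ‖y‖) x₁ := by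
    filter_upwards [continuous_norm.continuousAt.eventually (gt_mem_nhds hlt)] with y hy
    exact sub_le_iff_le_add'.2 (max_eq_left hpos.le ▸ hbound y hy.le)
  linarith [hu.le_value_of_isLocalMax h hA_pos hA_smooth hf hw hwf hp₀ hflux_pow hv hx₁ hlocal]

end IsEntireSolution

lemma IsLegendrePair.exists_slope (h : IsLegendrePair A k e ψ) (hk : k ≠ 0) (a b : ℝ) {F G : ℝ}
    (hF : 0 < F) (hG : 0 < G) :
    ∃ p₀, 0 < p₀ ∧ p₀ ≤ 1 ∧ a * e p₀ < F ∧ b * e p₀ ^ k < G := by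
  have hflux : ContinuousAt (fun p => a * e p) 0 := (e.continuous.const_mul a).continuousAt
  have hflux_pow : ContinuousAt (fun p => b * e p ^ k) 0 :=
    ((e.continuous.pow k).const_mul b).continuousAt
  obtain ⟨p₀, ⟨hp₀, hp₀1⟩, hp₀F, hp₀G⟩ :
      ∃ p ∈ Ioc (0 : ℝ) 1, a * e p < F ∧ b * e p ^ k < G :=
    (Filter.Eventually.and (Ioc_mem_nhdsGT one_pos)
      (nhdsWithin_le_nhds ((hflux.eventually_lt_const (by simpa [h.flux_zero])).and
        (hflux_pow.eventually_lt_const (by simpa [h.flux_zero, hk]))))).exists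
  exact ⟨p₀, hp₀, hp₀1, hp₀F, hp₀G⟩

namespace IsWeight

variable (hw : IsWeight w) (h : IsLegendrePair A k e ψ)

include hw h

lemma integrableOn_inv_psi_symm_const_mul {c ε : ℝ} (hε : 0 < ε)
    (hint : IntegrableAtFilter (fun s => (ψ.symm (∫ t in c..s, w t))⁻¹) atTop) (a : ℝ) :
    IntegrableOn (fun s => (ψ.symm (∫ t in a..s, ε * w t))⁻¹) (Ioi a) := by
  have hεw := hw.const_mul hε
  refine h.isKernel.integrableOn_Ioi (hεw.pos a) ((hεw.monotone_integral a).monotoneOn _)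
    (fun s hs => hεw.mul_sub_le_integral (le_of_lt hs))
    (h.isKernel.integrableAtFilter_of_eventually_mul_integral_le hw (half_pos hε)
      (hεw.monotone_integral a) ?_ hint)
  filter_upwards [hw.eventually_add_mul_integral_le (half_lt_self hε) c 0] with s hs
  simpa only [zero_add, intervalIntegral.integral_const_mul] using hs

theorem exists_isProfile_le_value (hk : k ≠ 0) (hp₀ : 0 < p₀) (hr₀ : 0 < r₀)
    (hint : IntegrableOn (fun s => (ψ.symm (∫ t in s₀..s, w t))⁻¹) (Ioi s₀)) :
    ∃ ρ, r₀ ≤ ρ ∧ ∀ S, ∃ w₁ v vp, IsWeight w₁ ∧ (∀ t, w₁ t ≤ w t) ∧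
      IsProfile e ψ w₁ s₀ p₀ r₀ v vp ∧ S ≤ v ρ := by
  have hJ : 0 ≤ ∫ s in Ioi s₀, (ψ.symm (∫ t in s₀..s, w t))⁻¹ :=
    setIntegral_nonneg measurableSet_Ioi fun s hs =>
      inv_nonneg.2 (h.psi_symm_nonneg (hw.integral_nonneg (le_of_lt hs)))
  set J := ∫ s in Ioi s₀, (ψ.symm (∫ t in s₀..s, w t))⁻¹
  refine ⟨r₀ + J + 1, by linarith, fun S => ?_⟩
  have hw₁ := hw.comp_min S
  obtain ⟨v, vp, hv⟩ := exists_isProfile h hw₁ hp₀ hr₀.ne'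
    (tendsto_integral_inv_psi_symm_energy h hk hw₁ hp₀ fun t => hw.monotone (min_le_right t S))
  refine ⟨_, v, vp, hw₁, fun t => hw.monotone (min_le_left t S), hv, ?_⟩
  by_contra! hlt
  have hle := hv.radius_le h hw₁ hp₀ hw hint (r := r₀ + J + 1) (by linarith) fun t ht => by
    rw [min_eq_left (ht.trans hlt.le)]
  linarith

end IsWeight

theorem IsEntireSolution.psiKellerOsserman {u : EuclideanSpace ℝ (Fin n) → ℝ}
    (hu : IsEntireSolution n k A f u) (h : IsLegendrePair A k e ψ) (hk : 1 ≤ k) (hkn : k ≤ n)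
    (hA_pos : ∀ p : ℝ, 0 < p → 0 < A p) (hA_smooth : ContDiffOn ℝ 1 A (Ioi 0)) (hf : IsWeight f)
    {b c : ℝ} (hcb : c ≤ b) : PsiKellerOsserman A f k c b := by
  obtain ⟨k, rfl⟩ := Nat.exists_eq_succ_of_ne_zero (Nat.one_le_iff_ne_zero.1 hk)
  obtain ⟨n, rfl⟩ := Nat.exists_eq_succ_of_ne_zero (Nat.one_le_iff_ne_zero.1 (hk.trans hkn))
  rw [psiKellerOsserman_iff h hf hcb]
  intro hint
  have hN : (0 : ℝ) < 4 * (n + 1).choose (k + 1) :=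
    mul_pos four_pos (Nat.cast_pos.2 (Nat.choose_pos hkn))
  have hε := inv_pos.2 hN
  have hfk := hf.pow (k + 1)
  obtain ⟨p₀, hp₀, hp₀1, hflux, hflux_pow⟩ := h.exists_slope k.succ_ne_zero (n + 1 : ℕ)
    (2 * (n + 1).choose (k + 1)) (hf.pos (u 0 - 2)) (hfk.pos (u 0 - 2))
  have hlow : u 0 - 2 ≤ u 0 - 1 - p₀ := by linarith
  obtain ⟨ρ, hρ, hprofile⟩ := (hfk.const_mul hε).exists_isProfile_le_value h k.succ_ne_zero hp₀
    one_pos (hfk.integrableOn_inv_psi_symm_const_mul h hε hint (u 0 - 1))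
  obtain ⟨U, hU⟩ := (isCompact_closedBall (0 : EuclideanSpace ℝ (Fin (n + 1))) ρ).bddAbove_image
    hu.contDiff.continuous.continuousOn
  obtain ⟨w, v, vp, hw, hwf, hv, hUv⟩ := hprofile U
  have hzero : u 0 ≤ v ‖(0 : EuclideanSpace ℝ (Fin (n + 1)))‖ :=
    hu.le_value_of_le_on_sphere h hA_pos hA_smooth hf hw
      (fun t => (le_inv_mul_iff₀ hN).1 (hwf t)) hp₀ (hflux.trans_le (hf.monotone hlow))
      (hflux_pow.trans_le (hfk.monotone hlow)) hv hρ
      (fun x hx => (hU ⟨x, mem_closedBall_zero_iff.2 hx.le, rfl⟩).trans (hx ▸ hUv)) 0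
      (by rw [norm_zero]; linarith)
  have hmono := hv.monotoneOn h hw hp₀ one_pos self_mem_Ici (mem_Ici.2 zero_le_one) zero_le_one
  rw [norm_zero] at hzero
  rw [hv.value_eq] at hmono
  linarith

end Necessity

section Delay

theorem exists_continuous_fixedPoint_of_delay (T : (ℝ → ℝ) → ℝ → ℝ)
    (hinit : ∀ R R', EqOn (T R) (T R') (Iic 0))
    (hdelay : ∀ R R' a, EqOn R R' (Iic a) → EqOn (T R) (T R') (Iic (a + 1)))
    (hcont : ∀ R, Continuous R → Continuous (T R)) : ∃ R, Continuous R ∧ T R = R := by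
  set iter : ℕ → ℝ → ℝ := fun j => T^[j + 1] 0
  have hsucc : ∀ j, iter (j + 1) = T (iter j) := fun j => Function.iterate_succ_apply' T (j + 1) 0
  have hiter_cont : ∀ j, Continuous (iter j) := fun j => by
    induction j with
    | zero => exact hcont 0 continuous_const
    | succ j ih => exact hsucc j ▸ hcont _ ih
  have hstable_succ : ∀ j : ℕ, EqOn (iter (j + 1)) (iter j) (Iic j) := fun j => by
    induction j with
    | zero => rw [hsucc, Nat.cast_zero]; exact hinit _ _
    | succ j ih => rw [hsucc (j + 1), hsucc j, Nat.cast_succ]; exact hdelay _ _ _ (hsucc j ▸ ih)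
  have hstable : ∀ i j : ℕ, i ≤ j → EqOn (iter j) (iter i) (Iic i) := fun i j hij => by
    induction j, hij using Nat.le_induction with
    | base => exact eqOn_refl _ _
    | succ j hij ih =>
      exact ((hstable_succ j).mono (Iic_subset_Iic.2 (Nat.cast_le.2 hij))).trans ih
  set R : ℝ → ℝ := fun s => iter ⌈s⌉₊ s
  have hR : ∀ j : ℕ, EqOn R (iter j) (Iic j) := fun j s hs =>
    (hstable _ _ (Nat.ceil_le.2 hs) (Nat.le_ceil s)).symm
  refine ⟨R, continuous_iff_continuousAt.2 fun s => ?_, funext fun s => ?_⟩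
  · obtain ⟨j, hj⟩ := exists_nat_gt s
    exact (hiter_cont j).continuousAt.congr ((hR j).eventuallyEq_of_mem (Iic_mem_nhds hj)).symm
  · have hs : s ≤ ⌈s⌉₊ := Nat.le_ceil s
    rw [hdelay _ _ _ (hR ⌈s⌉₊) (hs.trans (lt_add_one _).le), ← hsucc, hstable_succ _ hs]

/-- The weight `w` multiplied by a power of an upper bound for the radius at which the height `t`
is reached. The bound uses the radius `R (t - 1)` of a strictly smaller height. -/
noncomputable def delayWeight (w : ℝ → ℝ) (r₀ δ : ℝ) (j : ℕ) (R : ℝ → ℝ) (t : ℝ) : ℝ :=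
  (max (R (t - 1)) r₀ + δ) ^ j * w t

/-- `R s` is the radius at which the radial profile with slope `p₀` at height `0` and radius `r₀`
reaches the height `s`, when its weight is the `delayWeight` built from `R` itself. For `s < 0` the
slope is frozen at `p₀`. -/
structure IsDelayedRadius (ψ : ℝ ≃o ℝ) (w : ℝ → ℝ) (r₀ p₀ : ℝ) (j : ℕ) (R : ℝ → ℝ) : Prop where
  continuous : Continuous R
  eq_integral : ∀ s, R s =
    r₀ + ∫ t in (0 : ℝ)..s, (ψ.symm (energy ψ (delayWeight w r₀ p₀⁻¹ j R) 0 p₀ (max t 0)))⁻¹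

variable {A w R R' : ℝ → ℝ} {k j : ℕ} {e ψ : ℝ ≃o ℝ} {a δ r₀ p₀ s : ℝ}

lemma delayWeight_pos (hw : IsWeight w) (hr₀ : 0 < r₀) (hδ : 0 ≤ δ) (t : ℝ) :
    0 < delayWeight w r₀ δ j R t :=
  mul_pos (pow_pos (add_pos_of_pos_of_nonneg (lt_max_of_lt_right hr₀) hδ) j) (hw.pos t)

lemma continuous_delayWeight (hw : Continuous w) (hR : Continuous R) :
    Continuous (delayWeight w r₀ δ j R) :=
  ((((hR.comp (continuous_sub_right 1)).max continuous_const).add continuous_const).pow j).mul hw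

lemma isWeight_delayWeight (hw : IsWeight w) (hr₀ : 0 < r₀) (hδ : 0 ≤ δ) (hR : Continuous R)
    (hmono : Monotone R) : IsWeight (delayWeight w r₀ δ j R) where
  continuous := continuous_delayWeight hw.continuous hR
  monotone s t hst := by
    have hnonneg : ∀ t, 0 ≤ max (R (t - 1)) r₀ + δ := fun t =>
      add_nonneg (hr₀.le.trans (le_max_right _ _)) hδ
    have hbase : max (R (s - 1)) r₀ + δ ≤ max (R (t - 1)) r₀ + δ :=
      add_le_add_left (max_le_max_right _ (hmono (sub_le_sub_right hst 1))) δ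
    exact mul_le_mul (pow_le_pow_left₀ (hnonneg s) hbase j) (hw.monotone hst) (hw.pos s).le
      (pow_nonneg (hnonneg t) j)
  pos := delayWeight_pos hw hr₀ hδ

lemma delayWeight_eqOn_Iic (h : EqOn R R' (Iic a)) :
    EqOn (delayWeight w r₀ δ j R) (delayWeight w r₀ δ j R') (Iic (a + 1)) := fun t ht => by
  rw [delayWeight, delayWeight, h (show t - 1 ≤ a from sub_le_iff_le_add.2 ht)]

lemma psi_le_energy_delayWeight (hw : IsWeight w) (hr₀ : 0 < r₀) (hδ : 0 ≤ δ) (hs : 0 ≤ s) :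
    ψ p₀ ≤ energy ψ (delayWeight w r₀ δ j R) 0 p₀ s :=
  le_add_of_nonneg_right
    (intervalIntegral.integral_nonneg hs fun t _ => (delayWeight_pos hw hr₀ hδ t).le)

lemma slope_delayWeight_mem_Ioc (hw : IsWeight w) (hr₀ : 0 < r₀) (hp₀ : 0 < p₀) (hs : 0 ≤ s) :
    (ψ.symm (energy ψ (delayWeight w r₀ p₀⁻¹ j R) 0 p₀ s))⁻¹ ∈ Ioc 0 p₀⁻¹ := by
  have hle : p₀ ≤ ψ.symm (energy ψ (delayWeight w r₀ p₀⁻¹ j R) 0 p₀ s) :=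
    ψ.le_symm_apply.2 (psi_le_energy_delayWeight hw hr₀ (inv_nonneg.2 hp₀.le) hs)
  exact ⟨inv_pos.2 (hp₀.trans_le hle), inv_anti₀ hp₀ hle⟩

lemma continuous_slope_delayWeight (hw : IsWeight w) (hr₀ : 0 < r₀) (hp₀ : 0 < p₀)
    (hR : Continuous R) :
    Continuous fun t => (ψ.symm (energy ψ (delayWeight w r₀ p₀⁻¹ j R) 0 p₀ (max t 0)))⁻¹ := by
  have henergy := continuous_energy (ψ := ψ) (s₀ := 0) (p₀ := p₀)
    (continuous_delayWeight (r₀ := r₀) (δ := p₀⁻¹) (j := j) hw.continuous hR)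
  exact (ψ.symm.continuous.comp (henergy.comp (by fun_prop))).inv₀ fun t =>
    (inv_pos.1 (slope_delayWeight_mem_Ioc hw hr₀ hp₀ (le_max_right t 0)).1).ne'

lemma integral_eqOn_Iic {q q' : ℝ → ℝ} (h : EqOn q q' (Iic (max a 0))) :
    EqOn (fun s => ∫ t in (0 : ℝ)..s, q t) (fun s => ∫ t in (0 : ℝ)..s, q' t) (Iic a) := fun s hs =>
  intervalIntegral.integral_congr fun _ ht =>
    h (ht.2.trans (max_le (le_max_right _ _) ((show s ≤ a from hs).trans (le_max_left _ _))))

lemma energy_max_eqOn_Iic {w' : ℝ → ℝ} (h : EqOn w w' (Ioo 0 a)) :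
    EqOn (fun t => energy ψ w 0 p₀ (max t 0)) (fun t => energy ψ w' 0 p₀ (max t 0))
      (Iic (max a 0)) := fun _ ht => congrArg (ψ p₀ + ·)
  (intervalIntegral.integral_congr_Ioo_of_le (le_max_right _ 0) fun _ hx => h ⟨hx.1,
    (lt_max_iff.1 (hx.2.trans_le (max_le ht (le_max_right a 0)))).resolve_right hx.1.not_gt⟩)

theorem exists_isDelayedRadius (hw : IsWeight w) (hr₀ : 0 < r₀) (hp₀ : 0 < p₀) (j : ℕ) :
    ∃ R, IsDelayedRadius ψ w r₀ p₀ j R := by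
  set T : (ℝ → ℝ) → ℝ → ℝ := fun R s => r₀ + ∫ t in (0 : ℝ)..s,
    (ψ.symm (energy ψ (delayWeight w r₀ p₀⁻¹ j R) 0 p₀ (max t 0)))⁻¹
  have hT : ∀ R R' a, EqOn (delayWeight w r₀ p₀⁻¹ j R) (delayWeight w r₀ p₀⁻¹ j R') (Ioo 0 a) →
      EqOn (T R) (T R') (Iic a) := fun R R' a hRR' =>
    (integral_eqOn_Iic
      ((energy_max_eqOn_Iic hRR').comp_left (g := fun z => (ψ.symm z)⁻¹))).comp_left
      (g := fun z => r₀ + z)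
  obtain ⟨R, hR, hfix⟩ := exists_continuous_fixedPoint_of_delay T
    (fun R R' => hT R R' 0 fun t ht => absurd ht.2 ht.1.not_gt)
    (fun R R' a hRR' => hT R R' _
      ((delayWeight_eqOn_Iic hRR').mono fun t (ht : t ∈ Ioo _ _) => ht.2.le))
    (fun R hR => continuous_const.add
      (intervalIntegral.continuous_primitive (fun _ _ =>
        (continuous_slope_delayWeight hw hr₀ hp₀ hR).intervalIntegrable _ _) 0))
  exact ⟨R, hR, fun s => (congrFun hfix s).symm⟩

namespace IsDelayedRadius

variable (hR : IsDelayedRadius ψ w r₀ p₀ j R) (hw : IsWeight w) (hr₀ : 0 < r₀) (hp₀ : 0 < p₀)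

include hR hw hr₀ hp₀

lemma hasDerivAt (s : ℝ) :
    HasDerivAt R (ψ.symm (energy ψ (delayWeight w r₀ p₀⁻¹ j R) 0 p₀ (max s 0)))⁻¹ s := by
  have hslope := continuous_slope_delayWeight (ψ := ψ) (j := j) hw hr₀ hp₀ hR.continuous
  exact ((hslope.integral_hasStrictDerivAt 0 s).hasDerivAt.const_add r₀).congr_of_eventuallyEq
    (.of_forall hR.eq_integral)

lemma monotone : Monotone R :=
  monotone_of_hasDerivAt_nonneg (hR.hasDerivAt hw hr₀ hp₀) fun _ =>
    (slope_delayWeight_mem_Ioc hw hr₀ hp₀ (le_max_right _ _)).1.le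

lemma isWeight : IsWeight (delayWeight w r₀ p₀⁻¹ j R) :=
  isWeight_delayWeight hw hr₀ (inv_nonneg.2 hp₀.le) hR.continuous (hR.monotone hw hr₀ hp₀)

lemma le_delay (s : ℝ) : R s ≤ max (R (s - 1)) r₀ + p₀⁻¹ := by
  have hderiv := hR.hasDerivAt hw hr₀ hp₀
  have hlip : R s - R (s - 1) ≤ p₀⁻¹ * (s - (s - 1)) :=
    image_sub_le_mul_sub_of_deriv_le (fun t => (hderiv t).differentiableAt)
      (fun t => (hderiv t).deriv ▸
        (slope_delayWeight_mem_Ioc hw hr₀ hp₀ (le_max_right _ _)).2) (sub_le_self s zero_le_one)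
  rw [sub_sub_cancel, mul_one, sub_le_iff_le_add'] at hlip
  exact hlip.trans (add_le_add_left (le_max_left _ _) _)

omit hw hr₀ hp₀ in
lemma eq_integral_of_nonneg (hs : 0 ≤ s) : R s =
    r₀ + ∫ t in (0 : ℝ)..s, (ψ.symm (energy ψ (delayWeight w r₀ p₀⁻¹ j R) 0 p₀ t))⁻¹ := by
  rw [hR.eq_integral s]
  congr 1
  refine intervalIntegral.integral_congr fun t ht => ?_
  simp only [max_eq_left (uIcc_of_le hs ▸ ht).1]

/-- If the radii stayed bounded, the delay would only change `w` by a bounded factor. -/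
theorem tendsto_atTop (h : IsLegendrePair A k e ψ) {c : ℝ}
    (hKO : ¬ IntegrableAtFilter (fun s => (ψ.symm (∫ t in c..s, w t))⁻¹) atTop) :
    Tendsto R atTop atTop := by
  have hmono := hR.monotone hw hr₀ hp₀
  refine (tendsto_atTop_of_monotone hmono).resolve_right fun ⟨l, hl⟩ => hKO ?_
  have hδ : 0 ≤ p₀⁻¹ := inv_nonneg.2 hp₀.le
  set C := (max l r₀ + p₀⁻¹) ^ j
  have hC₀ : 0 ≤ C := pow_nonneg (add_nonneg (hr₀.le.trans (le_max_right _ _)) hδ) j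
  have hweight_le : ∀ t, delayWeight w r₀ p₀⁻¹ j R t ≤ C * w t := fun t =>
    mul_le_mul_of_nonneg_right (pow_le_pow_left₀ (add_nonneg (hr₀.le.trans (le_max_right _ _)) hδ)
      (add_le_add_left (max_le_max_right _ (hmono.ge_of_tendsto hl _)) _) j) (hw.pos t).le
  have henergy_le : ∀ s, 0 ≤ s → energy ψ (delayWeight w r₀ p₀⁻¹ j R) 0 p₀ s ≤
      ψ p₀ + C * ∫ t in (0 : ℝ)..s, w t := fun s hs => by
    rw [← intervalIntegral.integral_const_mul]
    exact add_le_add_right (intervalIntegral.integral_mono_on hs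
      ((hR.isWeight hw hr₀ hp₀).continuous.intervalIntegrable _ _)
      ((hw.continuous.const_mul C).intervalIntegrable _ _) fun t _ => hweight_le t) _
  have hint : IntegrableAtFilter
      (fun s => (ψ.symm (energy ψ (delayWeight w r₀ p₀⁻¹ j R) 0 p₀ (max s 0)))⁻¹) atTop :=
    ⟨Ioi 0, Ioi_mem_atTop 0, integrableOn_Ioi_deriv_of_nonneg'
      (fun s _ => hR.hasDerivAt hw hr₀ hp₀ s)
      (fun s _ => (slope_delayWeight_mem_Ioc hw hr₀ hp₀ (le_max_right _ _)).1.le) hl⟩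
  refine h.isKernel.integrableAtFilter_of_const_mul (C := C + 1) hw (by linarith)
    (h.isKernel.integrableAtFilter_mono
      (z := fun s => energy ψ (delayWeight w r₀ p₀⁻¹ j R) 0 p₀ (max s 0))
      ((hw.monotone_integral c).const_mul (by linarith)) ?_ ?_ hint)
  · exact .of_forall fun s => (h.psi_pos hp₀).trans_le
      (psi_le_energy_delayWeight hw hr₀ hδ (le_max_right _ _))
  · filter_upwards [eventually_ge_atTop 0,
      hw.eventually_add_mul_integral_le (c := c) (lt_add_one C) 0 (ψ p₀)] with s hs hle
    exact (max_eq_left hs).symm ▸ (henergy_le s hs).trans hle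

end IsDelayedRadius

end Delay

section Sufficiency

variable {n k : ℕ} {A f w : ℝ → ℝ} {e ψ : ℝ ≃o ℝ} {s₀ p₀ r₀ : ℝ} {v vp : ℝ → ℝ}

lemma isEntireSolution_of_axialMap {u : EuclideanSpace ℝ (Fin (n + 1)) → ℝ} (hkn : k ≤ n)
    (hf : ∀ t, 0 < f t) (hu : ContDiff ℝ 1 u) (hu₂ : ContDiffOn ℝ 2 u {0}ᶜ)
    (hflux : ContDiff ℝ 1 (fluxField A u))
    (h : ∀ x, ∃ a b : ℝ, ∃ y : EuclideanSpace ℝ (Fin (n + 1)), 0 < a ∧ 0 < b ∧ ‖y‖ = 1 ∧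
      HasFDerivAt (fluxField A u) (axialMap a b y) x ∧ f (u x) ^ (k + 1) ≤ b * a ^ k) :
    IsEntireSolution (n + 1) (k + 1) A f u := by
  have hspectrum : ∀ x, ∃ a b : ℝ, 0 < a ∧ 0 < b ∧ f (u x) ^ (k + 1) ≤ b * a ^ k ∧
      eigenvalueMultiset (fluxMatrix A u x) = b ::ₘ Multiset.replicate n a := fun x => by
    obtain ⟨a, b, y, ha, hb, hy, hL, hle⟩ := h x
    exact ⟨a, b, ha, hb, hle, by
      rw [eigenvalueMultiset_fluxMatrix hL, roots_charpoly_axialMap finrank_euclideanSpace_fin hy]⟩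
  refine ⟨hu₂, ⟨hu, hflux, fun x => ?_⟩, fun x => ?_⟩
  · obtain ⟨a, b, ha, hb, -, heq⟩ := hspectrum x
    refine heq ▸ ⟨by simp, fun l hl hlk => ?_⟩
    obtain ⟨l, rfl⟩ := Nat.exists_eq_succ_of_ne_zero (Nat.one_le_iff_ne_zero.1 hl)
    have hchoose : 0 < n.choose l := Nat.choose_pos (by omega)
    rw [multiset_esymm_cons_replicate]
    positivity
  · obtain ⟨a, b, ha, hb, hle, heq⟩ := hspectrum x
    have hchoose : (1 : ℝ) ≤ n.choose k := by exact_mod_cast Nat.choose_pos hkn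
    rw [← Real.pow_rpow_inv_natCast (hf (u x)).le k.succ_ne_zero, ← one_div, heq,
      multiset_esymm_cons_replicate]
    refine Real.rpow_le_rpow (pow_pos (hf _) _).le (hle.trans ?_) (by positivity)
    exact (le_mul_of_one_le_left (by positivity) hchoose).trans
      (le_add_of_nonneg_left (by positivity))

lemma IsLegendrePair.contDiffAt_flux_symm (h : IsLegendrePair A k e ψ)
    (hA_smooth : ContDiffOn ℝ 1 A (Ioi 0))
    (hA_deriv : ∀ p, 0 < p → 0 < deriv (fun t => t * A t) p) {y : ℝ} (hy : 0 < y) :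
    ContDiffAt ℝ 1 e.symm y := by
  have hp : 0 < e.symm y := h.flux_symm_zero ▸ e.symm.strictMono hy
  have heq : e =ᶠ[𝓝 (e.symm y)] fun t => t * A t := by
    filter_upwards [Ioi_mem_nhds hp] with q hq using h.flux_eq q (le_of_lt hq)
  have hsmooth : ContDiffAt ℝ 1 e (e.symm y) :=
    ((contDiffOn_id.mul hA_smooth).contDiffAt (Ioi_mem_nhds hp)).congr_of_eventuallyEq heq
  exact e.toHomeomorph.toOpenPartialHomeomorph.contDiffAt_symm_deriv
    (heq.deriv_eq ▸ (hA_deriv _ hp).ne') (mem_univ y)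
    (hsmooth.differentiableAt one_ne_zero).hasDerivAt hsmooth

/-- The derivative `(e ∘ v')'` of the flux of a profile whose weight satisfies the matching
condition `w(s₀) r₀ = (k + 1) e(p₀)ᵏ⁺¹` at `r₀`; it is then constant for `r ≤ r₀`. -/
noncomputable def fluxDeriv (e : ℝ ≃o ℝ) (w v vp : ℝ → ℝ) (r₀ : ℝ) (k : ℕ) (r : ℝ) : ℝ :=
  w (v (max r r₀)) / ((k + 1) * e (vp (max r r₀)) ^ k)

namespace IsProfile

variable (hv : IsProfile e ψ w s₀ p₀ r₀ v vp) (h : IsLegendrePair A (k + 1) e ψ) (hw : IsWeight w)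
  (hp₀ : 0 < p₀) (hr₀ : 0 < r₀)

include hv h hw hp₀ hr₀

lemma flux_pos {r : ℝ} (hr : 0 < r) : 0 < e (vp r) := h.flux_pos (hv.deriv_pos h hw hp₀ hr₀ hr)

lemma fluxDeriv_pos (r : ℝ) : 0 < fluxDeriv e w v vp r₀ k r :=
  div_pos (hw.pos _)
    (mul_pos k.cast_add_one_pos (pow_pos (hv.flux_pos h hw hp₀ hr₀ (lt_max_of_lt_right hr₀)) k))

lemma continuous_fluxDeriv : Continuous (fluxDeriv e w v vp r₀ k) := by
  have hmax : Continuous fun r => max r r₀ := by fun_prop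
  have hv_cont : Continuous v :=
    continuous_iff_continuousAt.2 fun r => (hv.hasDerivAt r).continuousAt
  exact (hw.continuous.comp (hv_cont.comp hmax)).div
    (continuous_const.mul (((e.continuous.comp hv.continuous).comp hmax).pow k)) fun r =>
      (mul_pos k.cast_add_one_pos
        (pow_pos (hv.flux_pos h hw hp₀ hr₀ (lt_max_of_lt_right hr₀)) k)).ne'

omit hw in
lemma fluxDeriv_of_le (hmatch : w s₀ * r₀ = (k + 1) * e p₀ ^ (k + 1)) {r : ℝ} (hr : r ≤ r₀) :
    fluxDeriv e w v vp r₀ k r = e p₀ / r₀ := by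
  have hflux := h.flux_pos hp₀
  rw [fluxDeriv, max_eq_right hr, hv.value_eq, hv.flux_eq r₀ le_rfl, div_mul_cancel₀ _ hr₀.ne',
    div_eq_div_iff (by positivity) hr₀.ne', hmatch]
  ring

variable (hmatch : w s₀ * r₀ = (k + 1) * e p₀ ^ (k + 1))

include hmatch

lemma flux_hasDerivAt (r : ℝ) :
    HasDerivAt (fun ρ => e (vp ρ)) (fluxDeriv e w v vp r₀ k r) r := by
  have hinner : ∀ r ≤ r₀,
      HasDerivWithinAt (fun ρ => e (vp ρ)) (fluxDeriv e w v vp r₀ k r) (Iic r₀) r := fun r hr => by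
    rw [hv.fluxDeriv_of_le h hp₀ hr₀ hmatch hr]
    exact (hasDerivAt_const_mul _).hasDerivWithinAt.congr hv.flux_eq (hv.flux_eq r hr)
  have houter : ∀ r, r₀ ≤ r →
      HasDerivWithinAt (fun ρ => e (vp ρ)) (fluxDeriv e w v vp r₀ k r) (Ici r₀) r := fun r hr => by
    simpa [fluxDeriv, max_eq_left hr] using
      hv.flux_hasDerivWithinAt h hw hp₀ hr₀ k.succ_ne_zero hr
  rcases lt_trichotomy r r₀ with hr | rfl | hr
  · exact (hinner r hr.le).hasDerivAt (Iic_mem_nhds hr)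
  · exact ((hinner r le_rfl).union (houter r le_rfl)).hasDerivAt (by simp)
  · exact (houter r hr.le).hasDerivAt (Ici_mem_nhds hr)

lemma contDiff_flux : ContDiff ℝ 1 fun ρ => e (vp ρ) := by
  have hderiv := hv.flux_hasDerivAt h hw hp₀ hr₀ hmatch
  refine contDiff_one_iff_deriv.2 ⟨fun r => (hderiv r).differentiableAt, ?_⟩
  rw [funext fun r => (hderiv r).deriv]
  exact hv.continuous_fluxDeriv h hw hp₀ hr₀

lemma contDiffOn_two (hA_smooth : ContDiffOn ℝ 1 A (Ioi 0))
    (hA_deriv : ∀ p, 0 < p → 0 < deriv (fun t => t * A t) p) : ContDiffOn ℝ 2 v (Ioi 0) := by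
  have hvp : ContDiffOn ℝ 1 vp (Ioi 0) := fun r hr => by
    have hcomp := (h.contDiffAt_flux_symm hA_smooth hA_deriv (hv.flux_pos h hw hp₀ hr₀ hr)).comp r
      (hv.contDiff_flux h hw hp₀ hr₀ hmatch).contDiffAt
    simpa only [Function.comp_def, e.symm_apply_apply] using hcomp.contDiffWithinAt
  rw [← one_add_one_eq_two, contDiffOn_succ_iff_deriv_of_isOpen isOpen_Ioi]
  exact ⟨fun r _ => (hv.hasDerivAt r).differentiableAt.differentiableWithinAt, by simp,
    hvp.congr fun r _ => (hv.hasDerivAt r).deriv⟩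

omit hmatch in
lemma fluxField_eq (x : EuclideanSpace ℝ (Fin n)) :
    fluxField A (fun y => v ‖y‖) x = (e (vp ‖x‖) / ‖x‖) • x := by
  have h0 := hv.deriv_zero h hr₀.le
  have hnonneg : ∀ r, 0 ≤ r → 0 ≤ vp r := fun r hr => by
    rcases hr.eq_or_lt with rfl | hr
    · exact h0.ge
    · exact (hv.deriv_pos h hw hp₀ hr₀ hr).le
  rw [fluxField_radial (fun r _ => hv.hasDerivAt r) h0 hnonneg,
    h.flux_eq _ (hnonneg _ (norm_nonneg x))]

omit hmatch in
lemma fluxField_eventuallyEq : fluxField A (fun y : EuclideanSpace ℝ (Fin n) => v ‖y‖) =ᶠ[𝓝 0]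
    fun x => (e p₀ / r₀) • x := by
  filter_upwards [Metric.ball_mem_nhds 0 hr₀] with x hx
  rcases eq_or_ne x 0 with rfl | hx0
  · simp [hv.fluxField_eq h hw hp₀ hr₀]
  · rw [hv.fluxField_eq h hw hp₀ hr₀, hv.flux_eq _ (mem_ball_zero_iff.1 hx).le,
      mul_div_cancel_right₀ _ (norm_ne_zero_iff.2 hx0)]

lemma contDiff_fluxField :
    ContDiff ℝ 1 (fluxField A fun y : EuclideanSpace ℝ (Fin n) => v ‖y‖) := by
  refine contDiff_iff_contDiffAt.2 fun x => ?_
  rcases eq_or_ne x 0 with rfl | hx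
  · exact (contDiffAt_id.const_smul (e p₀ / r₀)).congr_of_eventuallyEq
      (hv.fluxField_eventuallyEq h hw hp₀ hr₀)
  · have hnorm : ContDiffAt ℝ 1 (fun y : EuclideanSpace ℝ (Fin n) => ‖y‖) x := contDiffAt_norm ℝ hx
    rw [funext (hv.fluxField_eq h hw hp₀ hr₀)]
    exact (((hv.contDiff_flux h hw hp₀ hr₀ hmatch).contDiffAt.comp x hnorm).div hnorm
      (norm_ne_zero_iff.2 hx)).smul contDiffAt_id

lemma exists_hasFDerivAt_fluxField (hout : ∀ r, r₀ ≤ r →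
      (k + 1) * r ^ k * f (v r) ^ (k + 1) ≤ w (v r)) (hf : IsWeight f) (hf₀ : f s₀ ≤ e p₀ / r₀)
    (x : EuclideanSpace ℝ (Fin (n + 1))) :
    ∃ a b : ℝ, ∃ y : EuclideanSpace ℝ (Fin (n + 1)), 0 < a ∧ 0 < b ∧ ‖y‖ = 1 ∧
      HasFDerivAt (fluxField A fun y => v ‖y‖) (axialMap a b y) x ∧
      f (v ‖x‖) ^ (k + 1) ≤ b * a ^ k := by
  have hinner : ∀ r, 0 ≤ r → r ≤ r₀ → f (v r) ^ (k + 1) ≤ e p₀ / r₀ * (e p₀ / r₀) ^ k :=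
    fun r h0 hr => by
      have hvr : v r ≤ s₀ := hv.value_eq ▸ hv.monotoneOn h hw hp₀ hr₀ h0 hr₀.le hr
      exact (pow_le_pow_left₀ (hf.pos _).le ((hf.monotone hvr).trans hf₀) _).trans_eq
        (pow_succ' _ _)
  have hμ := div_pos (h.flux_pos hp₀) hr₀
  rcases eq_or_ne x 0 with rfl | hx
  · refine ⟨_, _, EuclideanSpace.single 0 1, hμ, hμ, by simp, ?_, by
      simpa using hinner 0 le_rfl hr₀.le⟩
    rw [axialMap_self]
    exact ((hasFDerivAt_id _).const_smul _).congr_of_eventuallyEq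
      (hv.fluxField_eventuallyEq h hw hp₀ hr₀)
  have hr : 0 < ‖x‖ := norm_pos_iff.2 hx
  have hflux := hv.flux_pos h hw hp₀ hr₀ hr
  refine ⟨_, _, _, div_pos hflux hr, hv.fluxDeriv_pos h hw hp₀ hr₀ ‖x‖, norm_inv_norm_smul_self hx,
    ?_, ?_⟩
  · rw [funext (hv.fluxField_eq h hw hp₀ hr₀)]
    exact hasFDerivAt_radialField hx (hv.flux_hasDerivAt h hw hp₀ hr₀ hmatch _)
  rcases le_total ‖x‖ r₀ with hle | hle
  · rw [hv.fluxDeriv_of_le h hp₀ hr₀ hmatch hle, hv.flux_eq _ hle, mul_div_cancel_right₀ _ hr.ne']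
    exact hinner _ hr.le hle
  · have hvalue : fluxDeriv e w v vp r₀ k ‖x‖ * (e (vp ‖x‖) / ‖x‖) ^ k =
        w (v ‖x‖) / ((k + 1) * ‖x‖ ^ k) := by
      rw [fluxDeriv, max_eq_left hle, div_pow]
      field_simp
    rw [hvalue, le_div_iff₀ (by positivity), mul_comm]
    exact hout _ hle

theorem isEntireSolution (hkn : k ≤ n) (hA_smooth : ContDiffOn ℝ 1 A (Ioi 0))
    (hA_deriv : ∀ p, 0 < p → 0 < deriv (fun t => t * A t) p) (hf : IsWeight f)
    (hf₀ : f s₀ ≤ e p₀ / r₀)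
    (hout : ∀ r, r₀ ≤ r → (k + 1) * r ^ k * f (v r) ^ (k + 1) ≤ w (v r)) :
    IsEntireSolution (n + 1) (k + 1) A f fun x => v ‖x‖ :=
  isEntireSolution_of_axialMap hkn hf.pos
    (contDiff_one_radial (fun r _ => hv.hasDerivAt r) hv.continuous (hv.deriv_zero h hr₀.le))
    ((hv.contDiffOn_two h hw hp₀ hr₀ hmatch hA_smooth hA_deriv).comp
      (fun _ hx => (contDiffAt_norm ℝ hx).contDiffWithinAt) fun _ hx => norm_pos_iff.2 hx)
    (hv.contDiff_fluxField h hw hp₀ hr₀ hmatch)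
    (hv.exists_hasFDerivAt_fluxField h hw hp₀ hr₀ hmatch hout hf hf₀)

end IsProfile

namespace IsDelayedRadius

variable {j : ℕ} {R : ℝ → ℝ} (hR : IsDelayedRadius ψ w r₀ p₀ j R)

include hR

lemma exists_isProfile (hw : IsWeight w) (hr₀ : 0 < r₀) (hp₀ : 0 < p₀)
    (h : IsLegendrePair A k e ψ) (htop : Tendsto R atTop atTop) :
    ∃ v vp, IsProfile e ψ (delayWeight w r₀ p₀⁻¹ j R) 0 p₀ r₀ v vp := by
  refine _root_.exists_isProfile h (hR.isWeight hw hr₀ hp₀) hp₀ hr₀.ne'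
    ((tendsto_atTop_add_const_left _ (-r₀) htop).congr' ?_)
  filter_upwards [eventually_ge_atTop 0] with s hs
  rw [hR.eq_integral_of_nonneg hs, neg_add_cancel_left]

lemma apply_value (hv : IsProfile e ψ (delayWeight w r₀ p₀⁻¹ j R) 0 p₀ r₀ v vp) {r : ℝ}
    (hr : r₀ ≤ r) : R (v r) = r := by
  rw [hR.eq_integral_of_nonneg (hv.le_value r hr), hv.radius_eq r hr]

lemma delayWeight_zero (hw : IsWeight w) (hr₀ : 0 < r₀) (hp₀ : 0 < p₀) :
    delayWeight w r₀ p₀⁻¹ j R 0 = (r₀ + p₀⁻¹) ^ j * w 0 := by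
  have hle : R (0 - 1) ≤ R 0 := hR.monotone hw hr₀ hp₀ (by norm_num)
  rw [hR.eq_integral_of_nonneg le_rfl, intervalIntegral.integral_same, add_zero] at hle
  rw [delayWeight, max_eq_right hle]

lemma mul_pow_le_delayWeight (hw : IsWeight w) (hr₀ : 0 < r₀) (hp₀ : 0 < p₀)
    (hv : IsProfile e ψ (delayWeight w r₀ p₀⁻¹ j R) 0 p₀ r₀ v vp) {r : ℝ} (hr : r₀ ≤ r) :
    r ^ j * w (v r) ≤ delayWeight w r₀ p₀⁻¹ j R (v r) := by
  have hdelay := hR.le_delay hw hr₀ hp₀ (v r)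
  rw [hR.apply_value hv hr] at hdelay
  exact mul_le_mul_of_nonneg_right (pow_le_pow_left₀ (hr₀.le.trans hr) hdelay j) (hw.pos _).le

end IsDelayedRadius

lemma exists_pos_mul_add_pow_mul_le (δ F G : ℝ) (k : ℕ) :
    ∃ r : ℝ, 0 < r ∧ r * F ≤ 1 ∧ r * (r + δ) ^ k * G ≤ 1 := by
  have hlin : ContinuousAt (fun r : ℝ => r * F) 0 := by fun_prop
  have hpow : ContinuousAt (fun r : ℝ => r * (r + δ) ^ k * G) 0 := by fun_prop
  obtain ⟨r, hr, hrF, hrG⟩ : ∃ r ∈ Ioi (0 : ℝ), r * F ≤ 1 ∧ r * (r + δ) ^ k * G ≤ 1 :=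
    (Filter.Eventually.and (self_mem_nhdsWithin : Ioi (0 : ℝ) ∈ 𝓝[>] 0) (nhdsWithin_le_nhds
      ((hlin.eventually_le_const (by simp)).and (hpow.eventually_le_const (by simp))))).exists
  exact ⟨r, hr, hrF, hrG⟩

theorem exists_isEntireSolution (h : IsLegendrePair A k e ψ) (hk : 1 ≤ k) (hkn : k ≤ n)
    (hA_smooth : ContDiffOn ℝ 1 A (Ioi 0))
    (hA_deriv : ∀ p, 0 < p → 0 < deriv (fun t => t * A t) p) (hf : IsWeight f) {b c : ℝ}
    (hcb : c ≤ b) (hKO : PsiKellerOsserman A f k c b) :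
    ∃ u : EuclideanSpace ℝ (Fin n) → ℝ, IsEntireSolution n k A f u := by
  obtain ⟨k, rfl⟩ := Nat.exists_eq_add_of_le' hk
  obtain ⟨n, rfl⟩ := Nat.exists_eq_add_of_le' (hk.trans hkn)
  rw [psiKellerOsserman_iff h hf hcb] at hKO
  have hfk := hf.pow (k + 1)
  set p₀ := e.symm 1
  have hflux₀ : e p₀ = 1 := e.apply_symm_apply 1
  have hp₀ : 0 < p₀ := h.flux_symm_zero ▸ e.symm.strictMono one_pos
  obtain ⟨r₀, hr₀, hrF, hrG⟩ := exists_pos_mul_add_pow_mul_le p₀⁻¹ (f 0) (f 0 ^ (k + 1)) k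
  set G := r₀ * (r₀ + p₀⁻¹) ^ k * f 0 ^ (k + 1) with hG_def
  have hG : 0 < G := mul_pos (by positivity) (hfk.pos 0)
  set K := (k + 1) / G with hK_def
  have hK : (k + 1 : ℝ) ≤ K := (le_div_iff₀ hG).2 (mul_le_of_le_one_right (by positivity) hrG)
  have hK₀ : 0 < K := k.cast_add_one_pos.trans_le hK
  have hw := hfk.const_mul hK₀
  obtain ⟨R, hR⟩ := exists_isDelayedRadius (ψ := ψ) hw hr₀ hp₀ k
  have hR_top := hR.tendsto_atTop hw hr₀ hp₀ h (c := c) fun hint =>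
    hKO (h.isKernel.integrableAtFilter_of_const_mul hfk hK₀
      (by simpa only [intervalIntegral.integral_const_mul] using hint))
  obtain ⟨v, vp, hv⟩ := hR.exists_isProfile hw hr₀ hp₀ h hR_top
  refine ⟨_, hv.isEntireSolution h (hR.isWeight hw hr₀ hp₀) hp₀ hr₀ ?_ (Nat.le_of_succ_le_succ hkn)
    hA_smooth hA_deriv hf ?_ fun r hr => ?_⟩
  · rw [hR.delayWeight_zero hw hr₀ hp₀, hflux₀, one_pow, mul_one, hK_def]
    calc (r₀ + p₀⁻¹) ^ k * ((k + 1) / G * f 0 ^ (k + 1)) * r₀ = (k + 1) / G * G := by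
          rw [hG_def]; ring
      _ = k + 1 := div_mul_cancel₀ _ hG.ne'
  · rwa [hflux₀, le_div_iff₀ hr₀, mul_comm]
  · calc (k + 1) * r ^ k * f (v r) ^ (k + 1) ≤ K * r ^ k * f (v r) ^ (k + 1) := by
          have := (hfk.pos (v r)).le
          have := hr₀.le.trans hr
          gcongr
      _ = r ^ k * (K * f (v r) ^ (k + 1)) := by ring
      _ ≤ _ := hR.mul_pow_le_delayWeight hw hr₀ hp₀ hv hr

end Sufficiency

theorem corollary1p4 (n k : ℕ) (hk : 1 ≤ k) (hkn : k ≤ n) (A f : ℝ → ℝ)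
    (hA_pos : ∀ p : ℝ, 0 < p → 0 < A p)
    (hA_smooth : ContDiffOn ℝ 1 A (Set.Ioi 0))
    (hA_cont : ContinuousOn (fun p : ℝ => p * A p) (Set.Ici 0))
    (hA_mono : StrictMonoOn (fun p : ℝ => p * A p) (Set.Ioi 0))
    (hf_cont : Continuous f) (hf_pos : ∀ t : ℝ, 0 < f t) (hf_mono : Monotone f) :
    -- bounded case
    ((∃ L : ℝ, Filter.Tendsto (fun p : ℝ => p * A p) Filter.atTop (nhds L)) →
      ¬ ∃ u : EuclideanSpace ℝ (Fin n) → ℝ, IsEntireSolution n k A f u) ∧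
    -- unbounded case
    (Filter.Tendsto (fun p : ℝ => p * A p) Filter.atTop Filter.atTop →
      ∀ c b : ℝ, 0 < c → c ≤ b →
        ((∃ u : EuclideanSpace ℝ (Fin n) → ℝ, IsEntireSolution n k A f u) →
          PsiKellerOsserman A f k c b) ∧
        ((∀ p : ℝ, 0 < p → 0 < deriv (fun t : ℝ => t * A t) p) →
          PsiKellerOsserman A f k c b →
          ∃ u : EuclideanSpace ℝ (Fin n) → ℝ, IsEntireSolution n k A f u)) ∧
    -- power growth
    (∀ m : ℝ, 1 < m → PowerGrowth A m →
      ∀ c b : ℝ, 0 < c → c ≤ b →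
        ((∃ u : EuclideanSpace ℝ (Fin n) → ℝ, IsEntireSolution n k A f u) →
          PowerKellerOsserman f k m c b) ∧
        ((∀ p : ℝ, 0 < p → 0 < deriv (fun t : ℝ => t * A t) p) →
          PowerKellerOsserman f k m c b →
          ∃ u : EuclideanSpace ℝ (Fin n) → ℝ, IsEntireSolution n k A f u)) := by
  have hf : IsWeight f := ⟨hf_cont, hf_mono, hf_pos⟩
  have hmono := strictMonoOn_mul_Ici hA_pos hA_mono
  have hk₀ := Nat.one_le_iff_ne_zero.1 hk
  have unbounded (ht : Tendsto (fun p => p * A p) atTop atTop) {c b : ℝ} (hcb : c ≤ b) :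
      ((∃ u : EuclideanSpace ℝ (Fin n) → ℝ, IsEntireSolution n k A f u) →
        PsiKellerOsserman A f k c b) ∧
      ((∀ p, 0 < p → 0 < deriv (fun t => t * A t) p) → PsiKellerOsserman A f k c b →
        ∃ u : EuclideanSpace ℝ (Fin n) → ℝ, IsEntireSolution n k A f u) := by
    obtain ⟨e, ψ, h⟩ := exists_isLegendrePair hk₀ hmono hA_cont ht
    exact ⟨fun ⟨_, hu⟩ => hu.psiKellerOsserman h hk hkn hA_pos hA_smooth hf hcb,
      fun hA_deriv hKO => exists_isEntireSolution h hk hkn hA_smooth hA_deriv hf hcb hKO⟩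
  refine ⟨?_, fun ht c b _ hcb => unbounded ht hcb, fun m hm hA c b _ hcb => ?_⟩
  · rintro ⟨L, hL⟩ ⟨u, hu⟩
    have hle : ∀ p, 0 ≤ p → p * A p ≤ L := fun p hp => ge_of_tendsto hL <| by
      filter_upwards [eventually_ge_atTop p] with q hq using hmono.monotoneOn hp (hp.trans hq) hq
    exact not_isEntireSolution_of_flux_le hk₀ hf hA_pos hle hu
  · have ht := hA.tendsto hm hA_pos
    obtain ⟨e, ψ, h⟩ := exists_isLegendrePair hk₀ hmono hA_cont ht
    rw [h.powerKellerOsserman_iff_psiKellerOsserman hk hm hA hf hcb]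
    exact unbounded ht hcb
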